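/- Let $K=\mathrm{GF}(q)$ be a finite field of odd characteristic, let $V$ be a vector space over $K$ of finite dimension $2n$, and let $f$ be a nondegenerate alternating bilinear form on $V$. Let $\mathrm{Sp}(V)=\mathrm{Sp}(V,f)$ be the symplectic group and $\mathrm{PSp}(V)=\mathrm{Sp}(V)/\{\pm 1\}$ (also written $\mathrm{PSp}(2n,q)$). An element $g$ of a group is called reversible if it is conjugate in that group to $g^{-1}$, and bireflectional if $g=st$ for elements $s,t$ of the group with $s^2=t^2=1$ (that is, $g$ is a product of at most two involutions). The elementary divisors of $\varphi\in\mathrm{Sp}(V)$ are the prime powers $p^e$ ($p\in K[x]$ monic irreducible, $e\ge 1$) in a decomposition of $V$, as a $K[x]$-module with $x$ acting as $\varphi$, into a direct sum of cyclic modules $K[x]/(p^e)$, counted with multiplicity. (a) Suppose that $q\equiv 3 \pmod 4$, and let $\varphi\in\mathrm{Sp}(V)$. Then the image of $\varphi$ in $\mathrm{PSp}(V)$ is reversible but not bireflectional if and only if the following three conditions hold: 1. $\varphi$ is conjugate to $-\varphi^{-1}$ in $\mathrm{Sp}(V)$; 2. for some integer $t\ge 1$, the elementary divisor $(x^2+1)^{2t}$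 of $\varphi$ occurs with odd multiplicity; 3. for some integer $t\ge 1$, the elementary divisor $(x-1)^{2t}$ of $\varphi$ occurs with odd multiplicity. (The integers $t$ in 2 and 3 may be different.) (b) For every odd prime power $q$ and every $n$, the group $\mathrm{PSp}(2n,q)$ contains an element that is reversible but not bireflectional if and only if $q\equiv 3\pmod 4$ and $2n\ge 8$. -/

import Mathlib

open Polynomial DirectSum

/-- An element of a group is reversible if it is conjugate to its inverse. -/
def IsReversible {G : Type*} [Group G] (g : G) : Prop :=
  IsConj g g⁻¹

/-- An element of a group is bireflectional if it is a product of (at most) two involutions.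
Factors equal to `1` are allowed, so this is "`g = s * t` with `s ^ 2 = t ^ 2 = 1`". -/
def IsBireflectional {G : Type*} [Group G] (g : G) : Prop :=
  ∃ s t : G, s ^ 2 = 1 ∧ t ^ 2 = 1 ∧ g = s * t

section Symplectic

variable {K V : Type*} [Field K] [AddCommGroup V] [Module K V]

/-- The group `Sp(V, f)` of all invertible linear transformations of `V` preserving the form `f`
(it is the symplectic group when `f` is alternating and nondegenerate). -/
def Sp (f : LinearMap.BilinForm K V) : Subgroup (V ≃ₗ[K] V) where
  carrier := {φ | ∀ u w, f (φ u) (φ w) = f u w}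
  mul_mem' := by
    intro a b ha hb u w
    simp only [Set.mem_ofPred_eq, LinearEquiv.mul_apply] at *
    rw [ha, hb]
  one_mem' := by
    intro u w
    rfl
  inv_mem' := by
    intro a ha u w
    have h := ha (a⁻¹ u) (a⁻¹ w)
    rw [← LinearEquiv.mul_apply, ← LinearEquiv.mul_apply, mul_inv_cancel] at h
    exact h.symm

/-- The negative `-φ : v ↦ -φ v` of an element of `Sp(V, f)`. -/
instance Sp.instNeg (f : LinearMap.BilinForm K V) : Neg (Sp f) where
  neg φ := ⟨LinearEquiv.neg K * (φ : V ≃ₗ[K] V), by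
    intro u w
    simpa using φ.2 u w⟩

theorem Sp.coe_neg_apply {f : LinearMap.BilinForm K V} (φ : Sp f) (v : V) :
    ((-φ : Sp f) : V ≃ₗ[K] V) v = -((φ : V ≃ₗ[K] V) v) :=
  rfl

theorem Sp.ext_apply {f : LinearMap.BilinForm K V} {φ ψ : Sp f}
    (h : ∀ v, (φ : V ≃ₗ[K] V) v = (ψ : V ≃ₗ[K] V) v) : φ = ψ :=
  Subtype.ext (LinearEquiv.ext h)

/-- The subgroup `{1, -1}` of `Sp(V, f)`. -/
def Sp.plusMinusOne (f : LinearMap.BilinForm K V) : Subgroup (Sp f) where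
  carrier := {1, -1}
  mul_mem' := by
    rintro a b (rfl | rfl) (rfl | rfl)
    · left; exact one_mul _
    · right; exact one_mul _
    · right; exact mul_one _
    · left
      refine Sp.ext_apply fun v => ?_
      change -(-v) = v
      exact neg_neg v
  one_mem' := Or.inl rfl
  inv_mem' := by
    rintro a (rfl | rfl)
    · left; exact inv_one
    · right
      refine inv_eq_of_mul_eq_one_left (Sp.ext_apply fun v => ?_)
      change -(-v) = v
      exact neg_neg v

instance Sp.plusMinusOne_normal (f : LinearMap.BilinForm K V) :
    (Sp.plusMinusOne f).Normal where
  conj_mem := by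
    rintro a (rfl | rfl) g
    · left; simp
    · right
      refine mul_inv_eq_of_eq_mul (Sp.ext_apply fun v => ?_)
      change (g : V ≃ₗ[K] V) (-v) = -((g : V ≃ₗ[K] V) v)
      exact map_neg _ v

/-- The projective symplectic group `PSp(V, f) = Sp(V, f) / {1, -1}`. -/
abbrev PSp (f : LinearMap.BilinForm K V) : Type _ :=
  Sp f ⧸ Sp.plusMinusOne f

/-- The image of `φ ∈ Sp(V, f)` in `PSp(V, f)`. -/
def Sp.toPSp {f : LinearMap.BilinForm K V} (φ : Sp f) : PSp f :=
  QuotientGroup.mk' (Sp.plusMinusOne f) φ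

end Symplectic

section ElementaryDivisors

variable {K V : Type*} [Field K] [AddCommGroup V] [Module K V]

/-- `S` is the multiset of elementary divisors of the endomorphism `φ`: the members of `S` are
powers `p ^ e`, `e ≥ 1`, of monic irreducible polynomials, and `V`, regarded as a `K[x]`-module
with `x` acting as `φ`, is isomorphic to the direct sum of the cyclic modules `K[x] / (p ^ e)`. -/
def IsElementaryDivisors (φ : Module.End K V) (S : Multiset K[X]) : Prop :=
  ∃ (N : ℕ) (p : Fin N → K[X]) (e : Fin N → ℕ),
    (∀ i, Irreducible (p i) ∧ (p i).Monic ∧ 1 ≤ e i) ∧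
    S = Finset.univ.val.map (fun i => p i ^ e i) ∧
    Nonempty (Module.AEval' φ ≃ₗ[K[X]] ⨁ i, K[X] ⧸ Ideal.span {p i ^ e i})

theorem exists_isElementaryDivisors [FiniteDimensional K V] (φ : Module.End K V) :
    ∃ S, IsElementaryDivisors φ S := by
  classical
  obtain ⟨ι, _, p, hp, e, ⟨E⟩⟩ := Module.equiv_directSum_of_isTorsion
    (R := K[X]) (M := Module.AEval' φ) (Module.AEval.isTorsion_of_finiteDimensional K V φ)
  let κ := {i : ι // e i ≠ 0}
  let E1 : (⨁ i, K[X] ⧸ Ideal.span {p i ^ e i}) ≃ₗ[K[X]] (∀ i, K[X] ⧸ Ideal.span {p i ^ e i}) :=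
    DirectSum.linearEquivFunOnFintype K[X] ι _
  let r : (∀ i, K[X] ⧸ Ideal.span {p i ^ e i}) →ₗ[K[X]]
      (∀ k : κ, K[X] ⧸ Ideal.span {p k.1 ^ e k.1}) :=
    LinearMap.pi fun k => LinearMap.proj k.1
  have hr : Function.Bijective r := by
    constructor
    · rw [← LinearMap.ker_eq_bot, LinearMap.ker_eq_bot']
      intro m hm
      funext i
      by_cases hi : e i = 0
      · have : Subsingleton (K[X] ⧸ Ideal.span {p i ^ e i}) := by
          rw [Ideal.Quotient.subsingleton_iff, hi, pow_zero, Ideal.span_singleton_one]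
        exact Subsingleton.elim _ _
      · exact congrFun hm ⟨i, hi⟩
    · intro m
      refine ⟨fun i => if hi : e i ≠ 0 then m ⟨i, hi⟩ else 0, ?_⟩
      funext k
      exact dif_pos k.2
  let s : Fin (Fintype.card κ) ≃ κ := (Fintype.equivFin κ).symm
  have hspan : ∀ k : κ, Ideal.span {p k.1 ^ e k.1} = Ideal.span {normalize (p k.1) ^ e k.1} :=
    fun k => Ideal.span_singleton_eq_span_singleton.mpr
      ((associated_normalize (p k.1)).pow_pow)
  let E2 : (∀ k : κ, K[X] ⧸ Ideal.span {p k.1 ^ e k.1}) ≃ₗ[K[X]]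
      (∀ k : κ, K[X] ⧸ Ideal.span {normalize (p k.1) ^ e k.1}) :=
    LinearEquiv.piCongrRight fun k => Submodule.quotEquivOfEq _ _ (hspan k)
  let E3 : (∀ k : κ, K[X] ⧸ Ideal.span {normalize (p k.1) ^ e k.1}) ≃ₗ[K[X]]
      (∀ j, K[X] ⧸ Ideal.span {normalize (p (s j).1) ^ e (s j).1}) :=
    (LinearEquiv.piCongrLeft K[X]
      (fun k : κ => K[X] ⧸ Ideal.span {normalize (p k.1) ^ e k.1}) s).symm
  let E4 := (DirectSum.linearEquivFunOnFintype K[X] (Fin (Fintype.card κ))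
    (fun j => K[X] ⧸ Ideal.span {normalize (p (s j).1) ^ e (s j).1})).symm
  refine ⟨_, Fintype.card κ, fun j => normalize (p (s j).1), fun j => e (s j).1, fun j => ?_, rfl,
    ⟨E ≪≫ₗ E1 ≪≫ₗ LinearEquiv.ofBijective r hr ≪≫ₗ E2 ≪≫ₗ E3 ≪≫ₗ E4⟩⟩
  exact ⟨(associated_normalize _).irreducible (hp _), Polynomial.monic_normalize (hp _).ne_zero,
    Nat.one_le_iff_ne_zero.mpr (s j).2⟩

/-- The multiset of elementary divisors of an endomorphism of a finite-dimensional space. -/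
noncomputable def elementaryDivisors [FiniteDimensional K V] (φ : Module.End K V) :
    Multiset K[X] :=
  (exists_isElementaryDivisors φ).choose

open Classical in
/-- The multiplicity with which `d` occurs among the elementary divisors of `φ ∈ Sp(V, f)`
(it is `0` if `d` is not an elementary divisor of `φ`). -/
noncomputable def Sp.elemDivMult [FiniteDimensional K V] {f : LinearMap.BilinForm K V}
    (φ : Sp f) (d : K[X]) : ℕ :=
  (elementaryDivisors ((φ : V ≃ₗ[K] V) : V →ₗ[K] V)).count d

end ElementaryDivisors

/-!
Write `a*` for the adjoint of an operator `a` with respect to `f`. An element `φ` of `Sp f` has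
`φ* = φ⁻¹`, so `D = φ - φ⁻¹` is skew-adjoint, `S = φ + φ⁻¹` is self-adjoint, the two commute, and
`D ^ 2 = S ^ 2 - 4`. The image of `φ` in the projective group is a product of two involutions if and only
if some `s` in `Sp f` with `s ^ 2 = ±1` conjugates `φ` to `φ⁻¹` or to `-φ⁻¹`
(`Sp.isBireflectional_toPSp_iff`); it is reversible if and only if `φ` is conjugate to one of these.
In terms of `D` and `S`, inverting `φ` means anticommuting with `D` and commuting with `S`, and
conjugating `φ` to `-φ⁻¹` means commuting with `D` and anticommuting with `S`. Such an `s` is built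
on mutually orthogonal invariant subspaces of `V`, one after the other (`exists_isTwist_of_strip`).

*Inverting `φ`.* Where `D` is injective, an involution of multiplier `-1` which anticommutes with
`D` and commutes with `S` is multiplied by an element `a(S) + D b(S)` of multiplier `-1`; finiteness
of `K` makes the norm equation for it solvable (`exists_isTwist_of_injective`). Where `D` is
nilpotent, `φ` has only the eigenvalues `±1`. Jordan blocks of odd size come in dual pairs, which
are interchanged; a block of even size carries the symmetric form `f (D ^ j u) v`, and two such
blocks admit an isometry of square `-1` (`exists_isTwist_of_nilpotent`). Hence `φ` is inverted by
some `s` with `s ^ 2 = -1` if `-1` is a square in `K` or if Jordan blocks of each even size occur an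
even number of times for both eigenvalues (`IsIsometryPair.exists_isTwist_inverting`). Conversely,
an isometry inverting `φ` changes the sign of the symmetric form `f (D ^ j u) v`, whose rank is the
number of blocks of size `j + 1`, so this number is even if `-1` is not a square
(`even_jordanCount_of_twist`).

*Conjugating `φ` to `-φ⁻¹`.* If `φ` is conjugate to `-φ⁻¹`, then where `S` is injective an
involution always does it (`IsSumDiff.exists_isTwist_of_even`,
`IsSumDiff.exists_isTwist_of_coprime`): a primary component of `S` is either interchanged with
another one by `x ↦ -x`, or it belongs to an even polynomial, and then `D` is `±δ(S)` on
suitable cyclic modules for a polynomial `δ` that is even or odd. Where `S` is nilpotent,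
`φ ^ 2 + 1 = φ S` is so as well, and an involution exists if the Jordan blocks of `S` of each even
size occur with multiplicity divisible by `4` (`IsSumDiff.exists_isTwist_of_nilpotent`). If `-1` is
not a square, this condition is also necessary for any `s` with `s ^ 2 = ±1`: on the space carrying
the form `f (S ^ j u) v`, the operator `D / 2` has square `-1` and commutes with a skew-adjoint
involution (`IsSumDiff.four_dvd_jordanCount`).

The multiplicity of the elementary divisor `p ^ e` times the degree of `p` is the number of Jordan
blocks of size `e` of `p(φ)` (`IsElementaryDivisors.count_mul_natDegree`), so the obstructions
become the odd multiplicities of `(x ^ 2 + 1) ^ (2 t)` and of `(x - 1) ^ (2 t)`; if `φ` is conjugate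
to `-φ⁻¹`, the eigenvalues `1` and `-1` behave alike. Then `(x - 1) ^ (2 t)`, `(x + 1) ^ (2 t)` and
`(x ^ 2 + 1) ^ (2 t')` are three elementary divisors of total degree at least `8`
(`Sp.eight_le_finrank`), and in dimension at least `8` an explicit isometry realises the conditions
(`Sp.exists_isConj_neg_inv`).
-/

/-! ### Nondegenerate subspaces and their orthogonal complements -/

section Twist

variable {K V : Type*} [Field K] [AddCommGroup V] [Module K V]

/-- The form `f` is nondegenerate on the subspace `W`. Only the left radical is mentioned; all
forms below are reflexive. -/
def IsNondegOn (f : LinearMap.BilinForm K V) (W : Submodule K V) : Prop :=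
  ∀ u ∈ W, (∀ v ∈ W, f u v = 0) → u = 0

theorem IsNondegOn.isCompl [FiniteDimensional K V] {f : LinearMap.BilinForm K V} (hf : f.IsRefl)
    {W : Submodule K V} (hW : IsNondegOn f W) : IsCompl W (f.orthogonal W) := by
  rw [LinearMap.BilinForm.isCompl_orthogonal_iff_disjoint hf, Submodule.disjoint_def]
  exact fun x hx hx' => hW x hx fun v hv => hf _ _ (hx' v hv)

theorem isNondegOn_top {f : LinearMap.BilinForm K V} (hf : f.Nondegenerate) :
    IsNondegOn f ⊤ := fun u _ h => hf.1 u fun v => h v trivial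

theorem IsNondegOn.exists_sub_mem [FiniteDimensional K V] {f : LinearMap.BilinForm K V}
    (hf : f.IsRefl) {W₁ W : Submodule K V} (hW₁ : IsNondegOn f W₁) (hle : W₁ ≤ W) {x : V}
    (hx : x ∈ W) : ∃ y ∈ W₁, x - y ∈ W ⊓ f.orthogonal W₁ := by
  have hx' : x ∈ W₁ ⊔ f.orthogonal W₁ := by rw [(hW₁.isCompl hf).sup_eq_top]; trivial
  obtain ⟨y, hy, z, hz, rfl⟩ := Submodule.mem_sup.1 hx'
  refine ⟨y, hy, W.sub_mem hx (hle hy), ?_⟩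
  simpa using hz

theorem IsNondegOn.compl [FiniteDimensional K V] {f : LinearMap.BilinForm K V} (hf : f.IsRefl)
    {W₁ W : Submodule K V} (hW₁ : IsNondegOn f W₁) (hW : IsNondegOn f W) (hle : W₁ ≤ W) :
    IsNondegOn f (W ⊓ f.orthogonal W₁) := by
  rintro u ⟨hu, hu'⟩ h
  refine hW u hu fun v hv => ?_
  obtain ⟨y, hy, hvy⟩ := hW₁.exists_sub_mem hf hle hv
  have h1 := h _ hvy
  have h2 : f u y = 0 := hf _ _ (hu' y hy)
  simpa [h2] using h1

theorem IsNondegOn.sup_compl [FiniteDimensional K V] {f : LinearMap.BilinForm K V} (hf : f.IsRefl)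
    {W₁ W : Submodule K V} (hW₁ : IsNondegOn f W₁) (hle : W₁ ≤ W) :
    W₁ ⊔ (W ⊓ f.orthogonal W₁) = W := by
  refine le_antisymm (sup_le hle inf_le_left) fun x hx => ?_
  obtain ⟨y, hy, hxy⟩ := hW₁.exists_sub_mem hf hle hx
  exact Submodule.mem_sup.2 ⟨y, hy, _, hxy, by simp⟩

theorem IsNondegOn.disjoint_compl {f : LinearMap.BilinForm K V} (hf : f.IsRefl)
    {W₁ : Submodule K V} (hW₁ : IsNondegOn f W₁) (W : Submodule K V) :
    Disjoint W₁ (W ⊓ f.orthogonal W₁) := by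
  rw [Submodule.disjoint_def]
  exact fun x hx hx' => hW₁ x hx fun v hv => hf _ _ (hx'.2 v hv)

theorem IsNondegOn.exists_repr [FiniteDimensional K V] {f : LinearMap.BilinForm K V}
    (hf : f.IsRefl) {W : Submodule K V} (hW : IsNondegOn f W) (l : V →ₗ[K] K) :
    ∃ v ∈ W, ∀ u ∈ W, f u v = l u := by
  let F : W →ₗ[K] Module.Dual K W := (W.subtype.dualMap.comp f.flip).comp W.subtype
  have hinj : Function.Injective F := by
    rw [← LinearMap.ker_eq_bot, LinearMap.ker_eq_bot']
    intro m hm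
    refine Subtype.ext (hW m m.2 fun v hv => hf _ _ ?_)
    exact LinearMap.congr_fun hm ⟨v, hv⟩
  obtain ⟨v, hv⟩ := (LinearMap.injective_iff_surjective_of_finrank_eq_finrank
    (Subspace.dual_finrank_eq (K := K) (V := W)).symm).1 hinj (W.subtype.dualMap l)
  exact ⟨v, v.2, fun u hu => LinearMap.congr_fun hv ⟨u, hu⟩⟩

/-! ### Twists: similitudes that normalise given operators up to scalars -/

/-- `s` is an `(η, ε)`-twist of the family `𝒜` on the subspace `W`: it maps `W` to itself,
multiplies the form by `η`, has square `ε`, and satisfies `s A = c A s` on `W` for each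
`(A, c) ∈ 𝒜`. Only the values of `s` on `W` matter. -/
structure IsTwist (f : LinearMap.BilinForm K V) (η ε : K) (𝒜 : Set (Module.End K V × K))
    (W : Submodule K V) (s : Module.End K V) : Prop where
  mapsTo : ∀ u ∈ W, s u ∈ W
  form : ∀ u ∈ W, ∀ v ∈ W, f (s u) (s v) = η * f u v
  sq : ∀ u ∈ W, s (s u) = ε • u
  comm : ∀ p ∈ 𝒜, ∀ u ∈ W, s (p.1 u) = p.2 • p.1 (s u)

/-- `W` is nondegenerate for `f` and invariant under the operators occurring in `𝒜`. -/
structure IsAdapted (f : LinearMap.BilinForm K V) (𝒜 : Set (Module.End K V × K))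
    (W : Submodule K V) : Prop where
  nondeg : IsNondegOn f W
  inv : ∀ p ∈ 𝒜, ∀ u ∈ W, p.1 u ∈ W

/-- Each operator in `𝒜` is proportional to its `f`-adjoint. -/
def HasScalarAdjoints (f : LinearMap.BilinForm K V) (𝒜 : Set (Module.End K V × K)) : Prop :=
  ∀ p ∈ 𝒜, ∃ c : K, ∀ u v, f u (p.1 v) = c * f (p.1 u) v

theorem IsAdapted.compl [FiniteDimensional K V] {f : LinearMap.BilinForm K V} (hf : f.IsRefl)
    {𝒜 : Set (Module.End K V × K)} (h𝒜 : HasScalarAdjoints f 𝒜) {W₁ W : Submodule K V}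
    (hW₁ : IsAdapted f 𝒜 W₁) (hW : IsAdapted f 𝒜 W) (hle : W₁ ≤ W) :
    IsAdapted f 𝒜 (W ⊓ f.orthogonal W₁) := by
  refine ⟨hW₁.nondeg.compl hf hW.nondeg hle, fun p hp u hu => ⟨hW.inv p hp u hu.1, fun n hn => ?_⟩⟩
  obtain ⟨c, hc⟩ := h𝒜 p hp
  have h : f (p.1 n) u = 0 := hu.2 _ (hW₁.inv p hp n hn)
  change f n (p.1 u) = 0
  rw [hc, h, mul_zero]

theorem IsTwist.glue [FiniteDimensional K V] {f : LinearMap.BilinForm K V} (hf : f.IsRefl)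
    {η ε : K} {𝒜 : Set (Module.End K V × K)} {W₁ W : Submodule K V}
    (h𝒜 : HasScalarAdjoints f 𝒜)
    (hW₁ : IsAdapted f 𝒜 W₁) (hW : IsAdapted f 𝒜 W) (hle : W₁ ≤ W) {s₁ s₂ : Module.End K V}
    (h₁ : IsTwist f η ε 𝒜 W₁ s₁) (h₂ : IsTwist f η ε 𝒜 (W ⊓ f.orthogonal W₁) s₂) :
    ∃ s, IsTwist f η ε 𝒜 W s := by
  have hW₂ := hW₁.compl hf h𝒜 hW hle
  set W₂ := W ⊓ f.orthogonal W₁ with hW₂def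
  have hc := hW₁.nondeg.isCompl hf
  let P : Module.End K V := W₁.subtype ∘ₗ Submodule.projectionOnto _ _ hc
  have hP1 : ∀ x ∈ W₁, P x = x := fun x hx => by
    simpa [P] using congrArg Subtype.val (Submodule.projectionOnto_apply_left hc ⟨x, hx⟩)
  have hP2 : ∀ x ∈ W₂, P x = 0 := fun x hx => by
    simpa [P] using (Submodule.projectionOnto_apply_eq_zero_iff hc).2 hx.2
  let s : Module.End K V := s₁ ∘ₗ P + s₂ ∘ₗ (LinearMap.id - P)
  have hs1 : ∀ x ∈ W₁, s x = s₁ x := fun x hx => by simp [s, hP1 x hx]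
  have hs2 : ∀ x ∈ W₂, s x = s₂ x := fun x hx => by simp [s, hP2 x hx]
  have hdec : ∀ x ∈ W, ∃ y ∈ W₁, ∃ z ∈ W₂, x = y + z := fun x hx => by
    obtain ⟨y, hy, hxy⟩ := hW₁.nondeg.exists_sub_mem hf hle hx
    exact ⟨y, hy, _, hxy, by simp⟩
  have horth : ∀ y ∈ W₁, ∀ z ∈ W₂, f y z = 0 := fun y hy z hz => hz.2 y hy
  refine ⟨s, fun u hu => ?_, fun u hu v hv => ?_, fun u hu => ?_, fun p hp u hu => ?_⟩
  · obtain ⟨y, hy, z, hz, rfl⟩ := hdec u hu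
    rw [map_add, hs1 y hy, hs2 z hz]
    exact W.add_mem (hle (h₁.mapsTo y hy)) (h₂.mapsTo z hz).1
  · obtain ⟨y, hy, z, hz, rfl⟩ := hdec u hu
    obtain ⟨y', hy', z', hz', rfl⟩ := hdec v hv
    simp only [map_add, hs1 y hy, hs2 z hz, hs1 y' hy', hs2 z' hz', LinearMap.add_apply]
    rw [h₁.form y hy y' hy', h₂.form z hz z' hz', horth _ hy _ hz', hf _ _ (horth _ hy' _ hz),
      horth _ (h₁.mapsTo y hy) _ (h₂.mapsTo z' hz'),
      hf _ _ (horth _ (h₁.mapsTo y' hy') _ (h₂.mapsTo z hz))]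
    ring
  · obtain ⟨y, hy, z, hz, rfl⟩ := hdec u hu
    rw [map_add, hs1 y hy, hs2 z hz, map_add, hs1 _ (h₁.mapsTo y hy), hs2 _ (h₂.mapsTo z hz),
      h₁.sq y hy, h₂.sq z hz, smul_add]
  · obtain ⟨y, hy, z, hz, rfl⟩ := hdec u hu
    rw [map_add, map_add, map_add, hs1 y hy, hs2 z hz, hs1 _ (hW₁.inv p hp y hy),
      hs2 _ (hW₂.inv p hp z hz), h₁.comm p hp y hy, h₂.comm p hp z hz, map_add, smul_add]

theorem IsNondegOn.finrank_compl_lt [FiniteDimensional K V] {f : LinearMap.BilinForm K V}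
    (hf : f.IsRefl) {W₁ W : Submodule K V} (hW₁ : IsNondegOn f W₁) (hle : W₁ ≤ W) (hne : W₁ ≠ ⊥) :
    Module.finrank K (W ⊓ f.orthogonal W₁ : Submodule K V) < Module.finrank K W := by
  refine Submodule.finrank_lt_finrank_of_lt (lt_of_le_of_ne inf_le_left fun h => hne ?_)
  have := hW₁.disjoint_compl hf W
  rw [h] at this
  exact (Submodule.eq_bot_iff _).2 fun x hx => (Submodule.disjoint_def.1 this) x hx (hle hx)

/-- Twists are built by splitting off adapted subspaces one after the other: `Good` is the
hypothesis that is passed on to the orthogonal complement. -/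
theorem exists_isTwist_of_strip [FiniteDimensional K V] {f : LinearMap.BilinForm K V}
    (hf : f.IsRefl) {η ε : K} {𝒜 : Set (Module.End K V × K)} (h𝒜 : HasScalarAdjoints f 𝒜)
    (Good : Submodule K V → Prop)
    (h : ∀ W, Good W → IsAdapted f 𝒜 W → W ≠ ⊥ → ∃ W₁ ≤ W, W₁ ≠ ⊥ ∧ IsAdapted f 𝒜 W₁ ∧
      (∃ s, IsTwist f η ε 𝒜 W₁ s) ∧ Good (W ⊓ f.orthogonal W₁))
    (W : Submodule K V) (hG : Good W) (hW : IsAdapted f 𝒜 W) : ∃ s, IsTwist f η ε 𝒜 W s := by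
  induction hn : Module.finrank K W using Nat.strong_induction_on generalizing W with
  | _ n ih =>
    by_cases hbot : W = ⊥
    · subst hbot
      exact ⟨0, by simp, by simp, by simp, by simp⟩
    · obtain ⟨W₁, hle, hne, hW₁, ⟨s₁, hs₁⟩, hG'⟩ := h W hG hW hbot
      obtain ⟨s₂, hs₂⟩ := ih _ (hn ▸ hW₁.nondeg.finrank_compl_lt hf hle hne) _ hG'
        (hW₁.compl hf h𝒜 hW hle) rfl
      exact hs₁.glue hf h𝒜 hW₁ hW hle hs₂

/-! ### Linear maps prescribed on generators -/

theorem exists_linearMap_comp_eq {X Y Z : Type*} [AddCommGroup X] [Module K X] [AddCommGroup Y]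
    [Module K Y] [AddCommGroup Z] [Module K Z] (F : X →ₗ[K] Y) (G : X →ₗ[K] Z)
    (h : ∀ x, F x = 0 → G x = 0) : ∃ T : Y →ₗ[K] Z, ∀ x, T (F x) = G x := by
  obtain ⟨S, hS⟩ := F.rangeRestrict.exists_rightInverse_of_surjective F.range_rangeRestrict
  obtain ⟨T, hT⟩ := (G ∘ₗ S).exists_extend
  refine ⟨T, fun x => ?_⟩
  have h1 : T (F x) = G (S ⟨F x, x, rfl⟩) := LinearMap.congr_fun hT ⟨F x, x, rfl⟩
  have h2 : F (S ⟨F x, x, rfl⟩) = F x :=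
    congrArg Subtype.val (LinearMap.congr_fun hS ⟨F x, x, rfl⟩)
  have h3 := h (S ⟨F x, x, rfl⟩ - x) (by rw [map_sub, h2, sub_self])
  rw [h1, ← sub_eq_zero, ← map_sub, h3]

/-- If two families have proportional Gram matrices and the second spans a nondegenerate subspace,
then the first can be mapped linearly to the second: a linear relation of the first family becomes
a vector in the radical of the second span. -/
theorem exists_linearMap_of_gram {ι : Type*} {f : LinearMap.BilinForm K V} (w w' : ι → V) (η : K)
    (hnd : IsNondegOn f (Submodule.span K (Set.range w')))
    (hgram : ∀ i j, f (w' i) (w' j) = η * f (w i) (w j)) :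
    ∃ s : Module.End K V, ∀ i, s (w i) = w' i := by
  have key : ∀ (x y : ι →₀ K), f (Finsupp.linearCombination K w' x)
      (Finsupp.linearCombination K w' y) =
      η * f (Finsupp.linearCombination K w x) (Finsupp.linearCombination K w y) := by
    intro x y
    simp only [Finsupp.linearCombination_apply, Finsupp.sum, map_sum, LinearMap.sum_apply,
      map_smul, LinearMap.smul_apply, smul_eq_mul, hgram, Finset.mul_sum]
    exact Finset.sum_congr rfl fun i _ => Finset.sum_congr rfl fun j _ => by ring
  obtain ⟨s, hs⟩ := exists_linearMap_comp_eq (Finsupp.linearCombination K w)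
    (Finsupp.linearCombination K w') fun x hx => by
      refine hnd _ (Finsupp.range_linearCombination K (v := w') ▸ ⟨x, rfl⟩) fun v hv => ?_
      rw [← Finsupp.range_linearCombination] at hv
      obtain ⟨y, rfl⟩ := hv
      rw [key, hx]
      simp
  exact ⟨s, fun i => by simpa using hs (Finsupp.single i 1)⟩

theorem form_eq_on_span {ι : Type*} {f : LinearMap.BilinForm K V} (w : ι → V) (η : K)
    (s : Module.End K V) (h : ∀ i j, f (s (w i)) (s (w j)) = η * f (w i) (w j)) :
    ∀ u ∈ Submodule.span K (Set.range w), ∀ v ∈ Submodule.span K (Set.range w),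
      f (s u) (s v) = η * f u v := by
  intro u hu v hv
  induction hu using Submodule.span_induction with
  | mem x hx =>
    obtain ⟨i, rfl⟩ := hx
    induction hv using Submodule.span_induction with
    | mem y hy => obtain ⟨j, rfl⟩ := hy; exact h i j
    | zero => simp
    | add y z _ _ hy hz => simp only [map_add, hy, hz, mul_add]
    | smul c y _ hy => simp only [map_smul, hy, smul_eq_mul]; ring
  | zero => simp
  | add y z _ _ hy hz => simp only [map_add, LinearMap.add_apply, hy, hz, mul_add]
  | smul c y _ hy => simp only [map_smul, LinearMap.smul_apply, hy, smul_eq_mul]; ring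

/-- A twist on the span of a nondegenerate family may be prescribed on the family itself, as soon
as the Gram matrices match. -/
theorem exists_isTwist_on_span {ι : Type*} {f : LinearMap.BilinForm K V} (w w' : ι → V) (η ε : K)
    (𝒜 : Set (Module.End K V × K)) (W : Submodule K V)
    (hw : Submodule.span K (Set.range w) = W) (hw' : Submodule.span K (Set.range w') = W)
    (hnd : IsNondegOn f W)
    (hgram : ∀ i j, f (w' i) (w' j) = η * f (w i) (w j))
    (hsq : ∀ s : Module.End K V, (∀ i, s (w i) = w' i) → ∀ i, s (w' i) = ε • w i)
    (hcomm : ∀ s : Module.End K V, (∀ i, s (w i) = w' i) →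
      ∀ p ∈ 𝒜, ∀ i, s (p.1 (w i)) = p.2 • p.1 (w' i)) :
    ∃ s, (∀ i, s (w i) = w' i) ∧ IsTwist f η ε 𝒜 W s := by
  subst hw
  obtain ⟨s, hs⟩ := exists_linearMap_of_gram w w' η (hw' ▸ hnd) hgram
  refine ⟨s, hs, fun u hu => ?_, form_eq_on_span w η s fun i j => by rw [hs, hs, hgram],
    fun u hu => ?_, fun p hp u hu => ?_⟩
  · have : Submodule.span K (Set.range w) ≤ (Submodule.span K (Set.range w)).comap s := by
      rw [Submodule.span_le]
      rintro _ ⟨i, rfl⟩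
      rw [← hw', SetLike.mem_coe, Submodule.mem_comap, hs]
      exact Submodule.subset_span ⟨i, rfl⟩
    exact this hu
  · have : Set.EqOn (s ∘ₗ s) (ε • LinearMap.id : Module.End K V)
        (Submodule.span K (Set.range w)) := by
      refine LinearMap.eqOn_span ?_
      rintro _ ⟨i, rfl⟩
      simp [hs, hsq s hs]
    exact this hu
  · have : Set.EqOn (s ∘ₗ p.1) (p.2 • (p.1 ∘ₗ s) : Module.End K V)
        (Submodule.span K (Set.range w)) := by
      refine LinearMap.eqOn_span ?_
      rintro _ ⟨i, rfl⟩
      simp [hs, hcomm s hs p hp]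
    exact this hu

/-! ### Fitting decomposition for operators proportional to their adjoint -/

theorem form_pow_adjoint {f : LinearMap.BilinForm K V} {T : Module.End K V} {c : K}
    (hT : ∀ u v, f u (T v) = c * f (T u) v) (k : ℕ) (u v : V) :
    f u ((T ^ k) v) = c ^ k * f ((T ^ k) u) v := by
  induction k generalizing u v with
  | zero => simp
  | succ k ih =>
    rw [pow_succ', Module.End.mul_apply, hT, ih, ← Module.End.mul_apply, ← pow_succ, pow_succ']
    ring

/-- The subspace of `W` on which `T` is nilpotent. -/
noncomputable def nilPart (T : Module.End K V) (W : Submodule K V) : Submodule K V :=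
  W ⊓ LinearMap.ker (T ^ Module.finrank K V)

theorem nilPart_le (T : Module.End K V) (W : Submodule K V) : nilPart T W ≤ W := inf_le_left

theorem mem_nilPart_of_pow [FiniteDimensional K V] {T : Module.End K V} {W : Submodule K V} {k : ℕ}
    {x : V} (hx : x ∈ W) (h : (T ^ k) x = 0) : x ∈ nilPart T W := by
  refine ⟨hx, ?_⟩
  have := Module.End.ker_pow_le_ker_pow_finrank T k
  exact this h

/-- On the orthogonal complement of the nilpotent part of `T`, the operator `T` is injective. -/
theorem nilPart_spec [FiniteDimensional K V] {f : LinearMap.BilinForm K V} (hf : f.IsRefl)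
    {T : Module.End K V} {c : K} (hT : ∀ u v, f u (T v) = c * f (T u) v)
    {W : Submodule K V} (hW : IsNondegOn f W) (hTW : ∀ u ∈ W, T u ∈ W) :
    IsNondegOn f (nilPart T W) ∧
      ∀ x ∈ W ⊓ f.orthogonal (nilPart T W), T x = 0 → x = 0 := by
  set n := Module.finrank K V
  have hW1nd : IsNondegOn f (nilPart T W) := by
    rintro x ⟨hx, hx0⟩ h
    -- `x` is orthogonal to `T ^ n W` as well, and these two subspaces span `W`.
    refine hW x hx fun v hv => ?_
    let R : Module.End K W := T.restrict hTW
    have hR : ∀ (k : ℕ) (y : W), ((R ^ k) y : V) = (T ^ k) y := by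
      intro k y
      induction k with
      | zero => simp
      | succ k ih =>
          rw [pow_succ', pow_succ', Module.End.mul_apply, Module.End.mul_apply, ← ih]
          rfl
    obtain ⟨k, hk⟩ := (R.eventually_isCompl_ker_pow_range_pow.and
      (Filter.eventually_ge_atTop n)).exists
    have hv' : (⟨v, hv⟩ : W) ∈ LinearMap.ker (R ^ k) ⊔ LinearMap.range (R ^ k) := by
      rw [hk.1.sup_eq_top]; trivial
    obtain ⟨y, hy, z, ⟨z', hz⟩, hyz⟩ := Submodule.mem_sup.1 hv'
    have hvv : v = (y : V) + (T ^ k) z' := by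
      rw [← hR, hz]; exact congrArg Subtype.val hyz.symm
    have hyn : (y : V) ∈ nilPart T W := mem_nilPart_of_pow (k := k) y.2 (by
      rw [← hR, LinearMap.mem_ker.1 hy]; rfl)
    have hxk : (T ^ k) x = 0 := by
      have : (T ^ n) x = 0 := hx0
      rw [← Nat.sub_add_cancel hk.2, pow_add, Module.End.mul_apply, this, map_zero]
    rw [hvv, map_add, h y hyn, form_pow_adjoint hT, hxk]
    simp
  refine ⟨hW1nd, fun x hx h0 => ?_⟩
  have : x ∈ nilPart T W := mem_nilPart_of_pow (k := 1) hx.1 (by simpa using h0)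
  exact (Submodule.disjoint_def.1 (hW1nd.disjoint_compl hf W)) x this hx

end Twist

/-! ### Counting Jordan blocks by ranks -/

section Blocks

variable {K V : Type*} [Field K] [AddCommGroup V] [Module K V]

/-- The second difference of the ranks of the powers of `P` on `W`. If `W` is invariant under `P`,
this is the number of Jordan blocks of size `j + 1` for the eigenvalue `0`. It is an integer, so
that the subtraction is not truncated. -/
noncomputable def jordanCount (P : Module.End K V) (W : Submodule K V) (j : ℕ) : ℤ :=
  (Module.finrank K (W.map (P ^ j)) : ℤ) - 2 * Module.finrank K (W.map (P ^ (j + 1))) +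
    Module.finrank K (W.map (P ^ (j + 2)))

theorem pow_apply_mem {T : Module.End K V} {W : Submodule K V} (hT : ∀ u ∈ W, T u ∈ W) (k : ℕ) :
    ∀ u ∈ W, (T ^ k) u ∈ W := by
  induction k with
  | zero => simp
  | succ k ih => intro u hu; rw [pow_succ', Module.End.mul_apply]; exact hT _ (ih u hu)

theorem finrank_map_sup [FiniteDimensional K V] {T : Module.End K V} {W₁ W₂ : Submodule K V}
    (h : Disjoint W₁ W₂) (h₁ : ∀ u ∈ W₁, T u ∈ W₁) (h₂ : ∀ u ∈ W₂, T u ∈ W₂) :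
    Module.finrank K ((W₁ ⊔ W₂).map T) =
      Module.finrank K (W₁.map T) + Module.finrank K (W₂.map T) := by
  have hd : Disjoint (W₁.map T) (W₂.map T) :=
    h.mono (Submodule.map_le_iff_le_comap.2 h₁) (Submodule.map_le_iff_le_comap.2 h₂)
  have := Submodule.finrank_sup_add_finrank_inf_eq (W₁.map T) (W₂.map T)
  rw [hd.eq_bot, finrank_bot, add_zero] at this
  rw [Submodule.map_sup, this]

theorem jordanCount_sup [FiniteDimensional K V] {T : Module.End K V} {W₁ W₂ : Submodule K V}
    (h : Disjoint W₁ W₂) (h₁ : ∀ u ∈ W₁, T u ∈ W₁) (h₂ : ∀ u ∈ W₂, T u ∈ W₂) (j : ℕ) :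
    jordanCount T (W₁ ⊔ W₂) j = jordanCount T W₁ j + jordanCount T W₂ j := by
  simp only [jordanCount,
    fun k => finrank_map_sup h (pow_apply_mem h₁ k) (pow_apply_mem h₂ k)]
  push_cast
  ring

theorem finrank_map_of_injOn [FiniteDimensional K V] {T : Module.End K V} {W : Submodule K V}
    (h : ∀ u ∈ W, T u = 0 → u = 0) : Module.finrank K (W.map T) = Module.finrank K W := by
  have : Function.Injective (T.domRestrict W) := by
    rw [← LinearMap.ker_eq_bot, LinearMap.ker_eq_bot']
    exact fun m hm => Subtype.ext (h m m.2 hm)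
  rw [← LinearMap.finrank_range_of_inj this, LinearMap.range_domRestrict]

theorem jordanCount_eq_zero_of_injOn [FiniteDimensional K V] {T : Module.End K V}
    {W : Submodule K V} (hT : ∀ u ∈ W, T u ∈ W) (h : ∀ u ∈ W, T u = 0 → u = 0) (j : ℕ) :
    jordanCount T W j = 0 := by
  have : ∀ k, ∀ u ∈ W, (T ^ k) u = 0 → u = 0 := fun k => by
    induction k with
    | zero => simp
    | succ k ih =>
      intro u hu h0
      rw [pow_succ, Module.End.mul_apply] at h0
      exact h u hu (ih _ (hT u hu) h0)
  simp only [jordanCount, fun k => finrank_map_of_injOn (this k)]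
  ring

/-- Multiplying `P` by a commuting operator that is injective on `W` does not change the ranks. -/
theorem jordanCount_mul_of_injOn [FiniteDimensional K V] {T P : Module.End K V}
    (hc : Commute T P) {W : Submodule K V} (hT : ∀ u ∈ W, T u ∈ W) (hP : ∀ u ∈ W, P u ∈ W)
    (h : ∀ u ∈ W, T u = 0 → u = 0) (j : ℕ) : jordanCount (T * P) W j = jordanCount P W j := by
  have : ∀ k, ∀ u ∈ W, (T ^ k) u = 0 → u = 0 := fun k => by
    induction k with
    | zero => simp
    | succ k ih =>
      intro u hu h0
      rw [pow_succ, Module.End.mul_apply] at h0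
      exact h u hu (ih _ (hT u hu) h0)
  have key : ∀ k, Module.finrank K (W.map ((T * P) ^ k)) = Module.finrank K (W.map (P ^ k)) := by
    intro k
    rw [hc.mul_pow, Module.End.mul_eq_comp, Submodule.map_comp]
    refine finrank_map_of_injOn ?_
    rintro _ ⟨u, hu, rfl⟩
    exact this k _ (pow_apply_mem hP k u hu)
  simp only [jordanCount, key]

/-! ### Blocks: dual systems of Jordan chains -/

theorem isNondegOn_span_of_dual {ι : Type*} {f : LinearMap.BilinForm K V} (w : ι → V)
    (h : ∀ k, w k = 0 ∨ ∃ k', f (w k) (w k') ≠ 0 ∧ ∀ j, j ≠ k → f (w j) (w k') = 0) :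
    IsNondegOn f (Submodule.span K (Set.range w)) := by
  intro u hu hv
  rw [← Finsupp.range_linearCombination] at hu
  obtain ⟨x, rfl⟩ := hu
  rw [Finsupp.linearCombination_apply, Finsupp.sum]
  refine Finset.sum_eq_zero fun k hk => ?_
  obtain h0 | ⟨k', hk', hj⟩ := h k
  · rw [h0, smul_zero]
  · have h1 := hv (w k') (Submodule.subset_span ⟨k', rfl⟩)
    rw [Finsupp.linearCombination_apply, Finsupp.sum, map_sum, LinearMap.sum_apply,
      Finset.sum_eq_single k] at h1
    · rw [map_smul, LinearMap.smul_apply, smul_eq_mul] at h1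
      rw [(mul_eq_zero.1 h1).resolve_right hk', zero_smul]
    · intro j _ hjk
      rw [map_smul, LinearMap.smul_apply, hj j hjk, smul_zero]
    · exact fun h => absurd hk h

theorem linearIndependent_of_dual {ι : Type*} {f : LinearMap.BilinForm K V} (w : ι → V)
    (h : ∀ k, ∃ v, f (w k) v ≠ 0 ∧ ∀ j, j ≠ k → f (w j) v = 0) : LinearIndependent K w := by
  rw [linearIndependent_iff']
  intro s g hg k hk
  obtain ⟨v, hv, hj⟩ := h k
  have h1 : f (∑ i ∈ s, g i • w i) v = 0 := by rw [hg]; simp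
  rw [map_sum, LinearMap.sum_apply, Finset.sum_eq_single k] at h1
  · rw [map_smul, LinearMap.smul_apply, smul_eq_mul] at h1
    exact (mul_eq_zero.1 h1).resolve_right hv
  · intro j _ hjk
    rw [map_smul, LinearMap.smul_apply, hj j hjk, smul_zero]
  · exact fun h => absurd hk h

/-- The vectors `u a` generate Jordan chains of `P` of length `e` such that the chain of `u a` is
dual to the chain of `u (π a)`: the only nonzero values of `f` are those on
`P ^ i (u a), P ^ j (u (π a))` with `i + j = e - 1`. -/
structure IsBlock {ι : Type*} (f : LinearMap.BilinForm K V) (P : Module.End K V) (e : ℕ)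
    (u : ι → V) (π : ι → ι) : Prop where
  inj : Function.Injective π
  zero : ∀ a, (P ^ e) (u a) = 0
  pair : ∀ a i j, i + j + 1 = e → f ((P ^ i) (u a)) ((P ^ j) (u (π a))) ≠ 0
  orth : ∀ a b i j, (b ≠ π a ∨ i + j + 1 ≠ e) → f ((P ^ i) (u a)) ((P ^ j) (u b)) = 0

/-- The span of the `P`-chains of the vectors `u a`. -/
def chainSpan {ι : Type*} (P : Module.End K V) (u : ι → V) : Submodule K V :=
  Submodule.span K (Set.range fun k : ι × ℕ => (P ^ k.2) (u k.1))

theorem mem_chainSpan {ι : Type*} (P : Module.End K V) (u : ι → V) (a : ι) (i : ℕ) :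
    (P ^ i) (u a) ∈ chainSpan P u := Submodule.subset_span ⟨(a, i), rfl⟩

theorem chainSpan_le {ι : Type*} {P : Module.End K V} {u : ι → V} {W : Submodule K V}
    (hP : ∀ x ∈ W, P x ∈ W) (hu : ∀ a, u a ∈ W) : chainSpan P u ≤ W := by
  rw [chainSpan, Submodule.span_le]
  rintro _ ⟨k, rfl⟩
  exact pow_apply_mem hP _ _ (hu _)

theorem chainSpan_inv {ι : Type*} {P : Module.End K V} {u : ι → V} :
    ∀ x ∈ chainSpan P u, P x ∈ chainSpan P u := by
  have : chainSpan P u ≤ (chainSpan P u).comap P := by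
    conv_lhs => rw [chainSpan]
    rw [Submodule.span_le]
    rintro _ ⟨k, rfl⟩
    change P ((P ^ k.2) (u k.1)) ∈ chainSpan P u
    rw [← Module.End.mul_apply, ← pow_succ']
    exact mem_chainSpan P u k.1 (k.2 + 1)
  exact this

theorem IsBlock.pow_eq_zero {ι : Type*} {f : LinearMap.BilinForm K V} {P : Module.End K V} {e : ℕ}
    {u : ι → V} {π : ι → ι} (h : IsBlock f P e u π) (a : ι) {i : ℕ} (hi : e ≤ i) :
    (P ^ i) (u a) = 0 := by
  rw [← Nat.sub_add_cancel hi, pow_add, Module.End.mul_apply, h.zero, map_zero]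

theorem IsBlock.nondeg {ι : Type*} {f : LinearMap.BilinForm K V} {P : Module.End K V} {e : ℕ}
    {u : ι → V} {π : ι → ι} (h : IsBlock f P e u π) : IsNondegOn f (chainSpan P u) := by
  refine isNondegOn_span_of_dual _ ?_
  rintro ⟨a, i⟩
  rcases le_or_gt e i with hi | hi
  · exact Or.inl (h.pow_eq_zero a hi)
  · refine Or.inr ⟨(π a, e - 1 - i), h.pair a i _ (by omega), ?_⟩
    rintro ⟨b, j⟩ hne
    refine h.orth _ _ _ _ ?_
    by_contra! hc
    exact hne (Prod.ext (h.inj hc.1.symm) (by simp only; omega))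

theorem IsBlock.finrank_map {ι : Type*} [Fintype ι] {f : LinearMap.BilinForm K V}
    {P : Module.End K V} {e : ℕ} {u : ι → V} {π : ι → ι} (h : IsBlock f P e u π) (k : ℕ) :
    Module.finrank K ((chainSpan P u).map (P ^ k)) = Fintype.card ι * (e - k) := by
  let w : ι × Fin (e - k) → V := fun x => (P ^ (x.2.1 + k)) (u x.1)
  have hw : (chainSpan P u).map (P ^ k) = Submodule.span K (Set.range w) := by
    rw [chainSpan, Submodule.map_span]
    refine le_antisymm (Submodule.span_le.2 ?_) (Submodule.span_le.2 ?_)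
    · rintro _ ⟨_, ⟨x, rfl⟩, rfl⟩
      simp only [← Module.End.mul_apply, ← pow_add]
      rcases lt_or_ge x.2 (e - k) with hx | hx
      · exact Submodule.subset_span ⟨(x.1, ⟨x.2, hx⟩), by simp [w, add_comm]⟩
      · rw [h.pow_eq_zero x.1 (by omega)]
        exact Submodule.zero_mem _
    · rintro _ ⟨x, rfl⟩
      refine Submodule.subset_span ⟨_, ⟨(x.1, x.2), rfl⟩, ?_⟩
      simp only [w, ← Module.End.mul_apply, ← pow_add, add_comm]
  have hli : LinearIndependent K w := by
    refine linearIndependent_of_dual (f := f) w ?_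
    rintro ⟨a, i⟩
    have hi := i.2
    refine ⟨(P ^ (e - 1 - (i.1 + k))) (u (π a)), h.pair a _ _ (by simp only; omega), ?_⟩
    rintro ⟨b, j⟩ hne
    refine h.orth _ _ _ _ ?_
    by_contra! hc
    have hc2 := hc.2
    simp only at hc2
    exact hne (Prod.ext (h.inj hc.1.symm) (Fin.ext (by simp only; omega)))
  rw [hw, finrank_span_eq_card hli, Fintype.card_prod, Fintype.card_fin]

theorem IsBlock.jordanCount {ι : Type*} [Fintype ι] {f : LinearMap.BilinForm K V}
    {P : Module.End K V} {e : ℕ} {u : ι → V} {π : ι → ι} (h : IsBlock f P e u π) (j : ℕ) :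
    jordanCount P (chainSpan P u) j = if j + 1 = e then (Fintype.card ι : ℤ) else 0 := by
  simp only [_root_.jordanCount, h.finrank_map]
  split_ifs with hj
  · subst hj
    have h1 : j + 1 - j = 1 := by omega
    have h2 : j + 1 - (j + 1) = 0 := by omega
    have h3 : j + 1 - (j + 2) = 0 := by omega
    rw [h1, h2, h3]
    simp
  · rcases lt_or_ge j e with hlt | hge
    · obtain ⟨m, rfl⟩ : ∃ m, e = j + 2 + m := ⟨e - j - 2, by omega⟩
      have h1 : j + 2 + m - j = m + 2 := by omega
      have h2 : j + 2 + m - (j + 1) = m + 1 := by omega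
      have h3 : j + 2 + m - (j + 2) = m := by omega
      rw [h1, h2, h3]
      push_cast
      ring
    · have h1 : e - j = 0 := by omega
      have h2 : e - (j + 1) = 0 := by omega
      have h3 : e - (j + 2) = 0 := by omega
      rw [h1, h2, h3]
      simp

theorem IsBlock.ne_bot {ι : Type*} {f : LinearMap.BilinForm K V} {P : Module.End K V}
    {e : ℕ} {u : ι → V} {π : ι → ι} (h : IsBlock f P (e + 1) u π) (a : ι) :
    chainSpan P u ≠ ⊥ := by
  intro hb
  have h1 := h.pair a 0 e (by omega)
  have h2 := mem_chainSpan P u a 0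
  rw [hb, Submodule.mem_bot] at h2
  rw [h2] at h1
  simp at h1

/-- If `P ^ (j + 1)` vanishes on `W`, then the number of blocks of size `j + 1` is the rank of
`P ^ j`. -/
theorem jordanCount_of_pow_eq_zero {P : Module.End K V} {W : Submodule K V} {j : ℕ}
    (h : ∀ x ∈ W, (P ^ (j + 1)) x = 0) :
    jordanCount P W j = Module.finrank K (W.map (P ^ j)) := by
  have h1 : W.map (P ^ (j + 1)) = ⊥ := by
    rw [Submodule.eq_bot_iff]; rintro _ ⟨x, hx, rfl⟩; exact h x hx
  have h2 : W.map (P ^ (j + 2)) = ⊥ := by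
    rw [Submodule.eq_bot_iff]; rintro _ ⟨x, hx, rfl⟩
    rw [pow_succ', Module.End.mul_apply, h x hx, map_zero]
  rw [jordanCount, h1, h2]
  simp

/-- An operator that is nilpotent on `W ≠ 0` has a nilpotency index there. -/
theorem exists_nilpotency_index {P : Module.End K V} {W : Submodule K V} (hW : W ≠ ⊥)
    (h : ∃ n : ℕ, ∀ x ∈ W, (P ^ n) x = 0) :
    ∃ j : ℕ, (∀ x ∈ W, (P ^ (j + 1)) x = 0) ∧ ∃ x ∈ W, (P ^ j) x ≠ 0 := by
  classical
  have hpos : Nat.find h ≠ 0 := fun h0 => hW <| by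
    have := Nat.find_spec h
    rw [h0] at this
    exact (Submodule.eq_bot_iff _).2 this
  obtain ⟨j, hj⟩ := Nat.exists_eq_succ_of_ne_zero hpos
  refine ⟨j, by have := Nat.find_spec h; rwa [hj] at this, ?_⟩
  have := Nat.find_min h (m := j) (by omega)
  push Not at this
  exact this

/-- Completing the square along a Jordan chain: if `P` is self-adjoint for the form `F`
and nilpotent, then `u` can be changed so that `F (P ^ i u) u` vanishes except for the top power,
where it keeps its value. -/
theorem exists_normalized [NeZero (2 : K)] {F : LinearMap.BilinForm K V}
    {P : Module.End K V} (hP : ∀ u v, F u (P v) = F (P u) v)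
    {W : Submodule K V} (hPW : ∀ u ∈ W, P u ∈ W) {m : ℕ} (hz : ∀ x ∈ W, (P ^ (m + 1)) x = 0)
    {u : V} (hu : u ∈ W) (h : F ((P ^ m) u) u ≠ 0) :
    ∃ u' ∈ W, F ((P ^ m) u') u' = F ((P ^ m) u) u ∧ ∀ i, i ≠ m → F ((P ^ i) u') u' = 0 := by
  have hz' : ∀ x ∈ W, ∀ i, m < i → (P ^ i) x = 0 := fun x hx i hi => by
    rw [← Nat.sub_add_cancel (show m + 1 ≤ i from hi), pow_add, Module.End.mul_apply, hz x hx,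
      map_zero]
  have hPk : ∀ (k : ℕ) (u v : V), F u ((P ^ k) v) = F ((P ^ k) u) v := fun k u v => by
    simpa using form_pow_adjoint (f := F) (T := P) (c := (1 : K)) (by simpa using hP) k u v
  have key : ∀ k ≤ m, ∃ u' ∈ W, F ((P ^ m) u') u' = F ((P ^ m) u) u ∧
      ∀ i, m - k ≤ i → i ≠ m → F ((P ^ i) u') u' = 0 := by
    intro k
    induction k with
    | zero =>
      refine fun _ => ⟨u, hu, rfl, fun i hi hne => ?_⟩
      rw [hz' u hu i (by omega)]
      simp
    | succ k ih =>
      intro hk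
      obtain ⟨v, hv, hv1, hv2⟩ := ih (by omega)
      have hα : F ((P ^ m) v) v ≠ 0 := hv1 ▸ h
      -- adding a multiple of `P ^ j v` with `j = k + 1` only changes the values below `m - k`
      let a : K := - F ((P ^ (m - (k + 1))) v) v / (2 * F ((P ^ m) v) v)
      let v' := v + a • (P ^ (k + 1)) v
      have hexp : ∀ i, F ((P ^ i) v') v' = F ((P ^ i) v) v + 2 * a * F ((P ^ (i + (k + 1))) v) v +
          a ^ 2 * F ((P ^ (i + (k + 1) + (k + 1))) v) v := by
        intro i
        have h1 : (P ^ i) ((P ^ (k + 1)) v) = (P ^ (i + (k + 1))) v := by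
          rw [← Module.End.mul_apply, ← pow_add]
        have h2 : F ((P ^ i) v) ((P ^ (k + 1)) v) = F ((P ^ (i + (k + 1))) v) v := by
          rw [hPk, ← Module.End.mul_apply, ← pow_add, add_comm]
        have h3 : F ((P ^ (i + (k + 1))) v) ((P ^ (k + 1)) v) =
            F ((P ^ (i + (k + 1) + (k + 1))) v) v := by
          rw [hPk, ← Module.End.mul_apply, ← pow_add, add_comm (k + 1)]
        simp only [v', map_add, map_smul, LinearMap.add_apply, LinearMap.smul_apply, smul_eq_mul,
          h1, h2, h3]
        ring
      have hbig : ∀ i, m < i → F ((P ^ i) v) v = 0 := fun i hi => by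
        rw [hz' v hv i hi]; simp
      refine ⟨v', W.add_mem hv (W.smul_mem _ (pow_apply_mem hPW _ _ hv)), ?_, ?_⟩
      · rw [hexp, hbig (m + (k + 1)) (by omega), hbig (m + (k + 1) + (k + 1)) (by omega), hv1]
        ring
      · intro i hi hne
        rw [hexp, hbig (i + (k + 1) + (k + 1)) (by omega)]
        rcases eq_or_ne i (m - (k + 1)) with rfl | hi'
        · have h1 : m - (k + 1) + (k + 1) = m := by omega
          rw [h1]
          have h2 : (2 : K) ≠ 0 := NeZero.ne _
          simp only [a]
          field_simp
          ring
        · rw [hv2 i (by omega) hne]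
          rcases lt_or_ge m (i + (k + 1)) with h3 | h3
          · rw [hbig _ h3]; ring
          · omega
  obtain ⟨u', hu', h1, h2⟩ := key m le_rfl
  exact ⟨u', hu', h1, fun i hi => h2 i (by omega) hi⟩

/-- A symmetric form that does not vanish identically takes a nonzero value on the diagonal. -/
theorem exists_diag_ne_zero [NeZero (2 : K)] {F : LinearMap.BilinForm K V}
    (hsymm : ∀ u v, F u v = F v u) {W : Submodule K V} {x y : V} (hx : x ∈ W) (hy : y ∈ W)
    (h : F x y ≠ 0) : ∃ u ∈ W, F u u ≠ 0 := by
  by_contra! hc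
  have h1 := hc _ (W.add_mem hx hy)
  simp only [map_add, LinearMap.add_apply, hc x hx, hc y hy, hsymm y x] at h1
  have : (2 : K) * F x y = 0 := by linear_combination h1
  exact h ((mul_eq_zero.1 this).resolve_left (NeZero.ne _))

end Blocks

section Nilpotent

variable {K V : Type*} [Field K] [AddCommGroup V] [Module K V]

/-! ### Twists anticommuting with a nilpotent operator -/

/-- A twist on a block that anticommutes with `P` is determined by its values `v a` on the
generators `u a` of the chains. -/
theorem IsBlock.exists_isTwist {ι : Type*} [Fintype ι] {f : LinearMap.BilinForm K V}
    {P : Module.End K V} {e : ℕ} {u : ι → V} {π : ι → ι} (h : IsBlock f P e u π) {κ ε : K}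
    (hP : ∀ x y, f x (P y) = κ * f (P x) y) (hε : ε ≠ 0) (v : ι → V) (c : ι → ι → K)
    (hv : ∀ a, v a = ∑ b, c a b • u b) (hu : ∀ a, ε • u a = ∑ b, c a b • v b)
    (hG : ∀ a b i, (-1) ^ i * f ((P ^ i) (v a)) (v b) = f ((P ^ i) (u a)) (u b))
    (𝒜 : Set (Module.End K V × K))
    (hcomm : ∀ s : Module.End K V, (∀ a i, s ((P ^ i) (u a)) = (-1 : K) ^ i • (P ^ i) (v a)) →
      ∀ p ∈ 𝒜, ∀ a i, s (p.1 ((P ^ i) (u a))) = p.2 • p.1 ((-1 : K) ^ i • (P ^ i) (v a))) :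
    ∃ s, (∀ a i, s ((P ^ i) (u a)) = (-1 : K) ^ i • (P ^ i) (v a)) ∧
      IsTwist f 1 ε 𝒜 (chainSpan P u) s := by
  have hvu : chainSpan P v ≤ chainSpan P u := chainSpan_le chainSpan_inv fun a => by
    rw [hv]
    exact Submodule.sum_mem _ fun b _ => Submodule.smul_mem _ _ (mem_chainSpan P u b 0)
  have huv : chainSpan P u ≤ chainSpan P v := chainSpan_le chainSpan_inv fun a => by
    have : u a = ε⁻¹ • ∑ b, c a b • v b := by rw [← hu, smul_smul, inv_mul_cancel₀ hε, one_smul]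
    rw [this]
    exact Submodule.smul_mem _ _ (Submodule.sum_mem _ fun b _ =>
      Submodule.smul_mem _ _ (mem_chainSpan P v b 0))
  have hsign : ∀ i : ℕ, ((-1 : K) ^ i) * (-1) ^ i = 1 := fun i => by
    rw [← mul_pow]; simp
  have hw' : Submodule.span K (Set.range fun k : ι × ℕ => (-1 : K) ^ k.2 • (P ^ k.2) (v k.1)) =
      chainSpan P u := by
    refine le_antisymm (Submodule.span_le.2 ?_) (huv.trans ?_)
    · rintro _ ⟨k, rfl⟩
      exact Submodule.smul_mem _ _ (hvu (mem_chainSpan P v _ _))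
    · rw [chainSpan, Submodule.span_le]
      rintro _ ⟨k, rfl⟩
      have : (P ^ k.2) (v k.1) = (-1 : K) ^ k.2 • ((-1 : K) ^ k.2 • (P ^ k.2) (v k.1)) := by
        rw [smul_smul, hsign, one_smul]
      simp only [SetLike.mem_coe]
      rw [this]
      exact Submodule.smul_mem _ _ (Submodule.subset_span ⟨k, rfl⟩)
  have hmove : ∀ (i j : ℕ) (x y : V),
      f ((P ^ i) x) ((P ^ j) y) = κ ^ j * f ((P ^ (i + j)) x) y := by
    intro i j x y
    rw [form_pow_adjoint hP, ← Module.End.mul_apply, ← pow_add, add_comm]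
  obtain ⟨s, hs, ht⟩ := exists_isTwist_on_span (f := f) (fun k : ι × ℕ => (P ^ k.2) (u k.1))
    (fun k : ι × ℕ => (-1 : K) ^ k.2 • (P ^ k.2) (v k.1)) 1 ε 𝒜 (chainSpan P u) rfl hw' h.nondeg
    (by
      rintro ⟨a, i⟩ ⟨b, j⟩
      simp only [map_smul, LinearMap.smul_apply, smul_eq_mul]
      rw [hmove, hmove, ← hG, pow_add]
      ring)
    (by
      rintro s hs ⟨a, i⟩
      have hs' : ∀ b, s ((P ^ i) (u b)) = (-1 : K) ^ i • (P ^ i) (v b) := fun b => hs (b, i)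
      simp only
      rw [hv, map_sum, map_smul, map_sum, ← map_smul (P ^ i), hu, map_sum, Finset.smul_sum]
      refine Finset.sum_congr rfl fun b _ => ?_
      rw [map_smul, map_smul, hs', map_smul, smul_comm (c a b), smul_smul, hsign, one_smul])
    (fun s hs p hp k => hcomm s (fun a i => hs (a, i)) p hp k.1 k.2)
  exact ⟨s, fun a i => hs (a, i), ht⟩

theorem comm_self_of_chain {ι : Type*} {P : Module.End K V} {u v : ι → V} {s : Module.End K V}
    (hs : ∀ a i, s ((P ^ i) (u a)) = (-1 : K) ^ i • (P ^ i) (v a)) (a : ι) (i : ℕ) :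
    s (P ((P ^ i) (u a))) = (-1 : K) • P ((-1 : K) ^ i • (P ^ i) (v a)) := by
  have h : ∀ x, P ((P ^ i) x) = (P ^ (i + 1)) x := fun x => by
    rw [pow_succ', Module.End.mul_apply]
  rw [h, hs, map_smul, h, smul_smul, pow_succ' (-1 : K)]

/-- A family with prescribed values of `f (P ^ i (u a)) (u b)` is a block. -/
theorem isBlock_of_chain {ι : Type*} {f : LinearMap.BilinForm K V} {P : Module.End K V} {κ : K}
    (hκ : κ ≠ 0) (hP : ∀ x y, f x (P y) = κ * f (P x) y) {j : ℕ} {u : ι → V} {π : ι → ι}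
    (hinj : Function.Injective π) (hz : ∀ a, (P ^ (j + 1)) (u a) = 0)
    (hne : ∀ a, f ((P ^ j) (u a)) (u (π a)) ≠ 0)
    (h0 : ∀ a b i, (b ≠ π a ∨ i ≠ j) → f ((P ^ i) (u a)) (u b) = 0) :
    IsBlock f P (j + 1) u π := by
  have hmove : ∀ (i j : ℕ) (x y : V),
      f ((P ^ i) x) ((P ^ j) y) = κ ^ j * f ((P ^ (i + j)) x) y := by
    intro i j x y
    rw [form_pow_adjoint hP, ← Module.End.mul_apply, ← pow_add, add_comm]
  refine ⟨hinj, hz, fun a i k hik => ?_, fun a b i k hik => ?_⟩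
  · obtain rfl : i + k = j := by omega
    rw [hmove]
    exact mul_ne_zero (pow_ne_zero _ hκ) (hne a)
  · rw [hmove, h0 a b _ (hik.imp_right (by omega)), mul_zero]

theorem form_odd_power_symm {f : LinearMap.BilinForm K V} (hf : f.IsAlt) {D : Module.End K V}
    (hD : ∀ u v, f u (D v) = -1 * f (D u) v) {j : ℕ} (hj : Odd j) (u v : V) :
    f ((D ^ j) u) v = f ((D ^ j) v) u := by
  have h1 := form_pow_adjoint hD j v u
  rw [hj.neg_one_pow] at h1
  rw [← hf.neg_eq, h1]
  ring

theorem form_even_power_alt [NeZero (2 : K)] {f : LinearMap.BilinForm K V} (hf : f.IsAlt)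
    {D : Module.End K V} (hD : ∀ u v, f u (D v) = -1 * f (D u) v) {j : ℕ} (hj : Even j) (u v : V) :
    f ((D ^ j) u) v = - f ((D ^ j) v) u := by
  have h1 := form_pow_adjoint hD j v u
  rw [hj.neg_one_pow] at h1
  rw [← hf.neg_eq, h1]
  ring

theorem form_even_power_self [NeZero (2 : K)] {f : LinearMap.BilinForm K V} (hf : f.IsAlt)
    {D : Module.End K V} (hD : ∀ u v, f u (D v) = -1 * f (D u) v) {j : ℕ} (hj : Even j) (u : V) :
    f ((D ^ j) u) u = 0 := by
  have h1 := form_even_power_alt hf hD hj u u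
  have h2 : (2 : K) * f ((D ^ j) u) u = 0 := by linear_combination h1
  exact (mul_eq_zero.1 h2).resolve_left (NeZero.ne _)

/-- For an odd top power `D ^ j` there is a chain generator `u` such that `f (D ^ i u) u` is nonzero
only for `i = j`. -/
theorem exists_selfdual_chain [NeZero (2 : K)] {f : LinearMap.BilinForm K V} (hf : f.IsAlt)
    {D : Module.End K V} (hD : ∀ u v, f u (D v) = -1 * f (D u) v) {W : Submodule K V}
    (hW : IsNondegOn f W) (hDW : ∀ u ∈ W, D u ∈ W) {j : ℕ} (hj : Odd j)
    (hz : ∀ x ∈ W, (D ^ (j + 1)) x = 0) (hne : ∃ x ∈ W, (D ^ j) x ≠ 0) :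
    ∃ u ∈ W, f ((D ^ j) u) u ≠ 0 ∧ ∀ i, i ≠ j → f ((D ^ i) u) u = 0 := by
  obtain ⟨m, rfl⟩ := hj
  obtain ⟨x, hx, hx0⟩ := hne
  have hex : ∃ y ∈ W, f ((D ^ (2 * m + 1)) x) y ≠ 0 := by
    by_contra! hc
    exact hx0 (hW _ (pow_apply_mem hDW _ x hx) hc)
  obtain ⟨y, hy, hxy⟩ := hex
  obtain ⟨u, hu, hu0⟩ := exists_diag_ne_zero (F := f ∘ₗ (D ^ (2 * m + 1)))
    (fun u v => form_odd_power_symm hf hD ⟨m, rfl⟩ u v) hx hy hxy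
  have hpow : ∀ i, f (D (((D ^ 2) ^ i) u)) = f ((D ^ (2 * i + 1)) u) := fun i => by
    rw [← pow_mul, ← Module.End.mul_apply D, ← pow_succ']
  obtain ⟨u', hu', h1, h2⟩ := exists_normalized (F := f ∘ₗ D) (P := D ^ 2) (W := W)
      (m := m) (u := u)
    (fun u v => by
      change f (D u) ((D ^ 2) v) = f (D ((D ^ 2) u)) v
      rw [form_pow_adjoint hD, ← Module.End.mul_apply (D ^ 2), ← Module.End.mul_apply D,
        ← pow_succ, ← pow_succ']
      ring)
    (pow_apply_mem hDW 2)
    (fun x hx => by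
      rw [← pow_mul]; exact hz x hx) hu
    (by
      change f (D (((D ^ 2) ^ m) u)) u ≠ 0
      rw [hpow]; exact hu0)
  have hpow' : ∀ i, f (D (((D ^ 2) ^ i) u')) = f ((D ^ (2 * i + 1)) u') := fun i => by
    rw [← pow_mul, ← Module.End.mul_apply D, ← pow_succ']
  refine ⟨u', hu', ?_, fun i hi => ?_⟩
  · have : f (D (((D ^ 2) ^ m) u')) u' = f (D (((D ^ 2) ^ m) u)) u := h1
    rw [hpow, hpow'] at this
    rw [this]; exact hu0
  · rcases Nat.even_or_odd i with he | ⟨k, rfl⟩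
    · exact form_even_power_self hf hD he u'
    · rw [← hpow']
      exact h2 k (by omega)

/-- A functional on a chain of length `j + 1` that picks out the top power is given by a vector. -/
theorem exists_dual_to_chain [FiniteDimensional K V] {f : LinearMap.BilinForm K V} (hf : f.IsRefl)
    {D : Module.End K V} {W : Submodule K V} (hW : IsNondegOn f W) (hDW : ∀ u ∈ W, D u ∈ W) {j : ℕ}
    {u : V} (hu : u ∈ W) (hz : (D ^ (j + 1)) u = 0) (hne : (D ^ j) u ≠ 0) :
    ∃ v ∈ W, f ((D ^ j) u) v = 1 ∧ ∀ i, i ≠ j → f ((D ^ i) u) v = 0 := by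
  have hli : LinearIndependent K fun i : Fin (j + 1) => (D ^ (i : ℕ)) u := by
    rw [linearIndependent_iff']
    intro t g hg
    by_contra! hc
    -- apply the power of `D` that moves the lowest term of the relation to the top
    obtain ⟨i, ⟨hit, hi0⟩, hmin⟩ := WellFounded.has_min (wellFounded_lt (α := Fin (j + 1)))
      {i | i ∈ t ∧ g i ≠ 0} hc
    have h1 := congrArg (D ^ (j - (i : ℕ))) hg
    rw [map_zero, map_sum, Finset.sum_eq_single i] at h1
    · rw [map_smul, ← Module.End.mul_apply, ← pow_add,
        Nat.sub_add_cancel (Nat.lt_succ_iff.1 i.2)] at h1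
      exact (smul_eq_zero.1 h1).elim hi0 hne
    · intro k hk hki
      by_cases hgk : g k = 0
      · rw [hgk, zero_smul, map_zero]
      · have hlt : i < k := lt_of_le_of_ne (not_lt.1 (hmin k ⟨hk, hgk⟩)) (Ne.symm hki)
        have hlt' : (i : ℕ) < k := hlt
        have := k.2
        rw [map_smul, ← Module.End.mul_apply, ← pow_add,
          show j - (i : ℕ) + k = (k - i - 1) + (j + 1) by omega, pow_add, Module.End.mul_apply, hz,
          map_zero, smul_zero]
    · exact fun h => absurd hit h
  let b := Module.Basis.span hli
  obtain ⟨l, hl⟩ := (b.coord (Fin.last j)).exists_extend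
  have hl' : ∀ i : Fin (j + 1), l ((D ^ (i : ℕ)) u) = if i = Fin.last j then 1 else 0 := by
    intro i
    have h1 : l (b i : V) = b.coord (Fin.last j) (b i) := LinearMap.congr_fun hl (b i)
    have h2 : (b i : V) = (D ^ (i : ℕ)) u :=
      congrArg Subtype.val (Module.Basis.span_apply hli i)
    rw [← h2, h1, Module.Basis.coord_apply, Module.Basis.repr_self, Finsupp.single_apply]
  obtain ⟨v, hv, hvl⟩ := hW.exists_repr hf l
  refine ⟨v, hv, ?_, fun i hi => ?_⟩
  · rw [hvl _ (pow_apply_mem hDW j u hu)]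
    simpa using hl' (Fin.last j)
  · rcases lt_or_ge i (j + 1) with h | h
    · rw [hvl _ (pow_apply_mem hDW i u hu)]
      have := hl' ⟨i, h⟩
      rw [this, if_neg]
      intro h'
      exact hi (congrArg Fin.val h')
    · rw [← Nat.sub_add_cancel h, pow_add, Module.End.mul_apply, hz]
      simp

/-- For an even top power `D ^ j` there are two isotropic chains that are dual to each other. -/
theorem exists_isotropic_pair [FiniteDimensional K V] [NeZero (2 : K)]
    {f : LinearMap.BilinForm K V} (hf : f.IsAlt) {D : Module.End K V}
    (hD : ∀ u v, f u (D v) = -1 * f (D u) v) {W : Submodule K V}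
    (hW : IsNondegOn f W) (hDW : ∀ u ∈ W, D u ∈ W) {j : ℕ} (hj : Even j)
    (hz : ∀ x ∈ W, (D ^ (j + 1)) x = 0) (hne : ∃ x ∈ W, (D ^ j) x ≠ 0) :
    ∃ u ∈ W, ∃ v ∈ W, (∀ i, f ((D ^ i) u) u = 0) ∧ (∀ i, f ((D ^ i) v) v = 0) ∧
      f ((D ^ j) u) v = 1 ∧ ∀ i, i ≠ j → f ((D ^ i) u) v = 0 := by
  have h2 : (2 : K) ≠ 0 := NeZero.ne _
  have hbig : ∀ x ∈ W, ∀ i, j < i → (D ^ i) x = 0 := fun x hx i hi => by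
    rw [← Nat.sub_add_cancel (show j + 1 ≤ i from hi), pow_add, Module.End.mul_apply, hz x hx,
      map_zero]
  have hmove : ∀ (i k : ℕ) (x y : V),
      f ((D ^ i) x) ((D ^ k) y) = (-1) ^ k * f ((D ^ (i + k)) x) y := by
    intro i j x y
    rw [form_pow_adjoint hD, ← Module.End.mul_apply, ← pow_add, add_comm]
  have hadd : ∀ (i k : ℕ) (x : V), (D ^ i) ((D ^ k) x) = (D ^ (i + k)) x := by
    intro i k x
    rw [← Module.End.mul_apply, ← pow_add]
  have hodd : ∀ k, k ≤ j → Odd (j - k) → Odd k := fun k hk ho => by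
    by_contra hc
    exact (Nat.not_even_iff_odd.2 ho) ((Nat.even_sub hk).2 (by simp_all))
  -- first make `u` isotropic, one power at a time from the top
  have step1 : ∀ k ≤ j, ∃ u ∈ W, (D ^ j) u ≠ 0 ∧ ∀ i, j - k ≤ i → f ((D ^ i) u) u = 0 := by
    intro k
    induction k with
    | zero =>
      obtain ⟨x, hx, hx0⟩ := hne
      refine fun _ => ⟨x, hx, hx0, fun i hi => ?_⟩
      rcases eq_or_lt_of_le (show j ≤ i by omega) with rfl | h
      · exact form_even_power_self hf hD hj x
      · rw [hbig x hx i h]; simp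
    | succ k ih =>
      intro hk
      obtain ⟨u, hu, hu0, hui⟩ := ih (by omega)
      rcases Nat.even_or_odd (j - (k + 1)) with he | ho
      · refine ⟨u, hu, hu0, fun i hi => ?_⟩
        rcases eq_or_lt_of_le hi with rfl | h
        · exact form_even_power_self hf hD he u
        · exact hui i (by omega)
      · have hok : Odd (k + 1) := hodd (k + 1) hk ho
        obtain ⟨v, hv, hv1, hv0⟩ := exists_dual_to_chain hf.isRefl hW hDW hu (hz u hu) hu0
        set χ := f ((D ^ (j - (k + 1))) u) u
        let u' := u + (χ / 2) • (D ^ (k + 1)) v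
        have hexp : ∀ i, j - (k + 1) ≤ i → f ((D ^ i) u') u' =
            f ((D ^ i) u) u -
              (χ / 2) * (1 + (-1) ^ (i + (k + 1))) * f ((D ^ (i + (k + 1))) u) v := by
          intro i hi
          have h1 : f ((D ^ (i + (k + 1))) v) u =
              - ((-1) ^ (i + (k + 1)) * f ((D ^ (i + (k + 1))) u) v) := by
            rw [← hf.neg_eq, form_pow_adjoint hD]
          have h3 : f ((D ^ (i + (k + 1))) v) ((D ^ (k + 1)) v) = 0 := by
            rw [hmove, hbig v hv _ (by obtain ⟨m, hm⟩ := ho; omega)]; simp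
          simp only [u', map_add, map_smul, LinearMap.add_apply, LinearMap.smul_apply, smul_eq_mul,
            hadd, h1, h3, hmove i, hok.neg_one_pow]
          ring
        refine ⟨u', W.add_mem hu (W.smul_mem _ (pow_apply_mem hDW _ v hv)), ?_, fun i hi => ?_⟩
        · simp only [u', map_add, map_smul, hadd]
          rw [hbig v hv _ (by omega)]
          simpa using hu0
        · rw [hexp i hi]
          rcases eq_or_lt_of_le hi with rfl | h
          · rw [Nat.sub_add_cancel hk, hv1, hj.neg_one_pow]
            simp only [χ]
            field_simp
            ring
          · rw [hui i (by omega), hbig u hu (i + (k + 1)) (by omega)]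
            simp
  obtain ⟨u, hu, hu0, hui'⟩ := step1 j le_rfl
  have hui : ∀ i, f ((D ^ i) u) u = 0 := fun i => hui' i (by omega)
  -- then correct the dual vector `v` by multiples of the powers `D ^ k u`
  have step2 : ∀ k ≤ j, ∃ v ∈ W, f ((D ^ j) u) v = 1 ∧ (∀ i, i ≠ j → f ((D ^ i) u) v = 0) ∧
      ∀ i, j - k ≤ i → f ((D ^ i) v) v = 0 := by
    intro k
    induction k with
    | zero =>
      intro _
      obtain ⟨v, hv, hv1, hv0⟩ := exists_dual_to_chain hf.isRefl hW hDW hu (hz u hu) hu0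
      refine ⟨v, hv, hv1, hv0, fun i hi => ?_⟩
      rcases eq_or_lt_of_le (show j ≤ i by omega) with rfl | h
      · exact form_even_power_self hf hD hj v
      · rw [hbig v hv i h]; simp
    | succ k ih =>
      intro hk
      obtain ⟨v, hv, hv1, hv0, hvi⟩ := ih (by omega)
      rcases Nat.even_or_odd (j - (k + 1)) with he | ho
      · refine ⟨v, hv, hv1, hv0, fun i hi => ?_⟩
        rcases eq_or_lt_of_le hi with rfl | h
        · exact form_even_power_self hf hD he v
        · exact hvi i (by omega)
      · have hok : Odd (k + 1) := hodd (k + 1) hk ho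
        set χ := f ((D ^ (j - (k + 1))) v) v
        let v' := v - (χ / 2) • (D ^ (k + 1)) u
        have huu : ∀ i l, f ((D ^ i) u) ((D ^ l) u) = 0 := fun i l => by rw [hmove, hui, mul_zero]
        have hexp : ∀ i, f ((D ^ i) v') v' = f ((D ^ i) v) v -
            (χ / 2) * (1 + (-1) ^ (i + (k + 1))) * f ((D ^ (i + (k + 1))) u) v := by
          intro i
          have h1 : f ((D ^ i) v) ((D ^ (k + 1)) u) =
              (-1) ^ (i + (k + 1)) * f ((D ^ (i + (k + 1))) u) v := by
            rw [← hf.neg_eq, hmove, pow_add (-1 : K), hok.neg_one_pow, add_comm]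
            ring
          simp only [v', map_sub, map_smul, LinearMap.sub_apply, LinearMap.smul_apply, smul_eq_mul,
            hadd, h1, huu]
          ring
        refine ⟨v', W.sub_mem hv (W.smul_mem _ (pow_apply_mem hDW _ u hu)), ?_, fun i hi => ?_,
          fun i hi => ?_⟩
        · simp only [v', map_sub, map_smul, huu, hv1]; simp
        · simp only [v', map_sub, map_smul, huu, hv0 i hi]; simp
        · rw [hexp i]
          rcases eq_or_lt_of_le hi with rfl | h
          · rw [Nat.sub_add_cancel hk, hv1, hj.neg_one_pow]
            simp only [χ]
            field_simp
            ring
          · rw [hvi i (by omega), hbig u hu (i + (k + 1)) (by omega)]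
            simp
  obtain ⟨v, hv, hv1, hv0, hvi⟩ := step2 j le_rfl
  exact ⟨u, hu, v, hv, hui, fun i => hvi i (by omega), hv1, hv0⟩

theorem hasScalarAdjoints_singleton {f : LinearMap.BilinForm K V} {D : Module.End K V} {c κ : K}
    (hD : ∀ u v, f u (D v) = κ * f (D u) v) : HasScalarAdjoints f {(D, c)} := by
  rintro p rfl
  exact ⟨κ, hD⟩

theorem isAdapted_singleton {f : LinearMap.BilinForm K V} {D : Module.End K V} {c : K}
    {W : Submodule K V} (hW : IsNondegOn f W) (hD : ∀ u ∈ W, D u ∈ W) :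
    IsAdapted f {(D, c)} W := ⟨hW, by rintro p rfl; exact hD⟩

/-- Splitting off an invariant nondegenerate subspace subtracts its Jordan blocks. -/
theorem IsAdapted.jordanCount_compl [FiniteDimensional K V] {f : LinearMap.BilinForm K V}
    (hf : f.IsRefl) {𝒜 : Set (Module.End K V × K)} (h𝒜 : HasScalarAdjoints f 𝒜)
    {W₁ W : Submodule K V} (hW₁ : IsAdapted f 𝒜 W₁) (hW : IsAdapted f 𝒜 W) (hle : W₁ ≤ W)
    {p : Module.End K V × K} (hp : p ∈ 𝒜) (j : ℕ) :
    jordanCount p.1 (W ⊓ f.orthogonal W₁) j = jordanCount p.1 W j - jordanCount p.1 W₁ j := by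
  have h := jordanCount_sup (hW₁.nondeg.disjoint_compl hf W) (hW₁.inv p hp)
    ((hW₁.compl hf h𝒜 hW hle).inv p hp) j
  rw [hW₁.nondeg.sup_compl hf hle] at h
  rw [h]
  ring

/-- A skew-adjoint operator that is nilpotent on `W` anticommutes with some isometry of square `-1`,
provided that `-1` is a square or that Jordan blocks of each even size occur an even number
of times. Blocks of odd size form isotropic pairs `u, v`, and the isometry takes `u` to `v` and `v`
to `-u`; blocks of even size carry a nonzero scalar `α`, and two of them, with scalars `α₁, α₂`,
admit an isometry because `a ^ 2 + α₁ α₂ b ^ 2 = -1` is solvable. -/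
theorem exists_isTwist_of_nilpotent [FiniteDimensional K V] [NeZero (2 : K)]
    (hsum : ∀ a : K, a ≠ 0 → ∃ x y : K, x ^ 2 + a * y ^ 2 = -1)
    {f : LinearMap.BilinForm K V} (hf : f.IsAlt) {D : Module.End K V}
    (hD : ∀ u v, f u (D v) = -1 * f (D u) v) {W : Submodule K V} (hW : IsNondegOn f W)
    (hDW : ∀ u ∈ W, D u ∈ W) (hnil : ∃ n : ℕ, ∀ x ∈ W, (D ^ n) x = 0)
    (hcond : IsSquare (-1 : K) ∨ ∀ j, Odd j → Even (jordanCount D W j)) :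
    ∃ s, IsTwist f 1 (-1) {(D, -1)} W s := by
  have h𝒜 : HasScalarAdjoints f {(D, (-1 : K))} := hasScalarAdjoints_singleton hD
  have hone : (-1 : K) ≠ 0 := neg_ne_zero.2 one_ne_zero
  refine exists_isTwist_of_strip hf.isRefl h𝒜
    (fun W => (∃ n : ℕ, ∀ x ∈ W, (D ^ n) x = 0) ∧
      (IsSquare (-1 : K) ∨ ∀ j, Odd j → Even (jordanCount D W j))) ?_ W ⟨hnil, hcond⟩
    (isAdapted_singleton hW hDW)
  rintro W ⟨⟨n, hn⟩, hcond⟩ hW hbot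
  have hDW : ∀ u ∈ W, D u ∈ W := hW.inv _ rfl
  obtain ⟨j, hz, hne⟩ := exists_nilpotency_index hbot ⟨n, hn⟩
  -- the remaining bookkeeping is the same for the three kinds of blocks
  have finish : ∀ {ι : Type} [Fintype ι] [Nonempty ι] (u : ι → V) (π : ι → ι),
      IsBlock f D (j + 1) u π → (∀ a, u a ∈ W) →
      (IsSquare (-1 : K) ∨ (Odd j → Even (Fintype.card ι))) →
      (∀ (v : ι → V) (c : ι → ι → K), (∀ a, v a = ∑ b, c a b • u b) →
        (∀ a, (-1 : K) • u a = ∑ b, c a b • v b) →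
        (∀ a b i, (-1) ^ i * f ((D ^ i) (v a)) (v b) = f ((D ^ i) (u a)) (u b)) →
      ∃ W₁ ≤ W, W₁ ≠ ⊥ ∧ IsAdapted f {(D, (-1 : K))} W₁ ∧
      (∃ s, IsTwist f 1 (-1) {(D, -1)} W₁ s) ∧
        ((∃ n : ℕ, ∀ x ∈ W ⊓ f.orthogonal W₁, (D ^ n) x = 0) ∧
        (IsSquare (-1 : K) ∨ ∀ j, Odd j → Even (jordanCount D (W ⊓ f.orthogonal W₁) j)))) := by
    intro ι _ _ u π hb huW hcard v c hv hu hG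
    have hle : chainSpan D u ≤ W := chainSpan_le hDW huW
    have had : IsAdapted f {(D, (-1 : K))} (chainSpan D u) :=
      isAdapted_singleton hb.nondeg chainSpan_inv
    obtain ⟨s, -, hs⟩ := hb.exists_isTwist hD hone v c hv hu hG {(D, (-1 : K))} (by
      rintro s hs p rfl a i
      exact comm_self_of_chain hs a i)
    refine ⟨chainSpan D u, hle, hb.ne_bot (Classical.arbitrary ι), had, ⟨s, hs⟩,
      ⟨n, fun x hx => hn x hx.1⟩, ?_⟩
    rcases hcond with h | h
    · exact Or.inl h
    rcases hcard with h' | h'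
    · exact Or.inl h'
    refine Or.inr fun k hk => ?_
    have := had.jordanCount_compl hf.isRefl h𝒜 hW hle (p := (D, -1)) rfl k
    rw [this, hb.jordanCount]
    refine (h k hk).sub ?_
    split_ifs with hkj
    · obtain rfl : k = j := by omega
      exact_mod_cast h' hk
    · exact Even.zero
  rcases Nat.even_or_odd j with hj | hj
  · obtain ⟨u, hu, v, hv, huu, hvv, huv1, huv0⟩ :=
      exists_isotropic_pair hf hD hW.nondeg hDW hj hz hne
    have hvu : ∀ i, f ((D ^ i) v) u = - (-1) ^ i * f ((D ^ i) u) v := fun i => by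
      rw [← hf.neg_eq, form_pow_adjoint hD]; ring
    have hb : IsBlock f D (j + 1) (fun b : Bool => bif b then u else v) not := by
      refine isBlock_of_chain hone hD Bool.not_injective ?_ ?_ ?_
      · rintro (_ | _)
        exacts [hz v hv, hz u hu]
      · rintro (_ | _)
        · change f ((D ^ j) v) u ≠ 0
          rw [hvu, huv1, hj.neg_one_pow]
          simp
        · change f ((D ^ j) u) v ≠ 0
          rw [huv1]
          exact one_ne_zero
      · rintro (_ | _) (_ | _) i h
        · exact hvv i
        · change f ((D ^ i) v) u = 0
          rw [hvu, huv0 i (by simpa using h), mul_zero]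
        · exact huv0 i (by simpa using h)
        · exact huu i
    refine finish _ _ hb (by rintro (_ | _); exacts [hv, hu]) (Or.inr fun _ => by simp)
      (fun b : Bool => bif b then v else -u)
      (fun a b => bif a then (bif b then 0 else 1) else (bif b then -1 else 0)) ?_ ?_ ?_
    · rintro (_ | _) <;> simp
    · rintro (_ | _) <;> simp
    · rintro (_ | _) (_ | _) i
      · simp [huu, hvv]
      · change (-1) ^ i * f ((D ^ i) (-u)) v = f ((D ^ i) v) u
        rw [hvu, map_neg, map_neg, LinearMap.neg_apply]
        ring
      · change (-1) ^ i * f ((D ^ i) v) (-u) = f ((D ^ i) u) v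
        have hs : ((-1 : K) ^ i) * (-1) ^ i = 1 := by rw [← mul_pow]; simp
        rw [map_neg, hvu]
        linear_combination (f ((D ^ i) u) v) * hs
      · simp [huu, hvv]
  · obtain ⟨u, hu, hα, huu⟩ := exists_selfdual_chain hf hD hW.nondeg hDW hj hz hne
    have hb : IsBlock f D (j + 1) (fun _ : Unit => u) id := by
      refine isBlock_of_chain hone hD Function.injective_id (fun _ => hz u hu) (fun _ => hα) ?_
      intro a b i h
      exact huu i (by simpa using h)
    by_cases hsq : IsSquare (-1 : K)
    · obtain ⟨i, hi⟩ := hsq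
      refine finish _ _ hb (fun _ => hu) (Or.inl ⟨i, hi⟩) (fun _ => i • u) (fun _ _ => i) (by simp)
        (by simp [smul_smul, ← hi]) ?_
      intro _ _ k
      simp only [map_smul, LinearMap.smul_apply, smul_eq_mul]
      by_cases hk : k = j
      · subst hk
        rw [hj.neg_one_pow]
        linear_combination (-f ((D ^ k) u) u) * hi.symm
      · rw [huu k hk]; ring
    · have hev := (hcond.resolve_left hsq) j hj
      have hle : chainSpan D (fun _ : Unit => u) ≤ W := chainSpan_le hDW fun _ => hu
      have had : IsAdapted f {(D, (-1 : K))} (chainSpan D (fun _ : Unit => u)) :=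
        isAdapted_singleton hb.nondeg chainSpan_inv
      have hcompl := had.compl hf.isRefl h𝒜 hW hle
      have hcount := had.jordanCount_compl hf.isRefl h𝒜 hW hle (p := (D, -1)) rfl j
      simp only [hb.jordanCount, if_true, Fintype.card_unit] at hcount
      set W₂ := W ⊓ f.orthogonal (chainSpan D fun _ : Unit => u)
      have hne₂ : ∃ x ∈ W₂, (D ^ j) x ≠ 0 := by
        by_contra! hc
        have h0 : W₂.map (D ^ j) = ⊥ := by
          rw [Submodule.eq_bot_iff]; rintro _ ⟨x, hx, rfl⟩; exact hc x hx
        rw [jordanCount_of_pow_eq_zero fun x (hx : x ∈ W₂) => hz x hx.1, h0, finrank_bot] at hcount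
        obtain ⟨m, hm⟩ := hev
        push_cast at hcount
        omega
      obtain ⟨v, hv, hβ, hvv⟩ := exists_selfdual_chain hf hD hcompl.nondeg (hcompl.inv _ rfl) hj
        (fun x (hx : x ∈ W₂) => hz x hx.1) hne₂
      have huv : ∀ i, f ((D ^ i) u) v = 0 := fun i =>
        hv.2 _ (mem_chainSpan D (fun _ : Unit => u) () i)
      have hvu : ∀ i, f ((D ^ i) v) u = 0 := fun i => by
        rw [← hf.neg_eq, form_pow_adjoint hD, huv]; simp
      have hb' : IsBlock f D (j + 1) (fun b : Bool => bif b then u else v) id := by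
        refine isBlock_of_chain hone hD Function.injective_id ?_ ?_ ?_
        · rintro (_ | _)
          exacts [hz v hv.1, hz u hu]
        · rintro (_ | _)
          exacts [hβ, hα]
        · rintro (_ | _) (_ | _) i h
          · exact hvv i (by simpa using h)
          · exact hvu i
          · exact huv i
          · exact huu i (by simpa using h)
      set α := f ((D ^ j) u) u
      set β := f ((D ^ j) v) v
      obtain ⟨x, y, hxy⟩ := hsum (α * β) (mul_ne_zero hα hβ)
      refine finish _ _ hb' (by rintro (_ | _); exacts [hv.1, hu]) (Or.inr fun _ => by simp)
        (fun b : Bool => bif b then x • u + (α * y) • v else (β * y) • u - x • v)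
        (fun a b => bif a then (bif b then x else α * y) else (bif b then β * y else -x)) ?_ ?_ ?_
      · rintro (_ | _)
        · simp [sub_eq_add_neg]
        · simp
      · rintro (_ | _)
        · simp only [Fintype.sum_bool, cond_true, cond_false]
          rw [← hxy]
          module
        · simp only [Fintype.sum_bool, cond_true, cond_false]
          rw [← hxy]
          module
      · rintro (_ | _) (_ | _) i <;>
          simp only [cond_true, cond_false, map_add, map_sub, map_smul, LinearMap.add_apply,
            LinearMap.sub_apply, LinearMap.smul_apply, smul_eq_mul, huv, hvu] <;>
          by_cases hi : i = j
        · subst hi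
          rw [hj.neg_one_pow]
          linear_combination (-β) * hxy
        · rw [huu i hi, hvv i hi]; ring
        · subst hi
          ring
        · rw [huu i hi, hvv i hi]; ring
        · subst hi
          ring
        · rw [huu i hi, hvv i hi]; ring
        · subst hi
          rw [hj.neg_one_pow]
          linear_combination (-α) * hxy
        · rw [huu i hi, hvv i hi]; ring

end Nilpotent

section Semisimple

variable {K V : Type*} [Field K] [AddCommGroup V] [Module K V]

/-! ### Polynomials in one operator -/

theorem aeval_apply_mem {T : Module.End K V} {W : Submodule K V} (hT : ∀ u ∈ W, T u ∈ W)
    (p : K[X]) : ∀ u ∈ W, aeval T p u ∈ W := by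
  intro u hu
  rw [aeval_endomorphism]
  exact Submodule.sum_mem _ fun i _ => W.smul_mem _ (pow_apply_mem hT i u hu)

theorem aeval_selfAdjoint {f : LinearMap.BilinForm K V} {T : Module.End K V}
    (hT : ∀ u v, f u (T v) = f (T u) v) (p : K[X]) (u v : V) :
    f u (aeval T p v) = f (aeval T p u) v := by
  have hk : ∀ (i : ℕ) (u v : V), f u ((T ^ i) v) = f ((T ^ i) u) v := fun i u v => by
    simpa using form_pow_adjoint (f := f) (c := (1 : K)) (by simpa using hT) i u v
  rw [aeval_endomorphism, aeval_endomorphism, Polynomial.sum_def, Polynomial.sum_def, map_sum,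
    map_sum, LinearMap.sum_apply]
  exact Finset.sum_congr rfl fun i _ => by
    rw [map_smul, hk, map_smul, LinearMap.smul_apply]

/-- The polynomials in `T` that vanish on `W` are the multiples of a nonzero polynomial. -/
theorem exists_annihilator [FiniteDimensional K V] (T : Module.End K V) (W : Submodule K V) :
    ∃ m : K[X], m ≠ 0 ∧ ∀ p : K[X], (∀ x ∈ W, aeval T p x = 0) ↔ m ∣ p := by
  let I : Ideal K[X] :=
    { carrier := {p | ∀ x ∈ W, aeval T p x = 0}
      add_mem' := fun {a b} ha hb x hx => by rw [map_add, LinearMap.add_apply, ha x hx, hb x hx,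
        add_zero]
      zero_mem' := fun x _ => by simp
      smul_mem' := fun c a ha x hx => by
        rw [smul_eq_mul, map_mul, Module.End.mul_apply, ha x hx, map_zero] }
  have hI : ∀ p : K[X], p ∈ I ↔ ∀ x ∈ W, aeval T p x = 0 := fun p => Iff.rfl
  refine ⟨Submodule.IsPrincipal.generator I, fun h0 => ?_, fun p => ?_⟩
  · rw [← Submodule.IsPrincipal.eq_bot_iff_generator_eq_zero] at h0
    have h1 : minpoly K T ∈ I := (hI _).2 fun x _ => by rw [minpoly.aeval]; rfl
    rw [h0] at h1
    exact minpoly.ne_zero (Algebra.IsIntegral.isIntegral T) h1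
  · rw [← hI, Submodule.IsPrincipal.mem_iff_generator_dvd]

/-- In a cyclic module killed by `π ^ (k + 1)` every nonzero element has a multiple equal to
`π ^ k` times the generator. -/
theorem exists_mul_eq_socle {T : Module.End K V} {π : K[X]} (hπ : Irreducible π) {k : ℕ} {w : V}
    (hw : aeval T (π ^ (k + 1)) w = 0) {b : K[X]} (hb : aeval T b w ≠ 0) :
    ∃ c : K[X], aeval T (c * b) w = aeval T (π ^ k) w := by
  have hb0 : b ≠ 0 := by rintro rfl; simp at hb
  obtain ⟨j, b', hb', rfl⟩ := WfDvdMonoid.max_power_factor hb0 hπ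
  have hj : j ≤ k := by
    by_contra hc
    refine hb ?_
    rw [mul_comm, show j = (j - (k + 1)) + (k + 1) by omega, pow_add, ← mul_assoc, map_mul,
      Module.End.mul_apply, hw, map_zero]
  obtain ⟨s, t, hst⟩ := ((hπ.coprime_iff_not_dvd.2 hb').symm.pow_right (n := k + 1))
  refine ⟨s * π ^ (k - j), ?_⟩
  have : s * π ^ (k - j) * (π ^ j * b') = π ^ k - (π ^ k * t) * π ^ (k + 1) := by
    have h1 : π ^ (k - j) * π ^ j = π ^ k := by rw [← pow_add, Nat.sub_add_cancel hj]
    linear_combination (s * b') * h1 + π ^ k * hst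
  rw [this, map_sub, LinearMap.sub_apply, map_mul, Module.End.mul_apply _ _ w, hw, map_zero,
    sub_zero]

/-! ### A quadratic equation over finite algebras -/

theorem exists_sq_add_mul_sq {F : Type*} [Field F] [Finite F] (h2 : ringChar F ≠ 2) {a : F}
    (ha : a ≠ 0) (c : F) : ∃ x y : F, x ^ 2 + a * y ^ 2 = c := by
  cases nonempty_fintype F
  obtain ⟨x, y, h⟩ := FiniteField.exists_root_sum_quadratic (R := F) (f := X ^ 2 - C c)
    (g := C a * X ^ 2) (degree_X_pow_sub_C (by norm_num) c)
    (by rw [degree_C_mul_X_pow 2 ha]; rfl) (FiniteField.odd_card_of_char_ne_two h2)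
  refine ⟨x, y, ?_⟩
  simp only [eval_sub, eval_pow, eval_X, eval_C, eval_mul] at h
  linear_combination h

/-- In a finite commutative algebra over a field of odd characteristic, `a ^ 2 - z b ^ 2 = -1` is
solvable for every unit `z`: it is solvable in each residue field, hence modulo the nilradical, and
a unipotent element `1 - n` has an inverse square root among its powers. -/
theorem exists_sq_sub_unit_mul_sq [Finite K] {A : Type*} [CommRing A] [Finite A] [Algebra K A]
    (h2 : ringChar K ≠ 2) {z : A} (hz : IsUnit z) : ∃ a b : A, a ^ 2 - z * b ^ 2 = -1 := by
  have hloc : ∀ M : MaximalSpectrum A, ∃ x y : A ⧸ M.asIdeal,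
      x ^ 2 - Ideal.Quotient.mk M.asIdeal z * y ^ 2 = -1 := by
    intro M
    have := M.isMaximal
    let : Field (A ⧸ M.asIdeal) := Ideal.Quotient.field _
    have : Finite (A ⧸ M.asIdeal) := Quotient.finite _
    have hchar : ringChar (A ⧸ M.asIdeal) ≠ 2 := by
      rwa [← Algebra.ringChar_eq K (A ⧸ M.asIdeal)]
    have hz0 : Ideal.Quotient.mk M.asIdeal z ≠ 0 := (hz.map _).ne_zero
    obtain ⟨x, y, h⟩ := exists_sq_add_mul_sq hchar (neg_ne_zero.2 hz0) (-1)
    exact ⟨x, y, by rw [← h]; ring⟩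
  choose x y hxy using hloc
  have hsurj : ∀ t : ∀ M : MaximalSpectrum A, A ⧸ M.asIdeal,
      ∃ a : A, ∀ M : MaximalSpectrum A, Ideal.Quotient.mk M.asIdeal a = t M := by
    intro t
    obtain ⟨a, ha⟩ := Ideal.Quotient.mk_surjective ((IsArtinianRing.quotNilradicalEquivPi A).symm t)
    refine ⟨a, fun M => ?_⟩
    have := congrArg (IsArtinianRing.quotNilradicalEquivPi A) ha
    rw [AlgEquiv.apply_symm_apply] at this
    exact congrFun this M
  obtain ⟨a, ha⟩ := hsurj x
  obtain ⟨b, hb⟩ := hsurj y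
  set n := a ^ 2 - z * b ^ 2 + 1 with hn
  have hnil : IsNilpotent n := by
    rw [← mem_nilradical, nilradical_eq_sInf, Ideal.mem_sInf]
    intro P hP
    have hP : P.IsPrime := hP
    have hM : P.IsMaximal := Ideal.IsPrime.isMaximal' hP
    have := hxy ⟨P, hM⟩
    rw [← ha, ← hb] at this
    rw [← Ideal.Quotient.eq_zero_iff_mem, hn]
    simp only [map_add, map_sub, map_mul, map_pow, map_one]
    rw [this]
    ring
  obtain ⟨p, hp⟩ := CharP.exists K
  have hA : CharP A p ∨ Subsingleton A := by
    rcases subsingleton_or_nontrivial A with h | h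
    · exact Or.inr h
    · exact Or.inl (charP_of_injective_algebraMap (algebraMap K A).injective p)
  rcases hA with hA | hA
  swap
  · exact ⟨0, 0, Subsingleton.elim _ _⟩
  have hpp : p.Prime := CharP.char_is_prime K p
  have hodd : Odd p := hpp.odd_of_ne_two fun h => h2 (by
    rw [ringChar.eq K p, h])
  have := Fact.mk hpp
  obtain ⟨N, hN⟩ := hnil
  have hpow : (1 - n) ^ (p ^ N) = 1 := by
    rw [sub_pow_char_pow, one_pow, pow_eq_zero_of_le (Nat.lt_pow_self hpp.one_lt).le hN, sub_zero]
  obtain ⟨M, hM⟩ := hodd.pow (n := N)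
  refine ⟨a * (1 - n) ^ M, b * (1 - n) ^ M, ?_⟩
  rw [hM] at hpow
  linear_combination (-1 : A) * hpow + (1 - n) ^ (2 * M) * hn
end Semisimple

section Inverting

variable {K V : Type*} [Field K] [AddCommGroup V] [Module K V]

/-! ### Isometries of square `-1` inverting a given isometry: the part without eigenvalues `±1` -/

/-- The operators `D = φ - φ⁻¹` and `S = φ + φ⁻¹` attached to an isometry `φ`: they commute, `D` is
skew-adjoint, `S` is self-adjoint, and `D ^ 2 = S ^ 2 - 4`. -/
structure IsSumDiff (f : LinearMap.BilinForm K V) (D S : Module.End K V) : Prop where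
  skew : ∀ u v, f u (D v) = -1 * f (D u) v
  self : ∀ u v, f u (S v) = f (S u) v
  comm : Commute D S
  sq : D * D = S * S - 4

theorem IsSumDiff.hasScalarAdjoints {f : LinearMap.BilinForm K V} {D S : Module.End K V}
    (h : IsSumDiff f D S) (a b : K) : HasScalarAdjoints f {(D, a), (S, b)} := by
  rintro p (rfl | rfl)
  · exact ⟨-1, h.skew⟩
  · exact ⟨1, fun u v => by rw [one_mul]; exact h.self u v⟩

theorem IsSumDiff.sq_apply {f : LinearMap.BilinForm K V} {D S : Module.End K V}
    (h : IsSumDiff f D S) (x : V) : D (D x) = aeval S (X ^ 2 - 4 : K[X]) x := by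
  rw [map_sub, map_pow, aeval_X, map_ofNat, pow_two, ← h.sq]
  rfl

theorem IsSumDiff.comm_aeval {f : LinearMap.BilinForm K V} {D S : Module.End K V}
    (h : IsSumDiff f D S) (p : K[X]) (x : V) : D (aeval S p x) = aeval S p (D x) :=
  LinearMap.congr_fun (Algebra.commute_of_mem_adjoin_singleton_of_commute
    (aeval_mem_adjoin_singleton K (p := p) S) h.comm).eq x

theorem aeval_aeval_apply (S : Module.End K V) (p q : K[X]) (x : V) :
    aeval S p (aeval S q x) = aeval S (p * q) x := by rw [map_mul, Module.End.mul_apply]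

theorem isAdapted_pair {f : LinearMap.BilinForm K V} {D S : Module.End K V} {a b : K}
    {W : Submodule K V} (hW : IsNondegOn f W) (hD : ∀ u ∈ W, D u ∈ W) (hS : ∀ u ∈ W, S u ∈ W) :
    IsAdapted f {(D, a), (S, b)} W := ⟨hW, by rintro p (rfl | rfl); exacts [hD, hS]⟩

/-- Where `D` is injective there is an involution of multiplier `-1` which commutes with `S` and
anticommutes with `D`. On a cyclic module `K[S] w + D K[S] w` it is `a(S) w + D b(S) w ↦
a(S) w - D b(S) w`, and `W` is an orthogonal sum of nondegenerate cyclic modules because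
`f (D p(S) u) v` is symmetric. -/
theorem exists_skew_involution [FiniteDimensional K V] [NeZero (2 : K)]
    {f : LinearMap.BilinForm K V} (hf : f.IsAlt) {D S : Module.End K V} (h : IsSumDiff f D S)
    {W : Submodule K V} (hW : IsNondegOn f W) (hDW : ∀ u ∈ W, D u ∈ W) (hSW : ∀ u ∈ W, S u ∈ W)
    (hinj : ∀ u ∈ W, D u = 0 → u = 0) :
    ∃ s, IsTwist f (-1) 1 {(D, -1), (S, 1)} W s := by
  have h𝒜 := h.hasScalarAdjoints (-1) 1
  refine exists_isTwist_of_strip hf.isRefl h𝒜 (fun W => ∀ u ∈ W, D u = 0 → u = 0) ?_ W hinj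
    (isAdapted_pair hW hDW hSW)
  intro W hinj hW hbot
  have hDW : ∀ u ∈ W, D u ∈ W := hW.inv _ (Or.inl rfl)
  have hSW : ∀ u ∈ W, S u ∈ W := hW.inv _ (Or.inr rfl)
  have hself := aeval_selfAdjoint h.self
  have hcomm := h.comm_aeval
  have hmul := aeval_aeval_apply S
  have hsymm : ∀ (p : K[X]) (u v : V), f (D (aeval S p u)) v = f (D (aeval S p v)) u := by
    intro p u v
    rw [← hf.neg_eq, h.skew, hself, ← hcomm]
    ring
  obtain ⟨m, hm0, hm⟩ := exists_annihilator S W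
  have hmu : ¬ IsUnit m := fun hu => hbot <| (Submodule.eq_bot_iff _).2 fun x hx => by
    simpa using (hm 1).2 hu.dvd x hx
  obtain ⟨π, hπ, hπm⟩ := WfDvdMonoid.exists_irreducible_factor hmu hm0
  obtain ⟨k, r, hr, hmr⟩ := WfDvdMonoid.max_power_factor hm0 hπ
  obtain ⟨k, rfl⟩ : ∃ l, k = l + 1 := by
    refine Nat.exists_eq_succ_of_ne_zero ?_
    rintro rfl
    rw [pow_zero, one_mul] at hmr
    exact hr (hmr ▸ hπm)
  have hnd : ¬ m ∣ π ^ k * (r * r) := by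
    rw [hmr, pow_succ, mul_assoc]
    intro hd
    have := (mul_dvd_mul_iff_left (pow_ne_zero k hπ.ne_zero)).1 hd
    have := (dvd_of_mul_right_dvd this)
    exact (hπ.prime.dvd_or_dvd this).elim hr hr
  rw [← hm] at hnd
  push Not at hnd
  obtain ⟨x, hx, hx0⟩ := hnd
  have hDx : D (aeval S (π ^ k * (r * r)) x) ≠ 0 := fun h0 =>
    hx0 (hinj _ (aeval_apply_mem hSW _ x hx) h0)
  obtain ⟨y, hy, hxy⟩ : ∃ y ∈ W, f (D (aeval S (π ^ k * (r * r)) x)) y ≠ 0 := by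
    by_contra! hc
    exact hDx (hW.nondeg _ (hDW _ (aeval_apply_mem hSW _ x hx)) hc)
  obtain ⟨u, hu, hu0⟩ := exists_diag_ne_zero (F := f ∘ₗ D ∘ₗ (aeval S (π ^ k * (r * r))))
    (fun u v => hsymm _ u v) hx hy hxy
  -- the generator `w` of a nondegenerate cyclic module
  let w := aeval S r u
  have hwW : w ∈ W := aeval_apply_mem hSW r u hu
  have hw0 : aeval S (π ^ (k + 1)) w = 0 := by
    rw [hmul, ← hmr]
    exact (hm m).2 dvd_rfl u hu
  have hwne : f (D (aeval S (π ^ k) w)) w ≠ 0 := by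
    have : f (D (aeval S (π ^ k) w)) w = f (D (aeval S (π ^ k * (r * r)) u)) u := by
      rw [hmul, hself, hcomm, hcomm, hmul]
      ring_nf
    rw [this]
    exact hu0
  have heven : ∀ p : K[X], f (aeval S p w) w = 0 := fun p => by
    have h1 : (2 : K) * f (aeval S p w) w = 0 := by
      have h1 := hf.neg_eq (aeval S p w) w
      have h2 := hself p w w
      linear_combination -h1 - h2
    exact (mul_eq_zero.1 h1).resolve_left (NeZero.ne _)
  let g : K[X] × K[X] → V := fun p => aeval S p.1 w + D (aeval S p.2 w)
  let g' : K[X] × K[X] → V := fun p => aeval S p.1 w - D (aeval S p.2 w)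
  have hsq := h.sq_apply
  have hgram : ∀ p q : K[X] × K[X], f (g p) (g q) =
      f (D (aeval S (p.2 * q.1) w)) w - f (D (aeval S (p.1 * q.2) w)) w := by
    intro p q
    have h1 : f (aeval S p.1 w) (aeval S q.1 w) = 0 := by rw [hself, hmul, heven]
    have h2 : f (aeval S p.1 w) (D (aeval S q.2 w)) = - f (D (aeval S (p.1 * q.2) w)) w := by
      rw [h.skew, hself, ← hcomm, hmul, mul_comm q.2]; ring
    have h3 : f (D (aeval S p.2 w)) (aeval S q.1 w) = f (D (aeval S (p.2 * q.1) w)) w := by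
      rw [hself, ← hcomm, hmul, mul_comm q.1]
    have h4 : f (D (aeval S p.2 w)) (D (aeval S q.2 w)) = 0 := by
      rw [h.skew, hsq, hself, hmul, hmul, heven, mul_zero]
    simp only [g, map_add, LinearMap.add_apply, h1, h2, h3, h4]
    ring
  have hg' : ∀ p, g' p = g (p.1, -p.2) := fun p => by simp [g, g', sub_eq_add_neg]
  have hg'range : Set.range g' = Set.range g := by
    ext v
    constructor
    · rintro ⟨p, rfl⟩
      exact ⟨_, (hg' p).symm⟩
    · rintro ⟨p, rfl⟩
      exact ⟨(p.1, -p.2), by simp [hg']⟩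
  set W₁ := Submodule.span K (Set.range g) with hW₁
  have hmem : ∀ v ∈ W₁, ∃ p, v = g p := by
    intro v hv
    induction hv using Submodule.span_induction with
    | mem x hx => obtain ⟨p, rfl⟩ := hx; exact ⟨p, rfl⟩
    | zero => exact ⟨(0, 0), by simp [g]⟩
    | add x y _ _ hx hy =>
      obtain ⟨p, rfl⟩ := hx
      obtain ⟨q, rfl⟩ := hy
      exact ⟨(p.1 + q.1, p.2 + q.2), by simp only [g, map_add, LinearMap.add_apply]; abel⟩
    | smul c x _ hx =>
      obtain ⟨p, rfl⟩ := hx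
      exact ⟨(c • p.1, c • p.2), by simp [g]⟩
  have hgmem : ∀ p, g p ∈ W₁ := fun p => Submodule.subset_span ⟨p, rfl⟩
  have hle : W₁ ≤ W := by
    rw [hW₁, Submodule.span_le]
    rintro _ ⟨p, rfl⟩
    exact W.add_mem (aeval_apply_mem hSW _ _ hwW) (hDW _ (aeval_apply_mem hSW _ _ hwW))
  have hkill : ∀ b : K[X], (∀ c : K[X], f (D (aeval S (b * c) w)) w = 0) → aeval S b w = 0 := by
    intro b hb
    by_contra hb0
    obtain ⟨c, hc⟩ := exists_mul_eq_socle hπ hw0 hb0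
    have := hb c
    rw [mul_comm, hc] at this
    exact hwne this
  have hnd : IsNondegOn f W₁ := by
    intro v hv hv0
    obtain ⟨p, rfl⟩ := hmem v hv
    have h2 : aeval S p.2 w = 0 := hkill _ fun c => by
      have := hv0 _ (hgmem (c, 0))
      rw [hgram] at this
      simpa using this
    have h1 : aeval S p.1 w = 0 := hkill _ fun c => by
      have := hv0 _ (hgmem (0, c))
      rw [hgram] at this
      simpa using this
    simp [g, h1, h2]
  have hSg : ∀ p, S (g p) = g (X * p.1, X * p.2) := fun p => by
    have hX : ∀ (q : K[X]) x, S (aeval S q x) = aeval S (X * q) x := fun q x => by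
      rw [map_mul, aeval_X, Module.End.mul_apply]
    have hc : ∀ x, S (D x) = D (S x) := fun x => (LinearMap.congr_fun h.comm.eq x).symm
    simp only [g, map_add, hc, hX]
  have hDg : ∀ p, D (g p) = g ((X ^ 2 - 4) * p.2, p.1) := fun p => by
    simp only [g, map_add, hsq, hmul]
    abel
  have hinv : IsAdapted f {(D, (-1 : K)), (S, 1)} W₁ := by
    refine isAdapted_pair hnd (fun v hv => ?_) (fun v hv => ?_)
    · obtain ⟨p, rfl⟩ := hmem v hv
      rw [hDg]; exact hgmem _
    · obtain ⟨p, rfl⟩ := hmem v hv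
      rw [hSg]; exact hgmem _
  obtain ⟨s, -, hs⟩ := exists_isTwist_on_span (f := f) g g' (-1) 1 {(D, (-1 : K)), (S, 1)} W₁ rfl
    (by rw [hg'range]) hnd
    (fun p q => by
      rw [hg', hg', hgram, hgram]
      simp only [mul_neg, neg_mul, map_neg, LinearMap.neg_apply]
      ring)
    (fun s hs p => by rw [hg', hs, hg']; simp)
    (by
      rintro s hs p (rfl | rfl) q
      · simp only
        rw [hDg, hs, hg', hg', hDg]
        simp [g]
      · simp only
        rw [hSg, hs, hg', hg', hSg]
        simp)
  refine ⟨W₁, hle, fun h0 => ?_, hinv, ⟨s, hs⟩, fun v hv => hinj v hv.1⟩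
  have hw1 : w ∈ W₁ := by simpa [g] using hgmem (1, 0)
  rw [h0, Submodule.mem_bot] at hw1
  rw [hw1] at hwne
  simp at hwne

/-- Where `D` is injective, composing the involution of multiplier `-1` with a suitable element
`a(S) + D b(S)` gives an isometry of square `-1`. -/
theorem exists_isTwist_of_injective [FiniteDimensional K V] [Finite K] (h2 : ringChar K ≠ 2)
    [NeZero (2 : K)]
    {f : LinearMap.BilinForm K V} (hf : f.IsAlt) {D S : Module.End K V} (h : IsSumDiff f D S)
    {W : Submodule K V} (hW : IsNondegOn f W) (hDW : ∀ u ∈ W, D u ∈ W) (hSW : ∀ u ∈ W, S u ∈ W)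
    (hinj : ∀ u ∈ W, D u = 0 → u = 0) :
    ∃ s, IsTwist f 1 (-1) {(D, -1), (S, 1)} W s := by
  obtain ⟨σ, hσ⟩ := exists_skew_involution hf h hW hDW hSW hinj
  obtain ⟨m, hm0, hm⟩ := exists_annihilator S W
  have hsq := h.sq_apply
  have hself := aeval_selfAdjoint h.self
  have hcomm := h.comm_aeval
  have hmul := aeval_aeval_apply S
  -- `S ^ 2 - 4 = D ^ 2` is injective on `W`, so `X ^ 2 - 4` is a unit modulo `m`
  have hcop : IsCoprime (X ^ 2 - 4 : K[X]) m := by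
    refine isCoprime_of_irreducible_dvd (fun h => hm0 h.2) fun π hπ hπz ⟨r, hr⟩ => ?_
    obtain ⟨t, ht⟩ := hπz
    have : ∀ x ∈ W, aeval S r x = 0 := fun x hx => by
      have hrx := aeval_apply_mem hSW r x hx
      refine hinj _ hrx (hinj _ (hDW _ hrx) ?_)
      rw [hsq, hmul, ht, show π * t * r = t * (π * r) by ring, ← hr, ← hmul, (hm m).2 dvd_rfl x hx,
        map_zero]
    rw [hm, hr] at this
    have hr0 : r ≠ 0 := by rintro rfl; simp at hr; exact hm0 hr
    exact hπ.not_isUnit (isUnit_of_dvd_one ((mul_dvd_mul_iff_right hr0).1 (by simpa using this)))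
  have hfin : Finite (AdjoinRoot m) := by
    have : Module.Finite K (AdjoinRoot m) := (AdjoinRoot.powerBasis hm0).finite
    exact Module.finite_of_finite K
  have hunit : IsUnit (AdjoinRoot.mk m (X ^ 2 - 4)) := by
    obtain ⟨a, b, hab⟩ := hcop
    refine IsUnit.of_mul_eq_one (AdjoinRoot.mk m a) ?_
    have := congrArg (AdjoinRoot.mk m) hab
    rw [map_add, map_mul, map_mul, AdjoinRoot.mk_self, mul_zero, add_zero, map_one] at this
    rw [mul_comm, this]
  obtain ⟨a, b, hab⟩ := exists_sq_sub_unit_mul_sq (K := K) h2 hunit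
  obtain ⟨a, rfl⟩ := AdjoinRoot.mk_surjective a
  obtain ⟨b, rfl⟩ := AdjoinRoot.mk_surjective b
  have hdvd : m ∣ a ^ 2 - (X ^ 2 - 4) * b ^ 2 + 1 := by
    rw [← AdjoinRoot.mk_eq_zero, map_add, map_sub, map_mul, map_pow, map_pow, hab, map_one]
    ring
  have hN : ∀ x ∈ W, aeval S (a * a) x - aeval S ((X ^ 2 - 4) * (b * b)) x = -x := by
    intro x hx
    have := (hm _).2 hdvd x hx
    rw [map_add, map_sub, LinearMap.add_apply, LinearMap.sub_apply, map_one, Module.End.one_apply,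
      sq, sq b] at this
    rw [← sub_eq_zero, sub_neg_eq_add, this]
  let c : Module.End K V := aeval S a + D * aeval S b
  let c' : Module.End K V := aeval S a - D * aeval S b
  have hcx : ∀ x, c x = aeval S a x + D (aeval S b x) := fun x => rfl
  have hcx' : ∀ x, c' x = aeval S a x - D (aeval S b x) := fun x => rfl
  have hcW : ∀ x ∈ W, c x ∈ W := fun x hx =>
    W.add_mem (aeval_apply_mem hSW _ _ hx) (hDW _ (aeval_apply_mem hSW _ _ hx))
  have hcc : ∀ x ∈ W, c' (c x) = -x := by
    intro x hx
    rw [← hN x hx, hcx, hcx']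
    simp only [map_add, hmul, ← hcomm, hsq]
    rw [mul_comm b a, ← hmul (X ^ 2 - 4)]
    abel
  have hσS : ∀ (p : K[X]), ∀ x ∈ W, σ (aeval S p x) = aeval S p (σ x) := by
    intro p x hx
    have hk : ∀ i : ℕ, ∀ x ∈ W, σ ((S ^ i) x) = (S ^ i) (σ x) := by
      intro i
      induction i with
      | zero => simp
      | succ i ih =>
        intro x hx
        rw [pow_succ, Module.End.mul_apply, Module.End.mul_apply, ih _ (hSW x hx)]
        congr 1
        simpa using hσ.comm (S, 1) (Or.inr rfl) x hx
    rw [aeval_endomorphism, aeval_endomorphism, Polynomial.sum_def, Polynomial.sum_def, map_sum]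
    exact Finset.sum_congr rfl fun i _ => by rw [map_smul, hk i x hx]
  have hσD : ∀ x ∈ W, σ (D x) = - D (σ x) := fun x hx => by
    simpa using hσ.comm (D, -1) (Or.inl rfl) x hx
  have hσc : ∀ x ∈ W, σ (c x) = c' (σ x) := by
    intro x hx
    rw [hcx, hcx', map_add, hσS a x hx, hσD _ (aeval_apply_mem hSW b x hx), hσS b x hx]
    abel
  refine ⟨σ * c, fun u hu => hσ.mapsTo _ (hcW u hu), fun u hu v hv => ?_, fun u hu => ?_, ?_⟩
  · change f (σ (c u)) (σ (c v)) = _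
    rw [hσ.form _ (hcW u hu) _ (hcW v hv)]
    have hadj : ∀ x y, f x (c y) = f (c' x) y := fun x y => by
      rw [hcx, hcx', map_add, hself, h.skew, hself, hcomm, map_sub, LinearMap.sub_apply]
      ring
    rw [hadj, hcc u hu, map_neg, LinearMap.neg_apply]
    ring
  · change σ (c (σ (c u))) = _
    rw [hσc _ (hσ.mapsTo _ (hcW u hu)), hσ.sq _ (hcW u hu), one_smul, hcc u hu, neg_one_smul]
  · rintro p (rfl | rfl) u hu
    · change σ (c (D u)) = (-1 : K) • D (σ (c u))
      have : c (D u) = D (c u) := by rw [hcx, hcx, map_add, ← hcomm, ← hcomm]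
      rw [this, hσD _ (hcW u hu), neg_one_smul]
    · change σ (c (S u)) = (1 : K) • S (σ (c u))
      have hSD : ∀ x, S (D x) = D (S x) := fun x => (LinearMap.congr_fun h.comm.eq x).symm
      have hX : ∀ (q : K[X]) x, aeval S q (S x) = S (aeval S q x) := fun q x => by
        have h1 := hmul q X x
        have h2 := hmul X q x
        rw [aeval_X] at h1 h2
        rw [h1, h2, mul_comm]
      have : c (S u) = S (c u) := by rw [hcx, hcx, map_add, hX, hX, hSD]
      rw [this]
      exact hσ.comm (S, 1) (Or.inr rfl) _ (hcW u hu)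

/-! ### Isometries of square `-1` inverting a given isometry: the general case -/

/-- `φ` is an isometry of `f` and `ψ` is its inverse. -/
structure IsIsometryPair (f : LinearMap.BilinForm K V) (φ ψ : Module.End K V) : Prop where
  mul_eq_one : φ * ψ = 1
  mul_eq_one' : ψ * φ = 1
  adj : ∀ u v, f u (φ v) = f (ψ u) v

namespace IsIsometryPair

variable {f : LinearMap.BilinForm K V} {φ ψ : Module.End K V}

theorem apply_apply (h : IsIsometryPair f φ ψ) (x : V) : φ (ψ x) = x :=
  LinearMap.congr_fun h.mul_eq_one x

theorem apply_apply' (h : IsIsometryPair f φ ψ) (x : V) : ψ (φ x) = x :=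
  LinearMap.congr_fun h.mul_eq_one' x

theorem adj' (h : IsIsometryPair f φ ψ) (u v : V) : f u (ψ v) = f (φ u) v := by
  have := h.adj (φ u) (ψ v)
  rw [h.apply_apply, h.apply_apply'] at this
  exact this.symm

theorem isSumDiff (h : IsIsometryPair f φ ψ) : IsSumDiff f (φ - ψ) (φ + ψ) where
  skew u v := by
    rw [LinearMap.sub_apply, LinearMap.sub_apply, map_sub, map_sub, LinearMap.sub_apply, h.adj,
      h.adj']
    ring
  self u v := by
    rw [LinearMap.add_apply, LinearMap.add_apply, map_add, map_add, LinearMap.add_apply, h.adj,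
      h.adj']
    ring
  comm := by
    rw [commute_iff_eq]
    simp only [sub_mul, mul_add, mul_sub, add_mul, h.mul_eq_one, h.mul_eq_one']
    abel
  sq := by
    have : (4 : Module.End K V) = 1 + 1 + 1 + 1 := by norm_num
    rw [this]
    simp only [sub_mul, mul_add, mul_sub, add_mul, h.mul_eq_one, h.mul_eq_one']
    abel

theorem mul_sub_eq (h : IsIsometryPair f φ ψ) {c : K} (hc : c * c = 1) :
    φ * (φ + ψ - (2 * c) • 1) = (φ - c • 1) * (φ - c • 1) := by
  refine LinearMap.ext fun x => ?_
  have hx : φ (ψ x) = (c * c) • x := by rw [hc, one_smul, h.apply_apply]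
  simp only [Module.End.mul_apply, LinearMap.sub_apply, LinearMap.add_apply, LinearMap.smul_apply,
    Module.End.one_apply, map_add, map_sub, map_smul, hx]
  module

theorem apply_eq_zero_of_sub (h : IsIsometryPair f φ ψ) {c : K} (hc : c * c = 1) {x : V}
    (hx : (φ - c • 1) x = 0) : (φ + ψ - (2 * c) • 1) x = 0 := by
  have h1 := LinearMap.congr_fun (h.mul_sub_eq hc) x
  rw [Module.End.mul_apply, Module.End.mul_apply, hx, map_zero] at h1
  rw [← h.apply_apply' ((φ + ψ - (2 * c) • 1) x), h1, map_zero]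

theorem sub_smul_self (h : IsIsometryPair f φ ψ) (c : K) (u v : V) :
    f u ((φ + ψ - (2 * c) • 1 : Module.End K V) v) =
      1 * f ((φ + ψ - (2 * c) • 1 : Module.End K V) u) v := by
  have := h.isSumDiff.self u v
  rw [LinearMap.sub_apply, LinearMap.sub_apply, map_sub, map_sub, LinearMap.sub_apply, this]
  simp

theorem inv_of_commute {T R : Module.End K V} (hTR : Commute T R) {W : Submodule K V}
    (hR : ∀ u ∈ W, R u ∈ W) : ∀ u ∈ nilPart T W, R u ∈ nilPart T W := by
  rintro u ⟨hu, hu0⟩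
  refine ⟨hR u hu, ?_⟩
  have h1 := LinearMap.congr_fun (hTR.pow_left (Module.finrank K V)).eq u
  have h2 : (T ^ Module.finrank K V) u = 0 := hu0
  rw [Module.End.mul_apply, Module.End.mul_apply, h2, map_zero] at h1
  exact h1

theorem commute_sum (h : IsIsometryPair f φ ψ) (c : K) :
    Commute (φ + ψ - c • 1) φ ∧ Commute (φ + ψ - c • 1) ψ := by
  have h1 : Commute φ ψ := by rw [commute_iff_eq, h.mul_eq_one, h.mul_eq_one']
  exact ⟨((Commute.refl _).add_left h1.symm).sub_left ((Commute.one_left _).smul_left _),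
    (h1.add_left (Commute.refl _)).sub_left ((Commute.one_left _).smul_left _)⟩

/-- On the generalised eigenspace for `c = ±1`, the operator `φ + c` is injective. -/
theorem injOn_add [NeZero (2 : K)] (h : IsIsometryPair f φ ψ) {c : K} (hc : c * c = 1)
    {W : Submodule K V} {x : V} (hx : x ∈ nilPart (φ + ψ - (2 * c) • 1) W)
    (h0 : (φ - (-c) • 1) x = 0) : x = 0 := by
  have h2 : (2 : K) ≠ 0 := NeZero.ne _
  have hc0 : c ≠ 0 := by rintro rfl; simp at hc
  have h1 := h.apply_eq_zero_of_sub (c := -c) (by rw [neg_mul_neg, hc]) h0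
  have h3 : (φ + ψ - (2 * c) • 1 : Module.End K V) x = (-(2 * 2 * c)) • x := by
    have : (φ + ψ - (2 * c) • 1 : Module.End K V) x =
        (φ + ψ - (2 * -c) • 1 : Module.End K V) x - (2 * 2 * c) • x := by
      simp only [LinearMap.sub_apply, LinearMap.add_apply, LinearMap.smul_apply,
        Module.End.one_apply]
      module
    rw [this, h1, zero_sub, neg_smul]
  have h4 : ∀ k : ℕ, ((φ + ψ - (2 * c) • 1 : Module.End K V) ^ k) x = (-(2 * 2 * c)) ^ k • x := by
    intro k
    induction k with
    | zero => simp
    | succ k ih => rw [pow_succ, Module.End.mul_apply, h3, map_smul, ih, smul_smul, pow_succ']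
  have h5 : ((φ + ψ - (2 * c) • 1 : Module.End K V) ^ Module.finrank K V) x = 0 := hx.2
  rw [h4] at h5
  refine (smul_eq_zero.1 h5).resolve_left (pow_ne_zero _ (neg_ne_zero.2 ?_))
  exact mul_ne_zero (mul_ne_zero h2 h2) hc0

/-- On a generalised eigenspace for `c = ±1` the operator `S` is a polynomial in `S ^ 2`, because a
power of `S` whose exponent is a large power of the characteristic is scalar there. -/
theorem exists_sum_eq_pow [Finite K] (h2 : ringChar K ≠ 2) {S : Module.End K V} {c : K}
    (hc : c ≠ 0) (W : Submodule K V) :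
    ∃ (κ : K) (M : ℕ), ∀ x ∈ nilPart (S - c • 1) W, S x = κ • ((S ^ 2) ^ M) x := by
  obtain ⟨p, hp⟩ := CharP.exists K
  have hpp : p.Prime := CharP.char_is_prime K p
  have := Fact.mk hpp
  have hodd : Odd p := hpp.odd_of_ne_two fun h => h2 (by rw [ringChar.eq K p, h])
  set N := Module.finrank K V
  obtain ⟨M, hM⟩ := hodd.pow (n := N)
  refine ⟨(c ^ (p ^ N))⁻¹, M + 1, fun x hx => ?_⟩
  have hx0 : ((S - c • 1 : Module.End K V) ^ N) x = 0 := hx.2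
  have hpoly : (S - c • 1 : Module.End K V) ^ (p ^ N) = S ^ (p ^ N) - (c ^ (p ^ N)) • 1 := by
    have h3 := congrArg (aeval S) (sub_pow_char_pow (p := p) (X : K[X]) (C c) N)
    rwa [map_pow, map_sub, map_sub, map_pow, map_pow, aeval_X, aeval_C,
      Algebra.algebraMap_eq_smul_one, _root_.smul_pow, one_pow] at h3
  have h4 : ((S - c • 1 : Module.End K V) ^ (p ^ N)) x = 0 := by
    rw [← Nat.sub_add_cancel (Nat.lt_pow_self hpp.one_lt).le, pow_add, Module.End.mul_apply, hx0,
      map_zero]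
  rw [hpoly, LinearMap.sub_apply, LinearMap.smul_apply, Module.End.one_apply, sub_eq_zero] at h4
  rw [← pow_mul, show 2 * (M + 1) = (2 * M + 1) + 1 by ring, ← hM, pow_succ', Module.End.mul_apply,
    h4, map_smul, smul_smul, inv_mul_cancel₀ (pow_ne_zero _ hc), one_smul]

variable [FiniteDimensional K V]

/-- The Jordan blocks of `φ` for the eigenvalue `c = ±1` are those of `D = φ - φ⁻¹` on the
corresponding generalised eigenspace. -/
theorem jordanCount_nilPart [NeZero (2 : K)] (hf : f.IsRefl) (h : IsIsometryPair f φ ψ) {c : K}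
    (hc : c * c = 1) {W : Submodule K V} (hW : IsNondegOn f W) (hφ : ∀ u ∈ W, φ u ∈ W)
    (hψ : ∀ u ∈ W, ψ u ∈ W) (j : ℕ) :
    jordanCount (φ - ψ) (nilPart (φ + ψ - (2 * c) • 1) W) j = jordanCount (φ - c • 1) W j := by
  set T : Module.End K V := φ + ψ - (2 * c) • 1 with hT
  have hTW : ∀ u ∈ W, T u ∈ W := fun u hu =>
    W.sub_mem (W.add_mem (hφ u hu) (hψ u hu)) (W.smul_mem _ hu)
  obtain ⟨hnd, hinj⟩ := nilPart_spec hf (h.sub_smul_self c) hW hTW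
  have hcφ := h.commute_sum (2 * c)
  have hφ₁ := inv_of_commute hcφ.1 hφ
  have hψ₁ := inv_of_commute hcφ.2 hψ
  have hA : ∀ (U : Submodule K V) (d : K), (∀ u ∈ U, φ u ∈ U) →
      ∀ u ∈ U, (φ - d • 1 : Module.End K V) u ∈ U := fun U d hU u hu =>
    U.sub_mem (hU u hu) (U.smul_mem _ hu)
  have hφ₂ : ∀ u ∈ W ⊓ f.orthogonal (nilPart T W), φ u ∈ W ⊓ f.orthogonal (nilPart T W) := by
    rintro u ⟨hu, hu'⟩
    refine ⟨hφ u hu, fun n hn => ?_⟩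
    change f n (φ u) = 0
    rw [h.adj]
    exact hu' _ (hψ₁ n hn)
  have h1 : jordanCount (φ - c • 1) W j = jordanCount (φ - c • 1) (nilPart T W) j := by
    have := jordanCount_sup (hnd.disjoint_compl hf W) (hA _ c hφ₁) (hA _ c hφ₂) j
    rw [hnd.sup_compl hf (nilPart_le T W), jordanCount_eq_zero_of_injOn (hA _ c hφ₂) fun u hu h0 =>
      hinj u hu (h.apply_eq_zero_of_sub hc h0), add_zero] at this
    exact this
  have h2 : φ - ψ = (ψ * (φ - (-c) • 1)) * (φ - c • 1) := by
    refine LinearMap.ext fun x => ?_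
    have hx : ψ x = (c * c) • ψ x := by rw [hc, one_smul]
    simp only [Module.End.mul_apply, LinearMap.sub_apply, LinearMap.smul_apply,
      Module.End.one_apply, map_sub, map_smul, h.apply_apply']
    nth_rewrite 1 [hx]
    module
  rw [h1, h2]
  refine jordanCount_mul_of_injOn ?_ (fun u hu => ?_) (hA _ c hφ₁) (fun u hu h0 => ?_) j
  · have h3 : Commute φ ψ := by rw [commute_iff_eq, h.mul_eq_one, h.mul_eq_one']
    have h4 : Commute φ (φ - c • 1) :=
      (Commute.refl _).sub_right ((Commute.one_right _).smul_right _)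
    exact (h3.symm.sub_right ((Commute.one_right _).smul_right _)).mul_left
      (h4.sub_left ((Commute.one_left _).smul_left _))
  · exact hψ₁ _ (hA _ (-c) hφ₁ u hu)
  · refine h.injOn_add hc hu ?_
    rw [← h.apply_apply ((φ - (-c) • 1 : Module.End K V) u), ← Module.End.mul_apply ψ, h0, map_zero]

/-- The twist on the generalised eigenspace for `c = ±1`. -/
theorem exists_isTwist_nilPart [Finite K] (h2 : ringChar K ≠ 2) [NeZero (2 : K)] (hf : f.IsAlt)
    (h : IsIsometryPair f φ ψ) {c : K} (hc : c * c = 1) {W : Submodule K V} (hW : IsNondegOn f W)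
    (hφ : ∀ u ∈ W, φ u ∈ W) (hψ : ∀ u ∈ W, ψ u ∈ W)
    (hcond : IsSquare (-1 : K) ∨ ∀ j, Odd j → Even (jordanCount (φ - c • 1) W j)) :
    ∃ s, IsTwist f 1 (-1) {(φ - ψ, -1), (φ + ψ, 1)} (nilPart (φ + ψ - (2 * c) • 1) W) s := by
  set T : Module.End K V := φ + ψ - (2 * c) • 1 with hT
  have hTW : ∀ u ∈ W, T u ∈ W := fun u hu =>
    W.sub_mem (W.add_mem (hφ u hu) (hψ u hu)) (W.smul_mem _ hu)
  obtain ⟨hnd, hinj⟩ := nilPart_spec hf.isRefl (h.sub_smul_self c) hW hTW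
  have hcφ := h.commute_sum (2 * c)
  have hφ₁ := inv_of_commute hcφ.1 hφ
  have hψ₁ := inv_of_commute hcφ.2 hψ
  have hD₁ : ∀ u ∈ nilPart T W, (φ - ψ) u ∈ nilPart T W := fun u hu =>
    Submodule.sub_mem _ (hφ₁ u hu) (hψ₁ u hu)
  have hS₁ : ∀ u ∈ nilPart T W, (φ + ψ) u ∈ nilPart T W := fun u hu =>
    Submodule.add_mem _ (hφ₁ u hu) (hψ₁ u hu)
  have hnil : ∃ n : ℕ, ∀ x ∈ nilPart T W, ((φ - ψ) ^ n) x = 0 := by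
    refine ⟨2 * Module.finrank K V, fun x hx => ?_⟩
    have h3 : (φ - ψ) ^ 2 = (T + (2 * 2 * c) • 1) * T := by
      have h4 : (4 : Module.End K V) = ((2 * c) * (2 * c)) • 1 := by
        rw [show (2 * c) * (2 * c) = 4 * (c * c) by ring, hc, mul_one, ofNat_smul_eq_nsmul]
        simp
      have hS : T = φ + ψ - (2 * c) • 1 := hT
      rw [sq, h.isSumDiff.sq, h4, hS]
      simp only [mul_sub, sub_mul, add_mul, mul_add, mul_smul_comm, smul_mul_assoc, mul_one,
        one_mul, smul_smul, smul_sub, smul_add]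
      module
    have h5 : Commute (T + (2 * 2 * c) • 1) T :=
      (Commute.refl _).add_left ((Commute.one_left _).smul_left _)
    rw [pow_mul, h3, h5.mul_pow, Module.End.mul_apply, show (T ^ _) x = 0 from hx.2, map_zero]
  obtain ⟨s, hs⟩ := exists_isTwist_of_nilpotent
    (fun a ha => exists_sq_add_mul_sq h2 ha (-1)) hf h.isSumDiff.skew hnd hD₁ hnil
    (hcond.imp_right fun hc' j hj => by
      rw [h.jordanCount_nilPart hf.isRefl hc hW hφ hψ]; exact hc' j hj)
  refine ⟨s, hs.mapsTo, hs.form, hs.sq, ?_⟩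
  have hDs : ∀ x ∈ nilPart T W, s ((φ - ψ) x) = (-1 : K) • (φ - ψ) (s x) := hs.comm _ rfl
  rintro p (rfl | rfl) u hu
  · exact hDs u hu
  obtain ⟨κ, M, hM⟩ := exists_sum_eq_pow (S := φ + ψ) h2 (c := 2 * c)
    (mul_ne_zero (NeZero.ne _) (by rintro rfl; simp at hc)) W
  -- `s` commutes with `S ^ 2 = D ^ 2 + 4`, hence with `S`
  have hS2 : ∀ x, ((φ + ψ) ^ 2 : Module.End K V) x = (φ - ψ) ((φ - ψ) x) + (4 : K) • x := by
    intro x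
    have := LinearMap.congr_fun h.isSumDiff.sq x
    rw [Module.End.mul_apply] at this
    rw [this, sq, LinearMap.sub_apply]
    have h4 : (4 : Module.End K V) x = (4 : K) • x := by
      rw [ofNat_smul_eq_nsmul]; exact Module.End.ofNat_apply 4 x
    rw [h4]
    abel
  have hcS2 : ∀ x ∈ nilPart T W, s (((φ + ψ) ^ 2 : Module.End K V) x) =
      ((φ + ψ) ^ 2 : Module.End K V) (s x) := by
    intro x hx
    rw [hS2, hS2, map_add, map_smul, hDs _ (hD₁ x hx), hDs x hx, map_smul, smul_smul]
    simp
  have hcM : ∀ k : ℕ, ∀ x ∈ nilPart T W, s ((((φ + ψ) ^ 2) ^ k : Module.End K V) x) =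
      (((φ + ψ) ^ 2) ^ k : Module.End K V) (s x) := by
    intro k
    induction k with
    | zero => simp
    | succ k ih =>
      intro x hx
      rw [pow_succ, Module.End.mul_apply, Module.End.mul_apply, ih _ (pow_apply_mem hS₁ 2 x hx),
        hcS2 x hx]
  rw [one_smul, hM u hu, map_smul, hcM M u hu, ← hM _ (hs.mapsTo u hu)]

/-- An isometry `φ` of an alternating space over a finite field of odd order is inverted by an
isometry of square `-1`, provided that `-1` is a square or that the Jordan blocks of each even size
for the eigenvalues `±1` occur an even number of times. -/
theorem exists_isTwist_inverting [Finite K] (h2 : ringChar K ≠ 2) [NeZero (2 : K)] (hf : f.IsAlt)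
    (hf' : f.Nondegenerate) (h : IsIsometryPair f φ ψ)
    (hcond : IsSquare (-1 : K) ∨ ∀ j, Odd j →
      Even (jordanCount (φ - (1 : K) • 1) ⊤ j) ∧ Even (jordanCount (φ - (-1 : K) • 1) ⊤ j)) :
    ∃ s, IsTwist f 1 (-1) {(φ - ψ, -1), (φ + ψ, 1)} ⊤ s := by
  have hr := hf.isRefl
  have h𝒜 := h.isSumDiff.hasScalarAdjoints (-1) 1
  have htop : IsNondegOn f (⊤ : Submodule K V) := isNondegOn_top hf'
  -- invariance under `D, S` is invariance under `φ, ψ`, as the characteristic is odd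
  have hback : ∀ W : Submodule K V, IsAdapted f {(φ - ψ, (-1 : K)), (φ + ψ, 1)} W →
      (∀ u ∈ W, φ u ∈ W) ∧ ∀ u ∈ W, ψ u ∈ W := by
    intro W hW
    have hD : ∀ u ∈ W, (φ - ψ) u ∈ W := hW.inv _ (Or.inl rfl)
    have hS : ∀ u ∈ W, (φ + ψ) u ∈ W := hW.inv _ (Or.inr rfl)
    have h2' : (2 : K) ≠ 0 := NeZero.ne _
    constructor
    · intro u hu
      have : φ u = (2 : K)⁻¹ • ((φ + ψ) u + (φ - ψ) u) := by
        rw [eq_inv_smul_iff₀ h2', LinearMap.add_apply, LinearMap.sub_apply]; module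
      rw [this]
      exact W.smul_mem _ (W.add_mem (hS u hu) (hD u hu))
    · intro u hu
      have : ψ u = (2 : K)⁻¹ • ((φ + ψ) u - (φ - ψ) u) := by
        rw [eq_inv_smul_iff₀ h2', LinearMap.add_apply, LinearMap.sub_apply]; module
      rw [this]
      exact W.smul_mem _ (W.sub_mem (hS u hu) (hD u hu))
  -- the generalised eigenspace for `c` splits off
  have hsplit : ∀ (W : Submodule K V) (c : K), c * c = 1 →
      IsAdapted f {(φ - ψ, (-1 : K)), (φ + ψ, 1)} W →
      IsAdapted f {(φ - ψ, (-1 : K)), (φ + ψ, 1)} (nilPart (φ + ψ - (2 * c) • 1) W) ∧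
      ∀ x ∈ W ⊓ f.orthogonal (nilPart (φ + ψ - (2 * c) • 1) W),
        (φ - c • 1 : Module.End K V) x = 0 → x = 0 := by
    intro W c hc hW
    obtain ⟨hφ, hψ⟩ := hback W hW
    obtain ⟨hnd, hinj⟩ := nilPart_spec hr (h.sub_smul_self c) hW.nondeg fun u hu =>
      W.sub_mem (W.add_mem (hφ u hu) (hψ u hu)) (W.smul_mem _ hu)
    have hcφ := h.commute_sum (2 * c)
    refine ⟨isAdapted_pair hnd ?_ ?_, fun x hx h0 => hinj x hx (h.apply_eq_zero_of_sub hc h0)⟩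
    · exact fun u hu => Submodule.sub_mem _ (inv_of_commute hcφ.1 hφ u hu)
        (inv_of_commute hcφ.2 hψ u hu)
    · exact fun u hu => Submodule.add_mem _ (inv_of_commute hcφ.1 hφ u hu)
        (inv_of_commute hcφ.2 hψ u hu)
  have had : IsAdapted f {(φ - ψ, (-1 : K)), (φ + ψ, 1)} (⊤ : Submodule K V) :=
    isAdapted_pair htop (fun _ _ => trivial) fun _ _ => trivial
  obtain ⟨had₁, hinj₁⟩ := hsplit ⊤ 1 (one_mul 1) had
  set W₁ := nilPart (φ + ψ - (2 * (1 : K)) • 1) (⊤ : Submodule K V)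
  have hV₁ := had₁.compl hr h𝒜 had le_top
  set V₁ := ⊤ ⊓ f.orthogonal W₁
  obtain ⟨had₂, hinj₂⟩ := hsplit V₁ (-1) (by ring) hV₁
  set W₂ := nilPart (φ + ψ - (2 * (-1 : K)) • 1) V₁
  have hV₂ := had₂.compl hr h𝒜 hV₁ (nilPart_le _ _)
  set V₂ := V₁ ⊓ f.orthogonal W₂
  obtain ⟨s₁, hs₁⟩ := h.exists_isTwist_nilPart h2 hf (one_mul 1) htop (fun _ _ => trivial)
    (fun _ _ => trivial) (hcond.imp_right fun hj j hj' => (hj j hj').1)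
  have hφV₁ := hback V₁ hV₁
  obtain ⟨s₂, hs₂⟩ := h.exists_isTwist_nilPart h2 hf (c := -1) (by ring) hV₁.nondeg hφV₁.1 hφV₁.2
    (hcond.imp_right fun hj j hj' => by
      have hA : ∀ U : Submodule K V, (∀ u ∈ U, φ u ∈ U) →
          ∀ u ∈ U, (φ - (-1 : K) • 1 : Module.End K V) u ∈ U := fun U hU u hu =>
        U.sub_mem (hU u hu) (U.smul_mem _ hu)
      have := jordanCount_sup (had₁.nondeg.disjoint_compl hr ⊤) (hA _ (hback W₁ had₁).1)
        (hA _ hφV₁.1) j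
      rw [had₁.nondeg.sup_compl hr le_top,
        jordanCount_eq_zero_of_injOn (hA _ (hback W₁ had₁).1) fun u hu h0 =>
          h.injOn_add (one_mul 1) hu h0, zero_add] at this
      rw [← this]
      exact (hj j hj').2)
  have hinjD : ∀ u ∈ V₂, (φ - ψ) u = 0 → u = 0 := by
    intro u hu h0
    have h3 : φ (φ u) = u := by
      rw [LinearMap.sub_apply, sub_eq_zero] at h0
      rw [h0, h.apply_apply]
    have h4 : (φ - (-1 : K) • 1 : Module.End K V) u = 0 := by
      refine hinj₁ _ ?_ ?_
      · exact V₁.sub_mem (hφV₁.1 u hu.1) (V₁.smul_mem _ hu.1)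
      · simp only [LinearMap.sub_apply, LinearMap.smul_apply, Module.End.one_apply, map_sub,
          map_smul, h3]
        module
    exact hinj₂ u hu h4
  obtain ⟨s₃, hs₃⟩ := exists_isTwist_of_injective h2 hf h.isSumDiff hV₂.nondeg
    (hV₂.inv _ (Or.inl rfl)) (hV₂.inv _ (Or.inr rfl)) hinjD
  obtain ⟨s₄, hs₄⟩ := hs₂.glue hr h𝒜 had₂ hV₁ (nilPart_le _ _) hs₃
  exact hs₁.glue hr h𝒜 had₁ had le_top hs₄

end IsIsometryPair

end Inverting

section NegInverting

variable {K V : Type*} [Field K] [AddCommGroup V] [Module K V]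

/-! ### Involutions conjugating `φ` to `-φ⁻¹`: the part where `φ + φ⁻¹` is nilpotent -/

/-- A family `u a` whose `S`-chains, together with those of the vectors `D (u a)`, form a block, and
an involution of the index set compatible with the Gram matrix, determine an involution commuting
with `D` and anticommuting with `S`. -/
theorem IsSumDiff.exists_isTwist_chainSpan {κ : Type*} [Fintype κ] [DecidableEq κ]
    {f : LinearMap.BilinForm K V} {D S : Module.End K V} (h : IsSumDiff f D S) {j : ℕ}
    (u : κ → V) (τ : κ → κ)
    (hτ : Function.Involutive τ) (α : κ → K) (hα : ∀ a, α a ≠ 0)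
    (hz : ∀ a, (S ^ (j + 1)) (u a) = 0)
    (hG : ∀ a b i, f ((S ^ i) (D (u a))) (u b) = if b = a ∧ i = j then α a else 0)
    (hG0 : ∀ a b i, f ((S ^ i) (u a)) (u b) = 0) :
    let w : κ × Bool → V := fun x => bif x.2 then D (u x.1) else u x.1
    IsBlock f S (j + 1) w (fun x => (x.1, !x.2)) ∧ (∀ x ∈ chainSpan S w, D x ∈ chainSpan S w) ∧
      ((∀ a, (-1) ^ j * α (τ a) = α a) →
        ∃ s, IsTwist f 1 1 {(D, 1), (S, -1)} (chainSpan S w) s) := by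
  intro w
  have hDS : ∀ i x, D ((S ^ i) x) = (S ^ i) (D x) := fun i x =>
    LinearMap.congr_fun (h.comm.pow_right i).eq x
  have hSS : ∀ u v, f u (S v) = 1 * f (S u) v := fun u v => by rw [one_mul, h.self]
  have hadj : ∀ i u v, f ((S ^ i) u) (D v) = - f ((S ^ i) (D u)) v := fun i u v => by
    rw [h.skew, hDS]; ring
  have hDD : ∀ i x, (S ^ i) (D (D x)) = (S ^ (i + 2)) x - (4 : K) • (S ^ i) x := fun i x => by
    have h4 : aeval S (4 : K[X]) x = (4 : K) • x := by
      have : (4 : K[X]) = C 4 := (map_ofNat C 4).symm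
      rw [this, aeval_C, Module.algebraMap_end_apply]
    rw [h.sq_apply, map_sub, LinearMap.sub_apply, h4, map_sub, map_smul, map_pow, aeval_X,
      ← Module.End.mul_apply, ← pow_add]
  have hG00 : ∀ a b i, f ((S ^ i) (D (u a))) (D (u b)) = 0 := fun a b i => by
    rw [hadj, hDD, map_sub, map_smul, LinearMap.sub_apply, LinearMap.smul_apply, hG0, hG0]
    simp
  have hb : IsBlock f S (j + 1) w (fun x => (x.1, !x.2)) := by
    refine isBlock_of_chain one_ne_zero hSS ?_ ?_ ?_ ?_
    · rintro ⟨a, x⟩ ⟨b, y⟩ hxy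
      simp_all
    · rintro ⟨a, _ | _⟩
      · exact hz a
      · change (S ^ (j + 1)) (D (u a)) = 0
        rw [← hDS, hz, map_zero]
    · rintro ⟨a, _ | _⟩
      · change f ((S ^ j) (u a)) (D (u a)) ≠ 0
        rw [hadj, hG, if_pos ⟨rfl, rfl⟩]
        exact neg_ne_zero.2 (hα a)
      · change f ((S ^ j) (D (u a))) (u a) ≠ 0
        rw [hG, if_pos ⟨rfl, rfl⟩]
        exact hα a
    · rintro ⟨a, _ | _⟩ ⟨b, _ | _⟩ i hi
      · exact hG0 a b i
      · change f ((S ^ i) (u a)) (D (u b)) = 0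
        rw [hadj, hG, if_neg, neg_zero]
        rintro ⟨rfl, rfl⟩
        simp at hi
      · change f ((S ^ i) (D (u a))) (u b) = 0
        rw [hG, if_neg]
        rintro ⟨rfl, rfl⟩
        simp at hi
      · exact hG00 a b i
  -- the effect of `D` on the generators of the block
  have hDw : ∀ (x : κ × Bool) i, D ((S ^ i) (w x)) = bif x.2 then
      (S ^ (i + 2)) (w (x.1, false)) - (4 : K) • (S ^ i) (w (x.1, false))
      else (S ^ i) (w (x.1, true)) := by
    rintro ⟨a, _ | _⟩ i
    · exact hDS i (u a)
    · change D ((S ^ i) (D (u a))) = _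
      rw [hDS, hDD]
      rfl
  refine ⟨hb, ?_, ?_⟩
  · have : chainSpan S w ≤ (chainSpan S w).comap D := by
      conv_lhs => rw [chainSpan]
      rw [Submodule.span_le]
      rintro _ ⟨⟨x, i⟩, rfl⟩
      change D ((S ^ i) (w x)) ∈ chainSpan S w
      rw [hDw]
      rcases x with ⟨a, _ | _⟩
      · exact mem_chainSpan S w _ _
      · exact Submodule.sub_mem _ (mem_chainSpan S w _ _)
          (Submodule.smul_mem _ _ (mem_chainSpan S w _ _))
    exact this
  · intro hsign
    obtain ⟨s, -, hs⟩ := hb.exists_isTwist (κ := 1) (ε := 1) hSS one_ne_zero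
      (fun x => w (τ x.1, x.2)) (fun x y => if y = (τ x.1, x.2) then 1 else 0)
      (fun x => by simp) (fun x => by simp [hτ x.1]) (by
        have hsw : ∀ a b i, (-1) ^ i * (if τ b = τ a ∧ i = j then α (τ a) else 0) =
            if b = a ∧ i = j then α a else 0 := by
          intro a b i
          by_cases hc : b = a ∧ i = j
          · obtain ⟨rfl, rfl⟩ := hc
            rw [if_pos ⟨rfl, rfl⟩, if_pos ⟨rfl, rfl⟩, hsign]
          · rw [if_neg hc, if_neg fun h' => hc ⟨hτ.injective h'.1, h'.2⟩, mul_zero]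
        rintro ⟨a, _ | _⟩ ⟨b, _ | _⟩ i
        · change (-1) ^ i * f ((S ^ i) (u (τ a))) (u (τ b)) = f ((S ^ i) (u a)) (u b)
          rw [hG0, hG0, mul_zero]
        · change (-1) ^ i * f ((S ^ i) (u (τ a))) (D (u (τ b))) = f ((S ^ i) (u a)) (D (u b))
          rw [hadj, hadj, hG, hG, ← hsw a b i]
          ring
        · change (-1) ^ i * f ((S ^ i) (D (u (τ a)))) (u (τ b)) = f ((S ^ i) (D (u a))) (u b)
          rw [hG, hG, hsw]
        · change (-1) ^ i * f ((S ^ i) (D (u (τ a)))) (D (u (τ b))) =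
            f ((S ^ i) (D (u a))) (D (u b))
          rw [hG00, hG00, mul_zero])
      {(D, (1 : K)), (S, -1)} (by
        rintro s hs p (rfl | rfl) x i
        · simp only
          rw [hDw, map_smul, hDw]
          rcases x with ⟨a, _ | _⟩
          · simp only [cond_false]
            rw [hs, one_smul]
          · simp only [cond_true]
            rw [map_sub, map_smul, hs, hs, pow_add (-1 : K)]
            simp only [one_smul, smul_sub]
            rw [smul_comm (4 : K)]
            simp
        · exact comm_self_of_chain hs x i)
    exact ⟨s, hs⟩

/-- Every nonzero scalar is the top value `f (S ^ j (D u)) u` of a normalised generator `u`. -/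
theorem IsSumDiff.exists_generator [Finite K] (h2 : ringChar K ≠ 2) [NeZero (2 : K)]
    {f : LinearMap.BilinForm K V}
    (hf : f.IsAlt) {D S : Module.End K V} (h : IsSumDiff f D S) {W : Submodule K V}
    (hW : IsNondegOn f W) (hDW : ∀ u ∈ W, D u ∈ W) (hSW : ∀ u ∈ W, S u ∈ W) {j : ℕ}
    (hz : ∀ x ∈ W, (S ^ (j + 1)) x = 0) (hne : ∃ x ∈ W, (S ^ j) x ≠ 0) {β : K} (hβ : β ≠ 0) :
    ∃ u ∈ W, (∀ i, f ((S ^ i) (D u)) u = if i = j then β else 0) ∧ ∀ i, f ((S ^ i) u) u = 0 := by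
  have h20 : (2 : K) ≠ 0 := NeZero.ne _
  have h40 : (4 : K) ≠ 0 := by
    rw [show (4 : K) = 2 * 2 by norm_num]; exact mul_ne_zero h20 h20
  have hDS : ∀ i x, D ((S ^ i) x) = (S ^ i) (D x) := fun i x =>
    LinearMap.congr_fun (h.comm.pow_right i).eq x
  have hSi : ∀ i u v, f u ((S ^ i) v) = f ((S ^ i) u) v := fun i u v => by
    simpa using form_pow_adjoint (f := f) (c := (1 : K)) (by simpa using h.self) i u v
  have hself : ∀ i u, f ((S ^ i) u) u = 0 := fun i u => by
    have h1 : (2 : K) * f ((S ^ i) u) u = 0 := by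
      have h1 := hf.neg_eq ((S ^ i) u) u
      have h2 := hSi i u u
      linear_combination -h1 - h2
    exact (mul_eq_zero.1 h1).resolve_left h20
  have hDD : ∀ x, D (D x) = (S ^ 2) x - (4 : K) • x := fun x => by
    have h4 : aeval S (4 : K[X]) x = (4 : K) • x := by
      have : (4 : K[X]) = C 4 := (map_ofNat C 4).symm
      rw [this, aeval_C, Module.algebraMap_end_apply]
    rw [h.sq_apply, map_sub, LinearMap.sub_apply, h4, map_pow, aeval_X]
  have hsymm : ∀ i u v, f ((S ^ i) (D u)) v = f ((S ^ i) (D v)) u := fun i u v => by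
    rw [← hf.neg_eq, ← hDS i u, h.skew, hSi i (D v)]
    ring
  have htop : ∀ x ∈ W, (S ^ j) (D (D x)) = -(4 : K) • (S ^ j) x := fun x hx => by
    rw [hDD, map_sub, map_smul, ← Module.End.mul_apply, ← pow_add, show j + 2 = 1 + (j + 1) by ring,
      pow_add, Module.End.mul_apply, hz x hx, map_zero, zero_sub, neg_smul]
  obtain ⟨x, hx, hx0⟩ := hne
  have hDx : (S ^ j) (D x) ≠ 0 := fun h0 => hx0 <| by
    have h1 := htop x hx
    rw [← hDS, h0, map_zero] at h1
    exact (smul_eq_zero.1 h1.symm).resolve_left (neg_ne_zero.2 h40)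
  obtain ⟨y, hy, hxy⟩ : ∃ y ∈ W, f ((S ^ j) (D x)) y ≠ 0 := by
    by_contra! hc
    exact hDx (hW _ (pow_apply_mem hSW j _ (hDW x hx)) hc)
  obtain ⟨u, hu, hu0⟩ := exists_diag_ne_zero (F := f ∘ₗ (S ^ j) ∘ₗ D)
    (fun u v => hsymm j u v) hx hy hxy
  have hu0 : f ((S ^ j) (D u)) u ≠ 0 := hu0
  set α := f ((S ^ j) (D u)) u with hα
  obtain ⟨a, b, hab⟩ := exists_sq_add_mul_sq h2 h40 (β / α)
  -- the value at `a u + b D u` is `(a ^ 2 + 4 b ^ 2) α`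
  have hval : f ((S ^ j) (D (a • u + b • D u))) (a • u + b • D u) = β := by
    have h1 : f ((S ^ j) (D u)) (D u) = 0 := hself j (D u)
    simp only [map_add, map_smul, htop u hu, LinearMap.add_apply, LinearMap.smul_apply, h1,
      smul_eq_mul, hself j u, ← hα]
    have h3 : f ((S ^ j) u) (D u) = -α := by
      rw [h.skew, hDS, hα]; ring
    rw [h3]
    field_simp at hab
    linear_combination hab
  obtain ⟨u', hu', h1, h3⟩ := exists_normalized (F := f ∘ₗ D) (P := S) (W := W) (m := j)
    (u := a • u + b • D u)
    (fun u v => by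
      change f (D u) (S v) = f (D (S u)) v
      rw [h.self]
      congr 2
      exact (hDS 1 u).symm)
    hSW hz (W.add_mem (W.smul_mem _ hu) (W.smul_mem _ (hDW u hu))) (by
      change f (D ((S ^ j) _)) _ ≠ 0
      rw [hDS, hval]; exact hβ)
  have h1 : f (D ((S ^ j) u')) u' = f (D ((S ^ j) (a • u + b • D u))) (a • u + b • D u) := h1
  have h3 : ∀ i, i ≠ j → f (D ((S ^ i) u')) u' = 0 := h3
  refine ⟨u', hu', fun i => ?_, fun i => hself i u'⟩
  rw [← hDS]
  split_ifs with hi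
  · rw [hi, h1, hDS, hval]
  · exact h3 i hi

/-- Where `S` is nilpotent, an involution commuting with `D` and anticommuting with `S` exists if
the Jordan blocks of `S` of each even size occur with multiplicity divisible by `4`. A block of `S`
of odd size and its image under `D` admit such an involution; for even size two such pairs with
opposite scalars have to be interchanged. -/
theorem IsSumDiff.exists_isTwist_of_nilpotent [FiniteDimensional K V] [Finite K]
    (h2 : ringChar K ≠ 2) [NeZero (2 : K)] {f : LinearMap.BilinForm K V}
    (hf : f.IsAlt) {D S : Module.End K V} (h : IsSumDiff f D S) {W : Submodule K V}
    (hW : IsAdapted f {(D, (1 : K)), (S, -1)} W) (hnil : ∃ n : ℕ, ∀ x ∈ W, (S ^ n) x = 0)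
    (hcond : ∀ j, Odd j → (4 : ℤ) ∣ jordanCount S W j) :
    ∃ s, IsTwist f 1 1 {(D, 1), (S, -1)} W s := by
  have h𝒜 := h.hasScalarAdjoints 1 (-1)
  have hmemS : (S, (-1 : K)) ∈ ({(D, (1 : K)), (S, -1)} : Set (Module.End K V × K)) := Or.inr rfl
  refine exists_isTwist_of_strip hf.isRefl h𝒜
    (fun W => (∃ n : ℕ, ∀ x ∈ W, (S ^ n) x = 0) ∧
      ∀ j, Odd j → (4 : ℤ) ∣ jordanCount S W j) ?_ W ⟨hnil, hcond⟩ hW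
  rintro W ⟨⟨n, hn⟩, hcond⟩ hW hbot
  have hDW : ∀ u ∈ W, D u ∈ W := hW.inv _ (Or.inl rfl)
  have hSW : ∀ u ∈ W, S u ∈ W := hW.inv _ hmemS
  obtain ⟨j, hz, hne⟩ := exists_nilpotency_index hbot ⟨n, hn⟩
  have hDS : ∀ i x, D ((S ^ i) x) = (S ^ i) (D x) := fun i x =>
    LinearMap.congr_fun (h.comm.pow_right i).eq x
  have finish : ∀ {κ : Type} [Fintype κ] [DecidableEq κ] [Nonempty κ] (u : κ → V) (τ : κ → κ)
      (_ : Function.Involutive τ) (α : κ → K) (_ : ∀ a, α a ≠ 0) (_ : ∀ a, u a ∈ W)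
      (_ : ∀ a b i, f ((S ^ i) (D (u a))) (u b) = if b = a ∧ i = j then α a else 0)
      (_ : ∀ a b i, f ((S ^ i) (u a)) (u b) = 0) (_ : ∀ a, (-1) ^ j * α (τ a) = α a)
      (_ : Odd j → 4 ∣ Fintype.card κ * 2),
      ∃ W₁ ≤ W, W₁ ≠ ⊥ ∧ IsAdapted f {(D, (1 : K)), (S, -1)} W₁ ∧
      (∃ s, IsTwist f 1 1 {(D, (1 : K)), (S, -1)} W₁ s) ∧
        ((∃ n : ℕ, ∀ x ∈ W ⊓ f.orthogonal W₁, (S ^ n) x = 0) ∧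
        ∀ j, Odd j → (4 : ℤ) ∣ jordanCount S (W ⊓ f.orthogonal W₁) j) := by
    intro κ _ _ _ u τ hτ α hα huW hG hG0 hsign hcard
    obtain ⟨hb, hDc, hs⟩ := h.exists_isTwist_chainSpan u τ hτ α hα (fun a => hz _ (huW a)) hG hG0
    set w : κ × Bool → V := fun x => bif x.2 then D (u x.1) else u x.1
    have hle : chainSpan S w ≤ W := chainSpan_le hSW (by
      rintro ⟨a, _ | _⟩
      exacts [huW a, hDW _ (huW a)])
    have had : IsAdapted f {(D, (1 : K)), (S, -1)} (chainSpan S w) :=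
      isAdapted_pair hb.nondeg hDc chainSpan_inv
    refine ⟨chainSpan S w, hle, hb.ne_bot (Classical.arbitrary κ, true), had, hs hsign,
      ⟨n, fun x hx => hn x hx.1⟩, fun k hk => ?_⟩
    have := had.jordanCount_compl hf.isRefl h𝒜 hW hle hmemS k
    simp only at this
    rw [this, hb.jordanCount]
    refine (hcond k hk).sub ?_
    split_ifs with hkj
    · obtain rfl : k = j := by omega
      have := hcard hk
      rw [Fintype.card_prod, Fintype.card_bool]
      exact_mod_cast this
    · exact dvd_zero _
  obtain ⟨u, hu, hα, huu⟩ := h.exists_generator h2 hf hW.nondeg hDW hSW hz hne one_ne_zero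
  rcases Nat.even_or_odd j with hj | hj
  · exact finish (fun _ : Unit => u) id (fun _ => rfl) (fun _ => 1) (fun _ => one_ne_zero)
      (fun _ => hu) (by intro _ _ i; simpa using hα i) (fun _ _ i => huu i)
      (by simp [hj.neg_one_pow]) (fun ho => absurd hj (Nat.not_even_iff_odd.2 ho))
  -- for even block size a second generator with the opposite scalar is needed
  obtain ⟨hb, hDc, -⟩ := h.exists_isTwist_chainSpan (fun _ : Unit => u) id (fun _ => rfl)
    (fun _ => 1) (fun _ => one_ne_zero) (fun _ => hz _ hu) (by intro _ _ i; simpa using hα i)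
    (fun _ _ i => huu i)
  set w : Unit × Bool → V := fun x => bif x.2 then D u else u
  have hle : chainSpan S w ≤ W := chainSpan_le hSW (by
    rintro ⟨a, _ | _⟩
    exacts [hu, hDW _ hu])
  have had : IsAdapted f {(D, (1 : K)), (S, -1)} (chainSpan S w) :=
    isAdapted_pair hb.nondeg hDc chainSpan_inv
  have hcompl := had.compl hf.isRefl h𝒜 hW hle
  have hcount := had.jordanCount_compl hf.isRefl h𝒜 hW hle hmemS j
  simp only [hb.jordanCount, if_true, Fintype.card_prod, Fintype.card_unit,
    Fintype.card_bool] at hcount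
  have hcj := hcond j hj
  set W₂ := W ⊓ f.orthogonal (chainSpan S w)
  have hne₂ : ∃ x ∈ W₂, (S ^ j) x ≠ 0 := by
    by_contra! hc
    have h0 : W₂.map (S ^ j) = ⊥ := by
      rw [Submodule.eq_bot_iff]; rintro _ ⟨x, hx, rfl⟩; exact hc x hx
    rw [jordanCount_of_pow_eq_zero fun x (hx : x ∈ W₂) => hz x hx.1, h0, finrank_bot] at hcount
    push_cast at hcount
    omega
  obtain ⟨v, hv, hβ, hvv⟩ := h.exists_generator h2 hf hcompl.nondeg (hcompl.inv _ (Or.inl rfl))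
    (hcompl.inv _ hmemS) (fun x (hx : x ∈ W₂) => hz x hx.1) hne₂ (neg_ne_zero.2 one_ne_zero)
  have huv : ∀ i, f ((S ^ i) u) v = 0 := fun i => hv.2 _ (mem_chainSpan S w ((), false) i)
  have huv' : ∀ i, f ((S ^ i) (D u)) v = 0 := fun i => hv.2 _ (mem_chainSpan S w ((), true) i)
  have hSi : ∀ i u v, f u ((S ^ i) v) = f ((S ^ i) u) v := fun i u v => by
    simpa using form_pow_adjoint (f := f) (c := (1 : K)) (by simpa using h.self) i u v
  have hvu : ∀ i, f ((S ^ i) v) u = 0 := fun i => by rw [← hf.neg_eq, hSi, huv, neg_zero]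
  have hvu' : ∀ i, f ((S ^ i) (D v)) u = 0 := fun i => by
    rw [← hf.neg_eq, hSi, h.skew, hDS, huv']; ring
  refine finish (fun b : Bool => bif b then u else v) not Bool.not_not
    (fun b => bif b then 1 else -1) ?_ ?_ ?_ ?_ ?_ (fun _ => by simp)
  · rintro (_ | _) <;> simp
  · rintro (_ | _)
    exacts [hv.1, hu]
  · rintro (_ | _) (_ | _) i
    · simpa using hβ i
    · simpa using hvu' i
    · simpa using huv' i
    · simpa using hα i
  · rintro (_ | _) (_ | _) i
    exacts [hvv i, hvu i, huv i, huu i]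
  · rintro (_ | _) <;> simp [hj.neg_one_pow]

/-! ### Square roots of `x ^ 2 - 4` modulo an even irreducible polynomial -/

/-- If `q` is an even irreducible polynomial over a finite field, then `x ^ 2 - 4` has modulo `q` a
square root that is even or odd: in the field `K[x] / (q)` the subfield fixed by `x ↦ -x` contains
`x ^ 2`, which is not a square there, so an element of the subfield or its product with `x ^ 2` is
a square in the subfield. -/
theorem exists_even_or_odd_sqrt [Finite K] (h2 : ringChar K ≠ 2) [NeZero (2 : K)] {q : K[X]}
    (hq : Irreducible q) (heven : q.comp (-X) = q) (hX : ¬ q ∣ X) {c : K[X]}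
    (hc : c.comp (-X) = c) :
    ∃ (δ : K[X]) (η : K), η * η = 1 ∧ δ.comp (-X) = C η * δ ∧ q ∣ δ ^ 2 - c := by
  have := Fact.mk hq
  have h20 : (2 : K) ≠ 0 := NeZero.ne _
  let L := AdjoinRoot q
  have hfin : Finite L := by
    have : Module.Finite K (AdjoinRoot q) := (AdjoinRoot.powerBasis hq.ne_zero).finite
    exact Module.finite_of_finite K
  let σ : L →ₐ[K] L := AdjoinRoot.liftAlgHom q (Algebra.ofId K L) (-AdjoinRoot.root q) (by
    have h1 : aeval (AdjoinRoot.root q) (q.comp (-X)) = 0 := by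
      rw [heven, AdjoinRoot.aeval_eq, AdjoinRoot.mk_self]
    rw [aeval_comp] at h1
    rw [map_neg, aeval_X, aeval_def] at h1
    exact h1)
  have hσs : σ (AdjoinRoot.root q) = -AdjoinRoot.root q := AdjoinRoot.liftAlgHom_root q _ _ _
  have hσ : ∀ p : K[X], σ (AdjoinRoot.mk q p) = AdjoinRoot.mk q (p.comp (-X)) := by
    intro p
    rw [← AdjoinRoot.aeval_eq, ← AdjoinRoot.aeval_eq, aeval_comp, ← aeval_algHom_apply, hσs,
      map_neg, aeval_X]
  let L₀ : Subfield L := (σ : L →+* L).eqLocusField (RingHom.id L)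
  have hL₀ : ∀ x : L, x ∈ L₀ ↔ σ x = x := fun x => Iff.rfl
  have hint : ∀ x y : L, x ^ 2 = y ^ 2 → x = y ∨ x = -y := fun x y => sq_eq_sq_iff_eq_or_eq_neg.1
  have hL2 : (2 : L) ≠ 0 := by
    have := (map_ne_zero (algebraMap K L)).2 h20
    rwa [map_ofNat] at this
  -- it is enough to find a square root in `L` which is fixed or negated by `σ`
  have key : ∀ r : L, r ^ 2 = AdjoinRoot.mk q c → ∀ η : K, η * η = 1 →
      σ r = algebraMap K L η * r →
      ∃ (δ : K[X]) (η : K), η * η = 1 ∧ δ.comp (-X) = C η * δ ∧ q ∣ δ ^ 2 - c := by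
    intro r hr η hη hσr
    obtain ⟨p, rfl⟩ := AdjoinRoot.mk_surjective r
    have hηL : algebraMap K L η = AdjoinRoot.mk q (C η) := rfl
    have hinv : AdjoinRoot.mk q (C (2⁻¹ : K)) * 2 = 1 := by
      have h3 : (2 : L) = AdjoinRoot.mk q (C (2 : K)) := by rw [map_ofNat, map_ofNat]
      rw [h3, ← map_mul, ← C_mul, inv_mul_cancel₀ h20, C_1, map_one]
    refine ⟨C 2⁻¹ * (p + C η * p.comp (-X)), η, hη, ?_, ?_⟩
    · have h3 : (p.comp (-X)).comp (-X) = p := by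
        rw [comp_assoc]; simp
      have h4 : (C η * C η : K[X]) = 1 := by rw [← C_mul, hη, C_1]
      simp only [mul_comp, add_comp, C_comp, h3]
      linear_combination (-C 2⁻¹ * p.comp (-X)) * h4
    · rw [← AdjoinRoot.mk_eq_zero, map_sub, sub_eq_zero, ← hr, map_pow]
      congr 1
      rw [map_mul, map_add, map_mul, ← hσ, hσr, hηL, ← mul_assoc (AdjoinRoot.mk q (C η)),
        ← map_mul, ← C_mul, hη, C_1, map_one, one_mul, ← two_mul, ← mul_assoc, hinv, one_mul]
  have hσc : AdjoinRoot.mk q c ∈ L₀ := by rw [hL₀, hσ, hc]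
  have hone : (1 : K) * 1 = 1 := one_mul 1
  by_cases hc0 : AdjoinRoot.mk q c = 0
  · exact key 0 (by rw [hc0]; ring) 1 hone (by simp)
  by_cases hsq : IsSquare (⟨_, hσc⟩ : L₀)
  · obtain ⟨r, hr⟩ := hsq
    refine key r ?_ 1 hone ?_
    · have := congrArg (Subtype.val) hr
      rw [sq]
      exact this.symm
    · rw [map_one, one_mul]
      exact r.2
  set s : L := AdjoinRoot.root q with hs
  have hσs : σ s = -s := hσs
  have hs0 : s ≠ 0 := by
    intro h0
    rw [hs, ← AdjoinRoot.mk_X, AdjoinRoot.mk_eq_zero] at h0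
    exact hX h0
  have hs2 : s ^ 2 ∈ L₀ := by rw [hL₀, map_pow, hσs]; ring
  have hns : ¬ IsSquare (⟨_, hs2⟩ : L₀) := by
    rintro ⟨r, hr⟩
    have h3 : s ^ 2 = (r : L) ^ 2 := by rw [sq (r : L)]; exact congrArg Subtype.val hr
    have h4 : σ (r : L) = r := r.2
    have h5 : σ s = s := by rcases hint _ _ h3 with h | h <;> rw [h] <;> simp [h4]
    rw [hσs] at h5
    have h6 : 2 * s = 0 := by linear_combination -h5
    exact (mul_ne_zero hL2 hs0) h6
  have hfin₀ : Finite L₀ := Subtype.finite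
  have hchar : ringChar L₀ ≠ 2 := by
    rw [Algebra.ringChar_eq L₀ L, ← Algebra.ringChar_eq K L]
    exact h2
  have hprod : IsSquare ((⟨_, hσc⟩ : L₀) * ⟨_, hs2⟩) := by
    cases nonempty_fintype L₀
    have hc0' : (⟨_, hσc⟩ : L₀) ≠ 0 := fun h0 => hc0 (congrArg Subtype.val h0)
    have hs0' : (⟨_, hs2⟩ : L₀) ≠ 0 := fun h0 => pow_ne_zero 2 hs0 (congrArg Subtype.val h0)
    rw [FiniteField.isSquare_iff hchar hc0'] at hsq
    rw [FiniteField.isSquare_iff hchar hs0'] at hns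
    rw [FiniteField.isSquare_iff hchar (mul_ne_zero hc0' hs0'), mul_pow,
      (FiniteField.pow_dichotomy hchar hc0').resolve_left hsq,
      (FiniteField.pow_dichotomy hchar hs0').resolve_left hns]
    ring
  obtain ⟨r, hr⟩ := hprod
  have hr' : AdjoinRoot.mk q c * s ^ 2 = (r : L) * r := congrArg Subtype.val hr
  have h4 : σ (r : L) = r := r.2
  refine key (r / s) ?_ (-1) (by ring) ?_
  · rw [div_pow, div_eq_iff (pow_ne_zero 2 hs0), hr', sq]
  · rw [map_div₀, h4, hσs, map_neg, map_one, div_neg, neg_one_mul]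

/-- The square root lifts to the powers of `q`. -/
theorem exists_even_or_odd_sqrt_pow [Finite K] (h2 : ringChar K ≠ 2) [NeZero (2 : K)] {q : K[X]}
    (hq : Irreducible q) (heven : q.comp (-X) = q) (hX : ¬ q ∣ X) {c : K[X]}
    (hc : c.comp (-X) = c) (hqc : ¬ q ∣ c) (k : ℕ) :
    ∃ (δ : K[X]) (η : K), η * η = 1 ∧ δ.comp (-X) = C η * δ ∧ q ^ k ∣ δ ^ 2 - c := by
  have h20 : (2 : K) ≠ 0 := NeZero.ne _
  obtain ⟨δ, η, hη, hδ, hd⟩ := exists_even_or_odd_sqrt h2 hq heven hX hc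
  obtain ⟨p, hp⟩ := CharP.exists K
  have hpp : p.Prime := CharP.char_is_prime K p
  have := Fact.mk hpp
  have hodd : Odd p := hpp.odd_of_ne_two fun h => h2 (by rw [ringChar.eq K p, h])
  obtain ⟨M, hM⟩ := hodd.pow (n := k)
  -- an even inverse of `c` modulo `q ^ k`
  obtain ⟨y, hy, hyc⟩ : ∃ y : K[X], y.comp (-X) = y ∧ q ^ k ∣ c * y - 1 := by
    obtain ⟨a, b, hab⟩ := ((hq.coprime_iff_not_dvd.2 hqc).pow_left (m := k))
    have hab' : a.comp (-X) * q ^ k + b.comp (-X) * c = 1 := by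
      have := congrArg (fun p : K[X] => p.comp (-X)) hab
      simpa only [add_comp, mul_comp, pow_comp, heven, hc, one_comp] using this
    have h22 : (C (2⁻¹ : K)) * 2 = 1 := by
      have h3 : (2 : K[X]) = C (2 : K) := (map_ofNat C 2).symm
      rw [h3, ← C_mul, inv_mul_cancel₀ h20, C_1]
    refine ⟨C 2⁻¹ * (b + b.comp (-X)), ?_, -(C 2⁻¹ * (a + a.comp (-X))), ?_⟩
    · have h3 : (b.comp (-X)).comp (-X) = b := by
        rw [comp_assoc]; simp
      simp only [mul_comp, add_comp, C_comp, h3]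
      ring
    · linear_combination (C 2⁻¹) * (hab + hab') + h22
  have hηpow : ∀ m, η ^ m * η ^ m = 1 := fun m => by rw [← mul_pow, hη, one_pow]
  refine ⟨δ ^ (p ^ k) * y ^ M, η ^ (p ^ k), hηpow _, ?_, ?_⟩
  · rw [mul_comp, pow_comp, pow_comp, hy, hδ, mul_pow, C_pow]
    ring
  · have h1 : q ^ k ∣ (δ ^ 2) ^ (p ^ k) - c ^ (p ^ k) := by
      rw [← sub_pow_char_pow]
      exact (pow_dvd_pow q (Nat.lt_pow_self hpp.one_lt).le).trans (pow_dvd_pow_of_dvd hd _)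
    have h3 : q ^ k ∣ (c * y) ^ (2 * M) - 1 := by
      simpa using hyc.trans (sub_dvd_pow_sub_pow (c * y) 1 (2 * M))
    have : (δ ^ (p ^ k) * y ^ M) ^ 2 - c = ((δ ^ 2) ^ (p ^ k) - c ^ (p ^ k)) * y ^ (2 * M) +
        c * ((c * y) ^ (2 * M) - 1) := by
      rw [hM]
      ring
    rw [this]
    exact (h1.mul_right _).add (h3.mul_left _)

/-! ### Involutions conjugating `φ` to `-φ⁻¹`: the part where `φ + φ⁻¹` is injective -/

/-- The annihilator of a vector of exact `q`-height `k + 1` is generated by `q ^ (k + 1)`. -/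
theorem pow_dvd_of_aeval_eq_zero {T : Module.End K V} {q : K[X]} (hq : Irreducible q) {k : ℕ}
    {u : V} (hu : aeval T (q ^ (k + 1)) u = 0) (hu0 : aeval T (q ^ k) u ≠ 0) {a : K[X]}
    (ha : aeval T a u = 0) : q ^ (k + 1) ∣ a := by
  by_cases ha0 : a = 0
  · rw [ha0]; exact dvd_zero _
  obtain ⟨j, b, hb, rfl⟩ := WfDvdMonoid.max_power_factor ha0 hq
  rcases lt_or_ge k j with hj | hj
  · exact (pow_dvd_pow q hj).mul_right b
  · exfalso
    refine hu0 ?_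
    obtain ⟨s, t, hst⟩ := ((hq.coprime_iff_not_dvd.2 hb).symm.pow_right (n := k + 1))
    have h1 : q ^ k = s * q ^ (k - j) * (q ^ j * b) + q ^ k * t * q ^ (k + 1) := by
      have h2 : q ^ (k - j) * q ^ j = q ^ k := by rw [← pow_add, Nat.sub_add_cancel hj]
      linear_combination (-s * b) * h2 - q ^ k * hst
    rw [h1, map_add, LinearMap.add_apply, map_mul, Module.End.mul_apply, ha, map_zero, map_mul,
      Module.End.mul_apply, hu, map_zero, add_zero]

/-- Let `q` be even and `D = δ(S)` on the cyclic module of `u`, where `δ` is even or odd. There is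
a dual cyclic module, on which `D = -δ(S)`, and on the sum of the two the substitution `x ↦ -x` is
the required involution if `δ` is even; if `δ` is odd, it has to be composed with the interchange of
the two summands. -/
theorem IsSumDiff.exists_isTwist_of_even [FiniteDimensional K V] [NeZero (2 : K)]
    {f : LinearMap.BilinForm K V} (hf : f.IsAlt) {D S : Module.End K V} (h : IsSumDiff f D S)
    {W : Submodule K V} (hW : IsAdapted f {(D, (1 : K)), (S, -1)} W) {q : K[X]}
    (hq : Irreducible q) (heven : q.comp (-X) = q) (hX : ¬ q ∣ X) (h4 : ¬ q ∣ X ^ 2 - 4) {k : ℕ}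
    (hqk : ∀ x ∈ W, aeval S (q ^ (k + 1)) x = 0) {δ : K[X]} {η : K} (hη : η = 1 ∨ η = -1)
    (hδ : δ.comp (-X) = C η * δ) (hδ2 : q ^ (k + 1) ∣ δ ^ 2 - (X ^ 2 - 4)) {u : V} (huW : u ∈ W)
    (hu0 : aeval S (q ^ k) u ≠ 0) (hDu : D u = aeval S δ u) :
    ∃ W₁ ≤ W, W₁ ≠ ⊥ ∧ IsAdapted f {(D, (1 : K)), (S, -1)} W₁ ∧
      ∃ s, IsTwist f 1 1 {(D, 1), (S, -1)} W₁ s := by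
  have h20 : (2 : K) ≠ 0 := NeZero.ne _
  have hDW : ∀ u ∈ W, D u ∈ W := hW.inv _ (Or.inl rfl)
  have hSW : ∀ u ∈ W, S u ∈ W := hW.inv _ (Or.inr rfl)
  have hself := aeval_selfAdjoint h.self
  have hcomm := h.comm_aeval
  have hmul := aeval_aeval_apply S
  have hdvd : ∀ p : K[X], q ^ (k + 1) ∣ p → ∀ x ∈ W, aeval S p x = 0 := by
    rintro _ ⟨r, rfl⟩ x hx
    rw [mul_comm, ← hmul, hqk x hx, map_zero]
  have hcong : ∀ p r : K[X], q ^ (k + 1) ∣ p - r → ∀ x ∈ W, aeval S p x = aeval S r x :=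
    fun p r hpr x hx => by
      rw [← sub_eq_zero, ← LinearMap.sub_apply, ← map_sub]; exact hdvd _ hpr x hx
  have hneg : ∀ p : K[X], q ^ (k + 1) ∣ p → q ^ (k + 1) ∣ p.comp (-X) := by
    rintro _ ⟨r, rfl⟩
    rw [mul_comp, pow_comp, heven]
    exact dvd_mul_right _ _
  have hann : ∀ a : K[X], aeval S a u = 0 → q ^ (k + 1) ∣ a := fun a =>
    pow_dvd_of_aeval_eq_zero hq (hqk u huW) hu0
  -- the form vanishes on cyclic `K[S]`-modules
  have hiso : ∀ (p : K[X]) (x : V), f (aeval S p x) x = 0 := fun p x => by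
    have h1 : (2 : K) * f (aeval S p x) x = 0 := by
      have h1 := hf.neg_eq (aeval S p x) x
      have h2 := hself p x x
      linear_combination -h1 - h2
    exact (mul_eq_zero.1 h1).resolve_left h20
  -- a functional on the module of `u` with the symmetry of `δ`, nonzero on the socle
  obtain ⟨e, he0, he⟩ : ∃ e : K[X], aeval S (e * q ^ k) u ≠ 0 ∧
      (e * q ^ k).comp (-X) = C η * (e * q ^ k) := by
    rcases hη with rfl | rfl
    · exact ⟨1, by rwa [one_mul], by simp [heven]⟩
    · refine ⟨X, fun h0 => hX ?_, by simp [heven]⟩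
      have := hann _ h0
      rw [pow_succ'] at this
      exact (mul_dvd_mul_iff_right (pow_ne_zero k hq.ne_zero)).1 this
  have hηη : η * η = 1 := by rcases hη with rfl | rfl <;> ring
  obtain ⟨l, hl⟩ : ∃ l : V →ₗ[K] K, l (aeval S (e * q ^ k) u) ≠ 0 := by
    by_contra! hc
    exact he0 ((Module.forall_dual_apply_eq_zero_iff K _).1 hc)
  let Φ : K[X] →ₗ[K] V :=
    (LinearMap.applyₗ u).comp (aeval S : K[X] →ₐ[K] Module.End K V).toLinearMap
  let Λ : K[X] →ₗ[K] K :=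
    l.comp (Φ + η • Φ.comp (aeval (-X : K[X]) : K[X] →ₐ[K] K[X]).toLinearMap)
  have hΛ : ∀ a, Λ a = l (aeval S a u) + η * l (aeval S (a.comp (-X)) u) := fun a => by
    rw [← smul_eq_mul, ← map_smul, ← map_add]
    rfl
  have hΛneg : ∀ a, Λ (a.comp (-X)) = η * Λ a := fun a => by
    rw [hΛ, hΛ, comp_neg_X_comp_neg_X]
    linear_combination (-l (aeval S (a.comp (-X)) u)) * hηη
  have hΛe : Λ (e * q ^ k) ≠ 0 := by
    have : Λ (e * q ^ k) = 2 * l (aeval S (e * q ^ k) u) := by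
      rw [hΛ, he, map_mul (aeval S) (C η), aeval_C, Module.End.mul_apply,
        Module.algebraMap_end_apply, map_smul,
        smul_eq_mul]
      linear_combination (l (aeval S (e * q ^ k) u)) * hηη
    rw [this]
    exact mul_ne_zero h20 hl
  have hΛ0 : ∀ a, q ^ (k + 1) ∣ a → Λ a = 0 := fun a ha => by
    rw [hΛ, hdvd a ha u huW, hdvd _ (hneg a ha) u huW]
    simp
  obtain ⟨T, hT⟩ := exists_linearMap_comp_eq Φ Λ fun a ha => hΛ0 a (hann a ha)
  have hT : ∀ a, T (aeval S a u) = Λ a := hT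
  obtain ⟨y, hy⟩ : ∃ y : K[X], q ^ (k + 1) ∣ y * δ - 1 := by
    have hqδ : ¬ q ∣ δ := fun hd => h4 <| by
      have h1 := (dvd_pow_self q k.succ_ne_zero).trans hδ2
      exact (dvd_sub_right (dvd_pow hd two_ne_zero)).1 h1
    obtain ⟨a, b, hab⟩ := ((hq.coprime_iff_not_dvd.2 hqδ).pow_left (m := k + 1))
    exact ⟨b, -a, by linear_combination hab⟩
  obtain ⟨v', hv'W, hv'⟩ := hW.nondeg.exists_repr hf.isRefl (T ∘ₗ aeval S y)
  -- project the representing vector to the eigenspace `D = -δ(S)`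
  obtain ⟨v, hv⟩ : ∃ v, v = (2⁻¹ : K) • (aeval S δ v' - D v') := ⟨_, rfl⟩
  have hvW : v ∈ W := by
    rw [hv]
    exact W.smul_mem _ (W.sub_mem (aeval_apply_mem hSW _ _ hv'W) (hDW _ hv'W))
  have hDv : D v = - aeval S δ v := by
    have h1 : D (D v') = aeval S (δ * δ) v' := by
      rw [h.sq_apply]
      exact (hcong _ _ (by rwa [← pow_two]) v' hv'W).symm
    rw [hv, map_smul, map_sub, h1, map_smul, map_sub, hmul, hcomm]
    module
  have huv : ∀ a, f (aeval S a u) v = Λ a := by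
    intro a
    have h1 : f (aeval S a u) v = f (aeval S (δ * a) u) v' := by
      rw [hv, map_smul, map_sub, hself, h.skew, hcomm, hDu, hmul, hmul, mul_comm a, smul_eq_mul]
      field_simp
      ring
    rw [h1, hv' _ (aeval_apply_mem hSW _ _ huW), LinearMap.comp_apply, hmul, hT, ← sub_eq_zero,
      ← map_sub]
    refine hΛ0 _ ?_
    rw [show y * (δ * a) - a = (y * δ - 1) * a by ring]
    exact hy.mul_right a
  obtain ⟨τ, hττ, hτD, hτS, hτG⟩ : ∃ τ : K[X] × K[X] → K[X] × K[X], (∀ p, τ (τ p) = p) ∧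
      (∀ p : K[X] × K[X], τ (δ * p.1, -(δ * p.2)) = (δ * (τ p).1, -(δ * (τ p).2))) ∧
      (∀ p : K[X] × K[X], τ (X * p.1, X * p.2) = (-(X * (τ p).1), -(X * (τ p).2))) ∧
      ∀ p r, Λ ((τ p).1 * (τ r).2) - Λ ((τ p).2 * (τ r).1) = Λ (p.1 * r.2) - Λ (p.2 * r.1) := by
    rcases hη with rfl | rfl
    · refine ⟨fun p => (p.1.comp (-X), p.2.comp (-X)), fun p => ?_, fun p => ?_, fun p => ?_,
        fun p r => ?_⟩
      · simp only [comp_neg_X_comp_neg_X]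
      · simp [hδ]
      · simp
      · simp only [← mul_comp, hΛneg, one_mul]
    · refine ⟨fun p => (p.2.comp (-X), p.1.comp (-X)), fun p => ?_, fun p => ?_, fun p => ?_,
        fun p r => ?_⟩
      · simp only [comp_neg_X_comp_neg_X]
      · simp [hδ]
      · simp
      · simp only [← mul_comp, hΛneg]
        ring
  let g : K[X] × K[X] → V := fun p => aeval S p.1 u + aeval S p.2 v
  have hgram : ∀ p r : K[X] × K[X], f (g p) (g r) = Λ (p.1 * r.2) - Λ (p.2 * r.1) := by
    intro p r
    have h1 : f (aeval S p.1 u) (aeval S r.1 u) = 0 := by rw [hself, hmul, hiso]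
    have h2 : f (aeval S p.1 u) (aeval S r.2 v) = Λ (p.1 * r.2) := by
      rw [hself, hmul, huv, mul_comm]
    have h3 : f (aeval S p.2 v) (aeval S r.1 u) = - Λ (p.2 * r.1) := by
      rw [← hf.neg_eq, hself, hmul, huv]
    have h5 : f (aeval S p.2 v) (aeval S r.2 v) = 0 := by rw [hself, hmul, hiso]
    simp only [g, map_add, LinearMap.add_apply, h1, h2, h3, h5]
    ring
  set W₁ := Submodule.span K (Set.range g) with hW₁
  have hmem : ∀ x ∈ W₁, ∃ p, x = g p := by
    intro x hx
    induction hx using Submodule.span_induction with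
    | mem x hx => obtain ⟨p, rfl⟩ := hx; exact ⟨p, rfl⟩
    | zero => exact ⟨(0, 0), by simp [g]⟩
    | add x y _ _ hx hy =>
      obtain ⟨p, rfl⟩ := hx
      obtain ⟨r, rfl⟩ := hy
      exact ⟨(p.1 + r.1, p.2 + r.2), by simp only [g, map_add, LinearMap.add_apply]; abel⟩
    | smul c x _ hx =>
      obtain ⟨p, rfl⟩ := hx
      exact ⟨(c • p.1, c • p.2), by simp [g]⟩
  have hgmem : ∀ p, g p ∈ W₁ := fun p => Submodule.subset_span ⟨p, rfl⟩
  have hle : W₁ ≤ W := by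
    rw [hW₁, Submodule.span_le]
    rintro _ ⟨p, rfl⟩
    exact W.add_mem (aeval_apply_mem hSW _ _ huW) (aeval_apply_mem hSW _ _ hvW)
  have hkill : ∀ b : K[X], (∀ c : K[X], Λ (b * c) = 0) → q ^ (k + 1) ∣ b := by
    intro b hb
    by_contra hb0
    have hb1 : aeval S b u ≠ 0 := fun h0 => hb0 (hann b h0)
    obtain ⟨c, hc⟩ := exists_mul_eq_socle hq (hqk u huW) hb1
    have h1 := hb (e * c)
    rw [← hT, show b * (e * c) = e * (c * b) by ring, ← hmul, hc, hmul, hT] at h1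
    exact hΛe h1
  have hnd : IsNondegOn f W₁ := by
    intro x hx hx0
    obtain ⟨p, rfl⟩ := hmem x hx
    have h2 := hdvd _ (hkill p.2 fun c => by
      have := hx0 _ (hgmem (c, 0))
      rw [hgram] at this
      simpa using this) v hvW
    have h1 := hdvd _ (hkill p.1 fun c => by
      have := hx0 _ (hgmem (0, c))
      rw [hgram] at this
      simpa using this) u huW
    simp [g, h1, h2]
  have hSg : ∀ p, S (g p) = g (X * p.1, X * p.2) := fun p => by
    have hX : ∀ (r : K[X]) x, S (aeval S r x) = aeval S (X * r) x := fun q x => by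
      rw [map_mul, aeval_X, Module.End.mul_apply]
    simp only [g, map_add, hX]
  have hDg : ∀ p, D (g p) = g (δ * p.1, -(δ * p.2)) := fun p => by
    simp only [g, map_add, hcomm, hDu, hDv, map_neg, hmul, mul_comm δ, LinearMap.neg_apply]
  have hinv : IsAdapted f {(D, (1 : K)), (S, -1)} W₁ := by
    refine isAdapted_pair hnd (fun x hx => ?_) (fun x hx => ?_)
    · obtain ⟨p, rfl⟩ := hmem x hx
      rw [hDg]; exact hgmem _
    · obtain ⟨p, rfl⟩ := hmem x hx
      rw [hSg]; exact hgmem _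
  have hrange : Set.range (fun p => g (τ p)) = Set.range g := by
    ext x
    constructor
    · rintro ⟨p, rfl⟩
      exact ⟨_, rfl⟩
    · rintro ⟨p, rfl⟩
      exact ⟨τ p, by simp only [hττ]⟩
  obtain ⟨s, -, hs⟩ := exists_isTwist_on_span (f := f) g (fun p => g (τ p)) 1 1
    {(D, (1 : K)), (S, -1)} W₁ rfl
    (by rw [hrange]) hnd
    (fun p r => by rw [hgram, hgram, hτG, one_mul])
    (fun s hs p => by rw [hs, hττ, one_smul])
    (by
      rintro s hs p (rfl | rfl) r
      · simp only
        rw [hDg, hs, hτD, hDg, one_smul]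
      · simp only
        rw [hSg, hs, hτS, hSg]
        simp only [g, map_neg, LinearMap.neg_apply]
        module)
  refine ⟨W₁, hle, fun h0 => ?_, hinv, s, hs⟩
  have hu1 : u ∈ W₁ := by simpa [g] using hgmem (1, 0)
  rw [h0, Submodule.mem_bot] at hu1
  rw [hu1, map_zero] at hu0
  exact hu0 rfl

/-- The required involution exists on a space where an even irreducible polynomial in `S`, different
from `x`, is nilpotent. -/
theorem IsSumDiff.exists_isTwist_of_even_nilpotent [FiniteDimensional K V] [Finite K]
    (h2 : ringChar K ≠ 2) [NeZero (2 : K)] {f : LinearMap.BilinForm K V} (hf : f.IsAlt)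
    {D S : Module.End K V} (h : IsSumDiff f D S) {q : K[X]}
    (hq : Irreducible q) (heven : q.comp (-X) = q) (hX : ¬ q ∣ X)
    {W : Submodule K V} (hW : IsAdapted f {(D, (1 : K)), (S, -1)} W)
    (hnil : ∃ n : ℕ, ∀ x ∈ W, (aeval S q ^ n) x = 0) :
    ∃ s, IsTwist f 1 1 {(D, 1), (S, -1)} W s := by
  have h20 : (2 : K) ≠ 0 := NeZero.ne _
  have h𝒜 := h.hasScalarAdjoints 1 (-1)
  have hmul := aeval_aeval_apply S
  have hcomm := h.comm_aeval
  have h4even : (X ^ 2 - 4 : K[X]).comp (-X) = X ^ 2 - 4 := by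
    have : (4 : K[X]) = C 4 := (map_ofNat C 4).symm
    rw [this]; simp
  -- an even polynomial divisible by `x - 2` and irreducible is a multiple of `x - 2`
  have h4 : ¬ q ∣ X ^ 2 - 4 := by
    intro hd
    have h44 : (X ^ 2 - 4 : K[X]) = (X - C 2) * (X - C (-2)) := by
      have : (4 : K[X]) = C 2 * C 2 := by
        rw [← C_mul, show (2 * 2 : K) = 4 by norm_num, map_ofNat]
      rw [this, C_neg]; ring
    have key : ∀ c : K, c ≠ 0 → ¬ q ∣ X - C c := by
      intro c hc hd
      have ha := hq.associated_of_dvd (irreducible_X_sub_C c) hd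
      have hr : q.eval c = 0 := dvd_iff_isRoot.1 ha.symm.dvd
      have hr' : q.eval (-c) = 0 := by
        rw [← heven, eval_comp]; simpa using hr
      have h1 : (X - C (-c)) ∣ X - C c := (dvd_iff_isRoot.2 hr').trans hd
      have h3 := eval_eq_zero_of_dvd_of_eval_eq_zero h1 (x := -c) (by simp)
      simp only [eval_sub, eval_X, eval_C] at h3
      have h5 : (2 : K) * c = 0 := by linear_combination -h3
      exact (mul_ne_zero h20 hc) h5
    rw [h44] at hd
    rcases hq.prime.dvd_or_dvd hd with h' | h'
    exacts [key 2 h20 h', key (-2) (neg_ne_zero.2 h20) h']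
  refine exists_isTwist_of_strip hf.isRefl h𝒜
    (fun W => ∃ n : ℕ, ∀ x ∈ W, (aeval S q ^ n) x = 0) ?_ W hnil hW
  rintro W ⟨n, hn⟩ hW hbot
  have hDW : ∀ u ∈ W, D u ∈ W := hW.inv _ (Or.inl rfl)
  have hSW : ∀ u ∈ W, S u ∈ W := hW.inv _ (Or.inr rfl)
  obtain ⟨k, hz, x, hx, hx0⟩ := exists_nilpotency_index hbot ⟨n, hn⟩
  simp only [← map_pow] at hz hx0
  obtain ⟨δ, η, hηη, hδ, hδ2⟩ := exists_even_or_odd_sqrt_pow h2 hq heven hX h4even h4 (k + 1)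
  have hη : η = 1 ∨ η = -1 := mul_self_eq_one_iff.1 hηη
  have hD2 : ∀ x ∈ W, D (D x) = aeval S (δ * δ) x := fun x hx => by
    rw [h.sq_apply, ← sub_eq_zero, ← LinearMap.sub_apply, ← map_sub]
    obtain ⟨r, hr⟩ := hδ2
    rw [show X ^ 2 - 4 - δ * δ = -r * q ^ (k + 1) by linear_combination -hr, ← hmul, hz x hx,
      map_zero]
  have finish : ∀ δ : K[X], δ.comp (-X) = C η * δ → q ^ (k + 1) ∣ δ ^ 2 - (X ^ 2 - 4) →
      (∀ x ∈ W, D (D x) = aeval S (δ * δ) x) → aeval S (q ^ k) (aeval S δ x + D x) ≠ 0 →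
      ∃ W₁ ≤ W, W₁ ≠ ⊥ ∧ IsAdapted f {(D, (1 : K)), (S, -1)} W₁ ∧
      (∃ s, IsTwist f 1 1 {(D, (1 : K)), (S, -1)} W₁ s) ∧
        ∃ n : ℕ, ∀ x ∈ W ⊓ f.orthogonal W₁, (aeval S q ^ n) x = 0 := by
    intro δ hδ hδ2 hD2 hne
    obtain ⟨W₁, h1, h3, h5, h6⟩ := h.exists_isTwist_of_even hf hW hq heven hX h4 hz hη hδ hδ2
      (W.add_mem (aeval_apply_mem hSW δ x hx) (hDW x hx)) hne (by
        rw [map_add, map_add, hD2 x hx, hcomm, hmul, add_comm])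
    exact ⟨W₁, h1, h3, h5, h6, n, fun x hx => hn x hx.1⟩
  by_cases hne : aeval S (q ^ k) (aeval S δ x + D x) = 0
  swap
  · exact finish δ hδ hδ2 hD2 hne
  -- otherwise `D = -δ(S)` on a suitable vector
  refine finish (-δ) (by rw [neg_comp, hδ, mul_neg]) (by rwa [neg_sq])
    (by simpa only [neg_mul_neg] using hD2) fun hne' => ?_
  have hDx : aeval S (q ^ k) (D x) = 0 := by
    have h1 : (2 : K) • aeval S (q ^ k) (D x) = 0 := by
      rw [map_add] at hne hne'
      rw [map_neg, LinearMap.neg_apply, map_neg] at hne'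
      calc (2 : K) • aeval S (q ^ k) (D x) =
          (aeval S (q ^ k) (aeval S δ x) + aeval S (q ^ k) (D x)) +
          (-aeval S (q ^ k) (aeval S δ x) + aeval S (q ^ k) (D x)) := by module
        _ = 0 := by rw [hne, hne', zero_add]
    exact (smul_eq_zero.1 h1).resolve_left h20
  have h1 : aeval S ((X ^ 2 - 4) * q ^ k) x = 0 := by
    rw [← hmul, ← h.sq_apply, hcomm, hDx, map_zero]
  have h3 := pow_dvd_of_aeval_eq_zero hq (hz x hx) hx0 h1
  rw [pow_succ'] at h3
  exact h4 ((mul_dvd_mul_iff_right (pow_ne_zero k hq.ne_zero)).1 h3)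

theorem aeval_apply_of_anticommute {g S : Module.End K V} (h : g * S = -(S * g)) (p : K[X])
    (x : V) : aeval S p (g x) = g (aeval S (p.comp (-X)) x) := by
  have h1 : ∀ x, S (g x) = - g (S x) := fun x => by
    have := LinearMap.congr_fun h x
    rw [LinearMap.neg_apply, Module.End.mul_apply, Module.End.mul_apply] at this
    rw [this, neg_neg]
  have h2 : ∀ (n : ℕ) (x : V), (S ^ n) (g x) = g (((-S) ^ n) x) := by
    intro n
    induction n with
    | zero => simp
    | succ n ih =>
      intro x
      rw [pow_succ, Module.End.mul_apply, h1, ← map_neg, ih, pow_succ, Module.End.mul_apply]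
      rfl
  rw [aeval_comp, map_neg, aeval_X, aeval_endomorphism, aeval_endomorphism, Polynomial.sum_def,
    Polynomial.sum_def, map_sum]
  exact Finset.sum_congr rfl fun n _ => by rw [map_smul, h2]

theorem IsIsometryPair.anticommute_inv {f : LinearMap.BilinForm K V} {g g' S : Module.End K V}
    (hg : IsIsometryPair f g g') (h : g * S = -(S * g)) : g' * S = -(S * g') := by
  refine LinearMap.ext fun x => ?_
  have h1 := LinearMap.congr_fun h (g' x)
  rw [Module.End.mul_apply, LinearMap.neg_apply, Module.End.mul_apply, hg.apply_apply] at h1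
  rw [Module.End.mul_apply, LinearMap.neg_apply, Module.End.mul_apply,
    ← hg.apply_apply' (S (g' x)), h1, map_neg, neg_neg]

/-- If `q(x)` and `q(-x)` are coprime, an isometry `g` commuting with `D` and anticommuting with `S`
interchanges the `q(S)`- and the `q(-S)`-primary part; then `g` on the former and `g⁻¹` on the
latter is the required involution. -/
theorem IsSumDiff.exists_isTwist_of_coprime [FiniteDimensional K V]
    {f : LinearMap.BilinForm K V} (hf : f.IsAlt) {D S g g' : Module.End K V} (h : IsSumDiff f D S)
    (hg : IsIsometryPair f g g') (hgD : g * D = D * g) (hgS : g * S = -(S * g)) {q : K[X]}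
    (hcop : IsCoprime q (q.comp (-X)))
    {W : Submodule K V} (hW : IsAdapted f {(D, (1 : K)), (S, -1)} W) (hgW : ∀ u ∈ W, g u ∈ W)
    (hgW' : ∀ u ∈ W, g' u ∈ W)
    (hnil : ∀ x ∈ W, (aeval S (q * q.comp (-X)) ^ Module.finrank K V) x = 0) :
    ∃ s, IsTwist f 1 1 {(D, 1), (S, -1)} W s := by
  have hself := aeval_selfAdjoint h.self
  have hcomm := h.comm_aeval
  have hmul := aeval_aeval_apply S
  have hDW : ∀ u ∈ W, D u ∈ W := hW.inv _ (Or.inl rfl)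
  have hSW : ∀ u ∈ W, S u ∈ W := hW.inv _ (Or.inr rfl)
  set N := Module.finrank K V
  set r := q.comp (-X) with hr
  obtain ⟨a, b, hab⟩ : IsCoprime (q ^ N) (r ^ N) := hcop.pow
  have hdec : ∀ x, aeval S (a * q ^ N) x + aeval S (b * r ^ N) x = x := fun x => by
    rw [← LinearMap.add_apply, ← map_add, hab, map_one, Module.End.one_apply]
  have hker : ∀ (p : K[X]) (x : V), x ∈ nilPart (aeval S p) W ↔ x ∈ W ∧ aeval S (p ^ N) x = 0 :=
    fun p x => by rw [map_pow]; rfl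
  have hswap := aeval_apply_of_anticommute hgS
  have hswap' := aeval_apply_of_anticommute (hg.anticommute_inv hgS)
  have hD' : ∀ x, g' (D x) = D (g' x) := fun x => by
    rw [← hg.apply_apply' (D (g' x)), ← Module.End.mul_apply g D, hgD, Module.End.mul_apply,
      hg.apply_apply]
  have hrq : r.comp (-X) = q := comp_neg_X_comp_neg_X q
  have h12 : ∀ x ∈ nilPart (aeval S q) W,
      g x ∈ nilPart (aeval S r) W ∧ g' x ∈ nilPart (aeval S r) W := by
    intro x hx
    rw [hker] at hx
    rw [hker, hker, hswap, hswap', pow_comp, hrq, hx.2, map_zero, map_zero]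
    exact ⟨⟨hgW x hx.1, rfl⟩, ⟨hgW' x hx.1, rfl⟩⟩
  have h21 : ∀ x ∈ nilPart (aeval S r) W,
      g x ∈ nilPart (aeval S q) W ∧ g' x ∈ nilPart (aeval S q) W := by
    intro x hx
    rw [hker] at hx
    rw [hker, hker, hswap, hswap', pow_comp, ← hr, hx.2, map_zero, map_zero]
    exact ⟨⟨hgW x hx.1, rfl⟩, ⟨hgW' x hx.1, rfl⟩⟩
  have hDp : ∀ (p : K[X]), ∀ x ∈ nilPart (aeval S p) W, D x ∈ nilPart (aeval S p) W := by
    intro p x hx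
    rw [hker] at hx ⊢
    rw [← hcomm, hx.2, map_zero]
    exact ⟨hDW x hx.1, rfl⟩
  have hSp : ∀ (p : K[X]), ∀ x ∈ nilPart (aeval S p) W, S x ∈ nilPart (aeval S p) W := by
    intro p x hx
    rw [hker] at hx ⊢
    refine ⟨hSW x hx.1, ?_⟩
    have h1 := hmul (p ^ N) X x
    rw [aeval_X, mul_comm, ← hmul, hx.2, map_zero] at h1
    exact h1
  have horth : ∀ x ∈ nilPart (aeval S q) W, ∀ y ∈ nilPart (aeval S r) W, f x y = 0 := by
    intro x hx y hy
    rw [hker] at hx hy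
    have h1 := hdec x
    rw [← hmul, hx.2, map_zero, zero_add] at h1
    calc f x y = f (aeval S (b * r ^ N) x) y := by rw [h1]
      _ = 0 := by rw [← hself, ← hmul, hy.2, map_zero, map_zero]
  have horth' : ∀ x ∈ nilPart (aeval S q) W, ∀ y ∈ nilPart (aeval S r) W, f y x = 0 :=
    fun x hx y hy => by rw [← hf.neg_eq, horth x hx y hy, neg_zero]
  let w : nilPart (aeval S q) W × nilPart (aeval S r) W → V := fun p => p.1 + p.2
  let τ : nilPart (aeval S q) W × nilPart (aeval S r) W →
      nilPart (aeval S q) W × nilPart (aeval S r) W := fun p =>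
    (⟨g' p.2, (h21 _ p.2.2).2⟩, ⟨g p.1, (h12 _ p.1.2).1⟩)
  have hττ : ∀ p, τ (τ p) = p := fun p =>
    Prod.ext (Subtype.ext (hg.apply_apply' _)) (Subtype.ext (hg.apply_apply _))
  have hwτ : ∀ p, w (τ p) = g' p.2 + g p.1 := fun p => rfl
  have hw : Submodule.span K (Set.range w) = W := by
    refine le_antisymm (Submodule.span_le.2 ?_) fun x hx => ?_
    · rintro _ ⟨p, rfl⟩
      exact W.add_mem p.1.2.1 p.2.2.1
    · have h0 : aeval S (q ^ N * r ^ N) x = 0 := by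
        rw [← mul_pow, map_pow]; exact hnil x hx
      refine Submodule.subset_span ⟨(⟨aeval S (b * r ^ N) x, ?_⟩, ⟨aeval S (a * q ^ N) x, ?_⟩), ?_⟩
      · refine (hker _ _).2 ⟨aeval_apply_mem hSW _ x hx, ?_⟩
        rw [hmul, show q ^ N * (b * r ^ N) = b * (q ^ N * r ^ N) by ring, ← hmul, h0, map_zero]
      · refine (hker _ _).2 ⟨aeval_apply_mem hSW _ x hx, ?_⟩
        rw [hmul, show r ^ N * (a * q ^ N) = a * (q ^ N * r ^ N) by ring, ← hmul, h0, map_zero]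
      · change aeval S (b * r ^ N) x + aeval S (a * q ^ N) x = x
        rw [add_comm]
        exact hdec x
  have hrange : Set.range (fun p => w (τ p)) = Set.range w := by
    ext x
    constructor
    · rintro ⟨p, rfl⟩
      exact ⟨_, rfl⟩
    · rintro ⟨p, rfl⟩
      exact ⟨τ p, by simp only [hττ]⟩
  obtain ⟨s, -, hs⟩ := exists_isTwist_on_span (f := f) w (fun p => w (τ p)) 1 1
    {(D, (1 : K)), (S, -1)} W hw (by rw [hrange, hw]) hW.nondeg
    (fun i j => by
      have hgg : ∀ x y, f (g x) (g y) = f x y := fun x y => by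
        rw [hg.adj, hg.apply_apply']
      have hgg' : ∀ x y, f (g' x) (g' y) = f x y := fun x y => by
        rw [hg.adj', hg.apply_apply]
      rw [hwτ, hwτ]
      simp only [w, map_add, LinearMap.add_apply, hgg, hgg', horth _ i.1.2 _ j.2.2,
        horth' _ j.1.2 _ i.2.2, horth _ (h21 _ i.2.2).2 _ (h12 _ j.1.2).1,
        horth' _ (h21 _ j.2.2).2 _ (h12 _ i.1.2).1]
      ring)
    (fun s hs i => by rw [hs, hττ, one_smul])
    (by
      have hD1 : ∀ i, D (w i) = w (⟨D i.1, hDp q _ i.1.2⟩, ⟨D i.2, hDp r _ i.2.2⟩) := fun i =>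
        map_add D _ _
      have hS1 : ∀ i, S (w i) = w (⟨S i.1, hSp q _ i.1.2⟩, ⟨S i.2, hSp r _ i.2.2⟩) := fun i =>
        map_add S _ _
      rintro s hs p (rfl | rfl) i
      · simp only
        rw [hD1, hs, hwτ, hwτ, map_add, one_smul, hD', ← Module.End.mul_apply g, hgD]
        rfl
      · simp only
        have h1 : ∀ x, g (S x) = -S (g x) := fun x => LinearMap.congr_fun hgS x
        have h3 : ∀ x, g' (S x) = -S (g' x) := fun x =>
          LinearMap.congr_fun (hg.anticommute_inv hgS) x
        rw [hS1, hs, hwτ, hwτ, map_add, h1, h3]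
        module)
  exact ⟨s, hs⟩

/-- Let `g` be an isometry commuting with `D` and anticommuting with `S`. If the Jordan blocks of
`S` of each even size occur with multiplicity divisible by `4`, then there is an involutory isometry
with the same properties. -/
theorem IsSumDiff.exists_isTwist_of_conj [FiniteDimensional K V] [Finite K]
    (h2 : ringChar K ≠ 2) [NeZero (2 : K)]
    {f : LinearMap.BilinForm K V} (hf : f.IsAlt) (hf' : f.Nondegenerate) {D S g g' : Module.End K V}
    (h : IsSumDiff f D S) (hg : IsIsometryPair f g g') (hgD : g * D = D * g)
    (hgS : g * S = -(S * g)) (hcond : ∀ j, Odd j → (4 : ℤ) ∣ jordanCount S ⊤ j) :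
    ∃ s, IsTwist f 1 1 {(D, 1), (S, -1)} ⊤ s := by
  have h𝒜 := h.hasScalarAdjoints 1 (-1)
  have hself := aeval_selfAdjoint h.self
  have hcomm := h.comm_aeval
  have hmul := aeval_aeval_apply S
  have hswap := aeval_apply_of_anticommute hgS
  have hswap' := aeval_apply_of_anticommute (hg.anticommute_inv hgS)
  have htop : IsAdapted f {(D, (1 : K)), (S, -1)} (⊤ : Submodule K V) :=
    isAdapted_pair (isNondegOn_top hf') (fun _ _ => trivial) fun _ _ => trivial
  -- splitting off the primary part of `p(S)`, where `p` is even or odd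
  have hsplit : ∀ (p : K[X]) (c : K), p.comp (-X) = C c * p → ∀ W : Submodule K V,
      IsAdapted f {(D, (1 : K)), (S, -1)} W → (∀ u ∈ W, g u ∈ W) → (∀ u ∈ W, g' u ∈ W) →
      IsAdapted f {(D, (1 : K)), (S, -1)} (nilPart (aeval S p) W) ∧
      (∀ x ∈ W ⊓ f.orthogonal (nilPart (aeval S p) W), aeval S p x = 0 → x = 0) ∧
      (∀ u ∈ nilPart (aeval S p) W, g u ∈ nilPart (aeval S p) W) ∧
      (∀ u ∈ nilPart (aeval S p) W, g' u ∈ nilPart (aeval S p) W) ∧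
      (∀ u ∈ W ⊓ f.orthogonal (nilPart (aeval S p) W),
        g u ∈ W ⊓ f.orthogonal (nilPart (aeval S p) W)) ∧
      ∀ u ∈ W ⊓ f.orthogonal (nilPart (aeval S p) W),
        g' u ∈ W ⊓ f.orthogonal (nilPart (aeval S p) W) := by
    intro p c hp W hW hgW hgW'
    have hDW : ∀ u ∈ W, D u ∈ W := hW.inv _ (Or.inl rfl)
    have hSW : ∀ u ∈ W, S u ∈ W := hW.inv _ (Or.inr rfl)
    obtain ⟨hnd, hinj⟩ := nilPart_spec hf.isRefl (T := aeval S p) (c := 1)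
      (by simpa using hself p) hW.nondeg (aeval_apply_mem hSW p)
    have hpN : ∀ (N : ℕ) (x : V), aeval S (p ^ N) x = 0 →
        aeval S ((p ^ N).comp (-X)) x = 0 := fun N x hx => by
      rw [pow_comp, hp, mul_pow, ← C_pow, map_mul, Module.End.mul_apply, hx, map_zero]
    have hgU : ∀ u ∈ nilPart (aeval S p) W, g u ∈ nilPart (aeval S p) W := by
      rintro u ⟨hu, hu0⟩
      have hu0 : (aeval S p ^ Module.finrank K V) u = 0 := hu0
      refine ⟨hgW u hu, ?_⟩
      change (aeval S p ^ Module.finrank K V) (g u) = 0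
      rw [← map_pow] at hu0 ⊢
      rw [hswap, hpN _ _ hu0, map_zero]
    have hgU' : ∀ u ∈ nilPart (aeval S p) W, g' u ∈ nilPart (aeval S p) W := by
      rintro u ⟨hu, hu0⟩
      have hu0 : (aeval S p ^ Module.finrank K V) u = 0 := hu0
      refine ⟨hgW' u hu, ?_⟩
      change (aeval S p ^ Module.finrank K V) (g' u) = 0
      rw [← map_pow] at hu0 ⊢
      rw [hswap', hpN _ _ hu0, map_zero]
    refine ⟨isAdapted_pair hnd (IsIsometryPair.inv_of_commute ?_ hDW)
      (IsIsometryPair.inv_of_commute ?_ hSW), hinj, hgU, hgU', ?_, ?_⟩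
    · exact LinearMap.ext fun x => (hcomm p x).symm
    · exact Commute.symm (Algebra.commute_of_mem_adjoin_self
        (aeval_mem_adjoin_singleton K (p := p) S))
    · rintro u ⟨hu, hu'⟩
      refine ⟨hgW u hu, fun n hn => ?_⟩
      change f n (g u) = 0
      rw [hg.adj]
      exact hu' _ (hgU' n hn)
    · rintro u ⟨hu, hu'⟩
      refine ⟨hgW' u hu, fun n hn => ?_⟩
      change f n (g' u) = 0
      rw [hg.adj']
      exact hu' _ (hgU n hn)
  obtain ⟨had, hinj, -, -, hgW, hgW'⟩ := hsplit X (-1) (by simp) ⊤ htop (fun _ _ => trivial)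
    fun _ _ => trivial
  rw [aeval_X] at had hinj hgW hgW'
  have hW := had.compl hf.isRefl h𝒜 htop le_top
  have hcount := had.jordanCount_compl hf.isRefl h𝒜 htop le_top (p := (S, -1)) (Or.inr rfl)
  set U := nilPart S (⊤ : Submodule K V)
  set W := ⊤ ⊓ f.orthogonal U
  obtain ⟨s₁, hs₁⟩ := h.exists_isTwist_of_nilpotent h2 hf had ⟨_, fun x hx => hx.2⟩ fun j hj => by
    have h1 := hcount j
    simp only at h1
    rw [jordanCount_eq_zero_of_injOn (hW.inv (S, -1) (Or.inr rfl)) hinj] at h1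
    rw [← sub_eq_zero.1 h1.symm]
    exact hcond j hj
  suffices ∃ s₂, IsTwist f 1 1 {(D, (1 : K)), (S, -1)} W s₂ by
    obtain ⟨s₂, hs₂⟩ := this
    exact hs₁.glue hf.isRefl h𝒜 had htop le_top hs₂
  refine exists_isTwist_of_strip hf.isRefl h𝒜 (fun W => (∀ x ∈ W, S x = 0 → x = 0) ∧
    (∀ u ∈ W, g u ∈ W) ∧ ∀ u ∈ W, g' u ∈ W) ?_ W ⟨hinj, hgW, hgW'⟩ hW
  clear_value W
  clear hs₁ hcount hW hgW hgW' hinj had W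
  rintro W ⟨hinj, hgW, hgW'⟩ hW hbot
  have hSW : ∀ u ∈ W, S u ∈ W := hW.inv _ (Or.inr rfl)
  obtain ⟨m, hm0, hm⟩ := exists_annihilator S W
  have hmu : ¬ IsUnit m := fun hu => hbot <| (Submodule.eq_bot_iff _).2 fun x hx => by
    simpa using (hm 1).2 hu.dvd x hx
  obtain ⟨q, hq, hqm⟩ := WfDvdMonoid.exists_irreducible_factor hmu hm0
  obtain ⟨x, hx, hx0, hqx⟩ : ∃ x ∈ W, x ≠ 0 ∧ aeval S q x = 0 := by
    obtain ⟨r, rfl⟩ := hqm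
    have hr0 : r ≠ 0 := by rintro rfl; simp at hm0
    have hr : ¬ q * r ∣ r := fun hd =>
      hq.not_isUnit (isUnit_of_dvd_one ((mul_dvd_mul_iff_right hr0).1 (by simpa using hd)))
    rw [← hm] at hr
    push Not at hr
    obtain ⟨x, hx, hx0⟩ := hr
    exact ⟨_, aeval_apply_mem hSW r x hx, hx0, by rw [hmul, (hm _).2 dvd_rfl x hx]⟩
  have hX : ¬ q ∣ X := fun hd => by
    obtain ⟨c, hc⟩ := (hq.associated_of_dvd irreducible_X hd).dvd
    refine hx0 (hinj x hx ?_)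
    rw [← aeval_X (R := K) S, hc, mul_comm, ← hmul, hqx, map_zero]
  have hne : ∀ p : K[X], q ∣ p → nilPart (aeval S p) W ≠ ⊥ := by
    rintro p ⟨r, rfl⟩ hb
    have h1 : x ∈ nilPart (aeval S (q * r)) W := mem_nilPart_of_pow (k := 1) hx (by
      rw [pow_one, mul_comm, ← hmul, hqx, map_zero])
    rw [hb] at h1
    exact hx0 h1
  have hinj' : ∀ U : Submodule K V, ∀ x ∈ W ⊓ f.orthogonal U, S x = 0 → x = 0 :=
    fun U x hx => hinj x hx.1
  have hqirr : Irreducible (q.comp (-X)) := by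
    have := (MulEquiv.irreducible_iff (algEquivAevalNegX (R := K))).2 hq
    exact this
  by_cases hass : Associated q (q.comp (-X))
  · -- an odd polynomial would be divisible by `x`
    have heven : q.comp (-X) = q := by
      obtain ⟨c, hc⟩ := hass
      obtain ⟨c, hcu, hc'⟩ := Polynomial.isUnit_iff.1 c.isUnit
      rw [← hc'] at hc
      have h1 : q.comp (-X) = C c * q := by rw [← hc, mul_comm]
      have h3 : q = C c * (C c * q) := by
        conv_lhs => rw [← comp_neg_X_comp_neg_X q, h1, mul_comp, C_comp, h1]
      have h4 : c * c = 1 := by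
        have h5 : (C (c * c) - 1) * q = 0 := by rw [C_mul]; linear_combination -h3
        have h6 := (mul_eq_zero.1 h5).resolve_right hq.ne_zero
        rw [sub_eq_zero, ← C_1, C_inj] at h6
        exact h6
      rcases mul_self_eq_one_iff.1 h4 with rfl | rfl
      · rw [h1, C_1, one_mul]
      · exfalso
        have h7 := congrArg (eval 0) h1
        simp only [eval_comp, eval_neg, eval_X, neg_zero, eval_mul, eval_C] at h7
        have h8 : (2 : K) * eval 0 q = 0 := by linear_combination h7
        have h9 := (mul_eq_zero.1 h8).resolve_left (NeZero.ne _)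
        have h10 : X ∣ q := by rw [X_dvd_iff, coeff_zero_eq_eval_zero, h9]
        exact hX (irreducible_X.associated_of_dvd hq h10).symm.dvd
    obtain ⟨had, -, -, -, h5, h6⟩ := hsplit q 1 (by rw [heven, C_1, one_mul]) W hW hgW hgW'
    exact ⟨_, nilPart_le _ _, hne q dvd_rfl, had,
      h.exists_isTwist_of_even_nilpotent h2 hf hq heven hX had ⟨_, fun x hx => hx.2⟩,
      hinj' _, h5, h6⟩
  · have hcop : IsCoprime q (q.comp (-X)) :=
      (hq.coprime_iff_not_dvd).2 fun hd => hass (hq.associated_of_dvd hqirr hd)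
    obtain ⟨had, -, h3, h4, h5, h6⟩ := hsplit (q * q.comp (-X)) 1 (by
      rw [mul_comp, comp_neg_X_comp_neg_X, C_1, one_mul, mul_comm]) W hW hgW hgW'
    exact ⟨_, nilPart_le _ _, hne _ (dvd_mul_right _ _), had,
      h.exists_isTwist_of_coprime hf hg hgD hgS hcop had h3 h4 fun x hx => hx.2,
      hinj' _, h5, h6⟩

end NegInverting

section Obstruction

variable {K V : Type*} [Field K] [AddCommGroup V] [Module K V]

/-! ### Parity of dimensions -/

theorem even_finrank_of_mul_self_eq_neg_one [FiniteDimensional K V] (hsq : ¬ IsSquare (-1 : K))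
    {J : Module.End K V} (hJ : ∀ x, J (J x) = -x) : Even (Module.finrank K V) := by
  by_contra hc
  refine hsq ⟨LinearMap.det J, ?_⟩
  have h1 : J * J = (-1 : K) • (1 : Module.End K V) := LinearMap.ext fun x => by
    rw [Module.End.mul_apply, hJ, LinearMap.smul_apply, Module.End.one_apply, neg_one_smul]
  rw [← map_mul, h1, LinearMap.det_smul, map_one, mul_one,
    (Nat.not_even_iff_odd.1 hc).neg_one_pow]

theorem even_finrank_of_form_neg [FiniteDimensional K V] (hsq : ¬ IsSquare (-1 : K))
    {B : LinearMap.BilinForm K V} (hB : ∀ x, (∀ y, B x y = 0) → x = 0) {T : Module.End K V}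
    (hT : ∀ x y, B (T x) (T y) = - B x y) : Even (Module.finrank K V) := by
  by_contra hc
  have hodd := Nat.not_even_iff_odd.1 hc
  let b := Module.finBasis K V
  set M := LinearMap.BilinForm.toMatrix b B with hM
  set A := LinearMap.toMatrix b b T
  have h1 : A.transpose * M * A = -M := by
    have h2 : B.comp T T = -B := by
      ext x y
      exact hT x y
    rw [hM, ← LinearMap.BilinForm.toMatrix_comp b b B T T, h2]
    exact map_neg (LinearMap.BilinForm.toMatrix b) B
  have hdet : M.det ≠ 0 := by
    have : B.Nondegenerate := by
      have h3 : LinearMap.SeparatingLeft B := fun x hx => hB x hx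
      exact LinearMap.BilinForm.nondegenerate_iff_ker_eq_bot.2
        (LinearMap.separatingLeft_iff_ker_eq_bot.1 h3)
    exact (LinearMap.BilinForm.nondegenerate_iff_det_ne_zero b).1 this
  have h4 := congrArg Matrix.det h1
  rw [Matrix.det_mul, Matrix.det_mul, Matrix.det_transpose, Matrix.det_neg, Fintype.card_fin,
    hodd.neg_one_pow] at h4
  refine hsq ⟨A.det, mul_right_cancel₀ hdet ?_⟩
  linear_combination -h4

/-- A nondegenerate form, for which an involution `R` is skew-adjoint, pairs the two eigenspaces of
`R`; if moreover `J ^ 2 = -1` and `J` commutes with `R`, the eigenspaces have even dimension. -/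
theorem four_dvd_finrank [FiniteDimensional K V] [NeZero (2 : K)] (hsq : ¬ IsSquare (-1 : K))
    {B : LinearMap.BilinForm K V} (hB : ∀ x, (∀ y, B x y = 0) → x = 0) {R J : Module.End K V}
    (hR : ∀ x, R (R x) = x) (hJ : ∀ x, J (J x) = -x) (hRJ : ∀ x, R (J x) = J (R x))
    (hBR : ∀ x y, B (R x) y = - B x (R y)) : 4 ∣ Module.finrank K V := by
  have h20 : (2 : K) ≠ 0 := NeZero.ne _
  let E : K → Submodule K V := fun c => LinearMap.ker (R - c • 1)
  have hE : ∀ c x, x ∈ E c ↔ R x = c • x := fun c x => by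
    simp only [E, LinearMap.mem_ker, LinearMap.sub_apply, LinearMap.smul_apply,
      Module.End.one_apply, sub_eq_zero]
  have hdec : ∀ c : K, c * c = 1 → ∀ x, x + c • R x ∈ E c := fun c hc x => by
    rw [hE, map_add, map_smul, hR, smul_add, smul_smul, hc, one_smul, add_comm]
  have hcompl : IsCompl (E 1) (E (-1)) := by
    refine IsCompl.of_le ?_ ?_
    · rintro x ⟨h1, h2⟩
      have h1 := (hE _ _).1 h1
      have h2 := (hE _ _).1 h2
      rw [h1, one_smul, neg_one_smul] at h2
      have h3 : (2 : K) • x = 0 := by rw [two_smul]; nth_rewrite 1 [h2]; exact neg_add_cancel x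
      exact (smul_eq_zero.1 h3).resolve_left h20
    · intro x _
      have h3 : x = (2⁻¹ : K) • (x + (1 : K) • R x) + (2⁻¹ : K) • (x + (-1 : K) • R x) := by
        rw [← smul_add, eq_inv_smul_iff₀ h20]
        module
      rw [h3]
      exact Submodule.add_mem_sup (Submodule.smul_mem _ _ (hdec 1 (by ring) x))
        (Submodule.smul_mem _ _ (hdec (-1) (by ring) x))
  have hle : ∀ c : K, c * c = 1 → Module.finrank K (E c) ≤ Module.finrank K (E (-c)) := by
    intro c hc
    let F : E c →ₗ[K] Module.Dual K (E (-c)) :=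
      ((E (-c)).subtype.dualMap.comp B).comp (E c).subtype
    have hF : Function.Injective F := by
      rw [← LinearMap.ker_eq_bot, LinearMap.ker_eq_bot']
      intro x hx
      refine Subtype.ext (hB _ fun y => ?_)
      have hxc : R x = c • (x : V) := (hE _ _).1 x.2
      have h1 : B x (y + (-c) • R y) = 0 :=
        LinearMap.congr_fun hx ⟨_, hdec (-c) (by rw [neg_mul_neg, hc]) y⟩
      have h2 := hBR x y
      rw [hxc, map_smul, LinearMap.smul_apply, smul_eq_mul] at h2
      rw [map_add, map_smul, smul_eq_mul] at h1
      have h3 : 2 * B x y = 0 := by linear_combination h1 + c * h2 + (-B x y) * hc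
      exact (mul_eq_zero.1 h3).resolve_left h20
    have := LinearMap.finrank_le_finrank_of_injective hF
    rwa [Subspace.dual_finrank_eq] at this
  have heq : Module.finrank K (E 1) = Module.finrank K (E (-1)) := by
    refine le_antisymm (hle 1 (by ring)) ?_
    have := hle (-1) (by ring)
    rwa [neg_neg] at this
  have hev : Even (Module.finrank K (E 1)) := by
    refine even_finrank_of_mul_self_eq_neg_one hsq
      (J := J.restrict (p := E 1) (q := E 1) fun x hx => ?_) fun x => ?_
    · have hx := (hE _ _).1 hx
      exact (hE _ _).2 (by rw [hRJ, hx, map_smul])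
    · exact Subtype.ext (hJ x)
  have hsum := Submodule.finrank_add_eq_of_isCompl hcompl
  obtain ⟨m, hm⟩ := hev
  exact ⟨m, by omega⟩

/-! ### The form attached to the Jordan blocks of a given size -/

theorem finrank_map_add_finrank_inf_ker [FiniteDimensional K V] (T : Module.End K V)
    (A : Submodule K V) : Module.finrank K (A.map T) + Module.finrank K
      (A ⊓ LinearMap.ker T : Submodule K V) = Module.finrank K A := by
  have h1 := LinearMap.finrank_range_add_finrank_ker (T.domRestrict A)
  rw [LinearMap.range_domRestrict] at h1
  rw [← h1]
  congr 1
  rw [LinearMap.ker_domRestrict, ← Submodule.map_comap_subtype,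
    ← LinearEquiv.finrank_eq (Submodule.equivSubtypeMap A _)]

/-- On the kernel `U` of `P ^ (j + 1)` the form `f (P ^ j u) v` has rank equal to the number of
Jordan blocks of size `j + 1`. A complement `H` of the radical is described together with the
projection `π` onto it. -/
theorem exists_radical_complement [FiniteDimensional K V] {f : LinearMap.BilinForm K V}
    (hf : f.IsAlt) {P : Module.End K V} {κ : K} (hκ : κ ≠ 0)
    (hP : ∀ u v, f u (P v) = κ * f (P u) v) {W : Submodule K V} (hW : IsNondegOn f W)
    (hPW : ∀ u ∈ W, P u ∈ W) (j : ℕ) :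
    ∃ (H : Submodule K V) (π : Module.End K V),
      (Module.finrank K H : ℤ) = jordanCount P W j ∧
      (∀ u ∈ H, u ∈ W ∧ (P ^ (j + 1)) u = 0 ∧ π u = u) ∧
      (∀ u ∈ H, (∀ v ∈ H, f ((P ^ j) u) v = 0) → u = 0) ∧
      (∀ u ∈ W, (P ^ (j + 1)) u = 0 → π u ∈ H ∧ ∀ v ∈ W, (P ^ (j + 1)) v = 0 →
        f ((P ^ j) (π u)) v = f ((P ^ j) u) v ∧ f ((P ^ j) v) (π u) = f ((P ^ j) v) u) ∧
      ∀ u ∈ W, (P ^ (j + 1)) u = 0 →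
        (∀ v ∈ W, (P ^ (j + 1)) v = 0 → f ((P ^ j) u) v = 0) → π u = 0 := by
  have hPk := form_pow_adjoint hP
  have hswap : ∀ u v, f ((P ^ j) v) u = - κ ^ j * f ((P ^ j) u) v := fun u v => by
    rw [← hf.neg_eq, hPk]; ring
  set U : Submodule K V := W ⊓ LinearMap.ker (P ^ (j + 1)) with hU
  let N : Submodule K V :=
    { carrier := {u | u ∈ U ∧ ∀ v ∈ U, f ((P ^ j) u) v = 0}
      add_mem' := fun {a b} ha hb => ⟨U.add_mem ha.1 hb.1, fun v hv => by
        rw [map_add, map_add, LinearMap.add_apply, ha.2 v hv, hb.2 v hv, add_zero]⟩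
      zero_mem' := ⟨U.zero_mem, fun v _ => by simp⟩
      smul_mem' := fun c a ha => ⟨U.smul_mem c ha.1, fun v hv => by
        rw [map_smul, map_smul, LinearMap.smul_apply, ha.2 v hv, smul_zero]⟩ }
  have hmemN : ∀ u, u ∈ N ↔ u ∈ U ∧ ∀ v ∈ U, f ((P ^ j) u) v = 0 := fun u => Iff.rfl
  have hNU : N ≤ U := fun u hu => hu.1
  have hsucc : ∀ (k : ℕ) (x : V), P ((P ^ k) x) = (P ^ (k + 1)) x := fun k x => by
    rw [pow_succ', Module.End.mul_apply]
  have hsucc' : ∀ (k : ℕ) (x : V), (P ^ k) (P x) = (P ^ (k + 1)) x := fun k x => by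
    rw [pow_succ, Module.End.mul_apply]
  -- a vector of `W` orthogonal to `U` is in the image of `P ^ (j + 1)`
  have horth : ∀ x ∈ W, (∀ v ∈ U, f x v = 0) → ∃ w ∈ W, (P ^ (j + 1)) w = x := by
    intro x hx hxU
    obtain ⟨T, hT⟩ := exists_linearMap_comp_eq ((P ^ (j + 1)) ∘ₗ W.subtype) (f x ∘ₗ W.subtype)
      fun w hw => hxU w ⟨w.2, hw⟩
    have hT : ∀ w ∈ W, T ((P ^ (j + 1)) w) = f x w := fun w hw => hT ⟨w, hw⟩
    obtain ⟨y, hy, hyT⟩ := hW.exists_repr hf.isRefl T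
    have hPy := pow_apply_mem hPW (j + 1) y hy
    refine ⟨(-κ ^ (j + 1)) • y, W.smul_mem _ hy, ?_⟩
    rw [map_smul, ← sub_eq_zero]
    refine hW _ (W.sub_mem (W.smul_mem _ hPy) hx) fun w hw => ?_
    have h1 : f ((P ^ (j + 1)) y) w * κ ^ (j + 1) = - f x w := by
      rw [← hT w hw, ← hyT _ (pow_apply_mem hPW _ w hw), ← hf.neg_eq y, neg_neg, hPk]
      ring
    rw [map_sub, map_smul, LinearMap.sub_apply, LinearMap.smul_apply, smul_eq_mul]
    linear_combination -h1
  have hUker : U ⊓ LinearMap.ker (P ^ j) = N ⊓ LinearMap.ker (P ^ j) := by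
    refine le_antisymm (fun u hu => ⟨⟨hu.1, fun v _ => ?_⟩, hu.2⟩) (inf_le_inf_right _ hNU)
    have : (P ^ j) u = 0 := hu.2
    rw [this]; simp
  have hUmap : U.map (P ^ j) = W.map (P ^ j) ⊓ LinearMap.ker P := by
    ext x
    constructor
    · rintro ⟨u, hu, rfl⟩
      exact ⟨⟨u, hu.1, rfl⟩, LinearMap.mem_ker.2 (by rw [hsucc]; exact hu.2)⟩
    · rintro ⟨⟨u, hu, rfl⟩, h0⟩
      have h0 := LinearMap.mem_ker.1 h0
      rw [hsucc] at h0
      exact ⟨u, ⟨hu, h0⟩, rfl⟩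
  have hNmap : N.map (P ^ j) = W.map (P ^ (j + 1)) ⊓ LinearMap.ker P := by
    ext x
    constructor
    · rintro ⟨u, hu, rfl⟩
      obtain ⟨w, hw, hwu⟩ := horth _ (pow_apply_mem hPW j u hu.1.1) hu.2
      exact ⟨⟨w, hw, hwu⟩, LinearMap.mem_ker.2 (by rw [hsucc]; exact hu.1.2)⟩
    · rintro ⟨⟨w, hw, rfl⟩, h0⟩
      have h0 := LinearMap.mem_ker.1 h0
      rw [hsucc] at h0
      refine ⟨P w, ⟨⟨hPW w hw, ?_⟩, fun v hv => ?_⟩, hsucc' j w⟩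
      · exact LinearMap.mem_ker.2 (by rw [hsucc']; exact h0)
      · have h1 := hPk (j + 1) w v
        rw [show (P ^ (j + 1)) v = 0 from hv.2, map_zero] at h1
        rw [hsucc']
        exact (mul_eq_zero.1 h1.symm).resolve_left (pow_ne_zero _ hκ)
  have hmapmap : ∀ k, (W.map (P ^ k)).map P = W.map (P ^ (k + 1)) := fun k => by
    rw [pow_succ', Module.End.mul_eq_comp, Submodule.map_comp]
  obtain ⟨C, hC⟩ := Submodule.exists_isCompl N
  have hπ : ∃ π : Module.End K V, (∀ u, π u ∈ C) ∧ (∀ u, u - π u ∈ N) ∧ (∀ u ∈ C, π u = u) ∧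
      ∀ u ∈ N, π u = 0 := by
    have hid : ∀ u ∈ C, C.projection N hC.symm u = u := fun u hu =>
      Submodule.projection_apply_of_mem_left hC.symm hu
    refine ⟨C.projection N hC.symm, fun u => Submodule.projection_apply_mem hC.symm u, fun u => ?_,
      hid, fun u hu => (Submodule.projection_apply_eq_zero_iff hC.symm).2 hu⟩
    rw [← Submodule.projection_apply_eq_zero_iff hC.symm, map_sub,
      hid _ (Submodule.projection_apply_mem hC.symm u), sub_self]
  obtain ⟨π, hπC, hπN, hπid, hπ0⟩ := hπ
  have hsup : N ⊔ (U ⊓ C) = U := by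
    refine le_antisymm (sup_le hNU inf_le_left) fun u hu => ?_
    refine Submodule.mem_sup.2 ⟨u - π u, hπN u, π u, ⟨?_, hπC u⟩, by abel⟩
    have := U.sub_mem hu (hNU (hπN u))
    rwa [sub_sub_cancel] at this
  have hdim : Module.finrank K N + Module.finrank K (U ⊓ C : Submodule K V) =
      Module.finrank K U := by
    have h1 := Submodule.finrank_sup_add_finrank_inf_eq N (U ⊓ C)
    have h2 : N ⊓ (U ⊓ C) = ⊥ := by
      rw [Submodule.eq_bot_iff]
      rintro x ⟨hx, -, hx'⟩
      exact (Submodule.disjoint_def.1 hC.disjoint) x hx hx'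
    rw [hsup, h2, finrank_bot, add_zero] at h1
    exact h1.symm
  refine ⟨U ⊓ C, π, ?_, fun u hu => ⟨hu.1.1, hu.1.2, hπid u hu.2⟩, fun u hu h0 => ?_,
    fun u hu hu0 => ?_, fun u hu hu0 h0 => hπ0 u ⟨⟨hu, hu0⟩, fun v hv => h0 v hv.1 hv.2⟩⟩
  · have h1 := finrank_map_add_finrank_inf_ker (P ^ j) U
    have h2 := finrank_map_add_finrank_inf_ker (P ^ j) N
    have h3 := finrank_map_add_finrank_inf_ker P (W.map (P ^ j))
    have h4 := finrank_map_add_finrank_inf_ker P (W.map (P ^ (j + 1)))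
    rw [hUker, hUmap] at h1
    rw [hNmap] at h2
    rw [hmapmap] at h3 h4
    rw [jordanCount]
    have h5 : j + 1 + 1 = j + 2 := rfl
    rw [h5] at h4
    omega
  · rw [← hπid u hu.2]
    refine hπ0 u ⟨hu.1, fun v hv => ?_⟩
    have h1 := (hπN v).2 u hu.1
    have hv' : π v ∈ U ⊓ C := by
      refine ⟨?_, hπC v⟩
      have := U.sub_mem hv (hNU (hπN v))
      rwa [sub_sub_cancel] at this
    have h2 := h0 _ hv'
    rw [hswap, map_sub, h2, sub_zero] at h1
    refine (mul_eq_zero.1 h1).resolve_left (neg_ne_zero.2 (pow_ne_zero _ hκ))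
  · have hu' : π u ∈ U ⊓ C := by
      refine ⟨?_, hπC u⟩
      have := U.sub_mem (show u ∈ U from ⟨hu, hu0⟩) (hNU (hπN u))
      rwa [sub_sub_cancel] at this
    refine ⟨hu', fun v hv hv0 => ?_⟩
    have h1 := (hπN u).2 v ⟨hv, hv0⟩
    rw [map_sub, map_sub, LinearMap.sub_apply, sub_eq_zero] at h1
    exact ⟨h1.symm, by rw [hswap, hswap u, h1]⟩

/-- An isometry `s` anticommuting with `D` forces the Jordan blocks of `D` of each even size to
occur an even number of times if `-1` is not a square: the form `f (D ^ j u) v` is symmetric, and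
`s` changes its sign. -/
theorem even_jordanCount_of_twist [FiniteDimensional K V] (hsq : ¬ IsSquare (-1 : K))
    {f : LinearMap.BilinForm K V} (hf : f.IsAlt) {D s : Module.End K V}
    (hD : ∀ u v, f u (D v) = -1 * f (D u) v) {W : Submodule K V} (hW : IsNondegOn f W)
    (hDW : ∀ u ∈ W, D u ∈ W) (hsW : ∀ u ∈ W, s u ∈ W) (hs : ∀ u v, f (s u) (s v) = f u v)
    (hsD : ∀ u, s (D u) = - D (s u)) {j : ℕ} (hj : Odd j) : Even (jordanCount D W j) := by
  obtain ⟨H, π, hH, hHU, hnd, hπ, -⟩ :=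
    exists_radical_complement hf (neg_ne_zero.2 one_ne_zero) hD hW hDW j
  have hsk : ∀ (k : ℕ) u, (D ^ k) (s u) = (-1 : K) ^ k • s ((D ^ k) u) := by
    intro k
    induction k with
    | zero => simp
    | succ k ih =>
      intro u
      have h1 : D (s u) = - s (D u) := by rw [hsD, neg_neg]
      rw [pow_succ, Module.End.mul_apply, h1, map_neg, ih, Module.End.mul_apply, pow_succ]
      simp
  have hsU : ∀ u, (D ^ (j + 1)) u = 0 → (D ^ (j + 1)) (s u) = 0 := fun u hu => by
    rw [hsk, hu, map_zero, smul_zero]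
  rw [← hH, Int.even_coe_nat]
  let T : Module.End K H := (π * s).restrict (p := H) (q := H) fun u hu =>
    (hπ _ (hsW u (hHU u hu).1) (hsU u (hHU u hu).2.1)).1
  refine even_finrank_of_form_neg hsq (B := (f ∘ₗ (D ^ j)).domRestrict₁₂ H H) (T := T) ?_ ?_
  · exact fun x hx => Subtype.ext (hnd x x.2 fun v hv => hx ⟨v, hv⟩)
  · intro x y
    have hx := hHU x x.2
    have hy := hHU y y.2
    have hx' := hπ _ (hsW x hx.1) (hsU x hx.2.1)
    have hy' := hπ _ (hsW y hy.1) (hsU y hy.2.1)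
    have hym := hHU _ hy'.1
    change f ((D ^ j) (π (s x))) (π (s y)) = - f ((D ^ j) x) y
    rw [(hx'.2 _ hym.1 hym.2.1).1, (hy'.2 _ (hsW x hx.1) (hsU x hx.2.1)).2, hsk, map_smul,
      LinearMap.smul_apply, hs, hj.neg_one_pow]
    simp

/-- An isometry `s` of square `±1` commuting with `D` and anticommuting with `S` forces the Jordan
blocks of `S` of each even size to occur with multiplicity divisible by `4` if `-1` is not a
square. On the space carrying the form `f (S ^ j u) v` one has `D ^ 2 = -4`. -/
theorem IsSumDiff.four_dvd_jordanCount [FiniteDimensional K V] [NeZero (2 : K)]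
    (hsq : ¬ IsSquare (-1 : K))
    {f : LinearMap.BilinForm K V} (hf : f.IsAlt) (hf' : f.Nondegenerate) {D S s : Module.End K V}
    (h : IsSumDiff f D S) {ε : K} (hε : ε = 1 ∨ ε = -1) (hs : IsTwist f 1 ε {(D, 1), (S, -1)} ⊤ s)
    {j : ℕ} (hj : Odd j) : (4 : ℤ) ∣ jordanCount S ⊤ j := by
  have h20 : (2 : K) ≠ 0 := NeZero.ne _
  have hS1 : ∀ u v, f u (S v) = 1 * f (S u) v := fun u v => by rw [one_mul, h.self]
  obtain ⟨H, π, hH, hHU, hnd, hπ, hπ0⟩ :=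
    exists_radical_complement hf one_ne_zero hS1 (isNondegOn_top hf') (fun _ _ => trivial) j
  rw [← hH]
  have hsD : ∀ u, s (D u) = D (s u) := fun u => by
    have := hs.comm _ (Or.inl rfl) u trivial
    rwa [one_smul] at this
  have hsS : ∀ u, s (S u) = - S (s u) := fun u => by
    have := hs.comm _ (Or.inr rfl) u trivial
    rwa [neg_one_smul] at this
  have hs2 : ∀ u, s (s u) = ε • u := fun u => hs.sq u trivial
  have hff : ∀ u v, f (s u) (s v) = f u v := fun u v => by
    rw [hs.form u trivial v trivial, one_mul]
  have hεε : ε * ε = 1 := by rcases hε with rfl | rfl <;> ring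
  have hDS : ∀ i x, (S ^ i) (D x) = D ((S ^ i) x) := fun i x =>
    (LinearMap.congr_fun (h.comm.pow_right i).eq x).symm
  have hsk : ∀ (k : ℕ) u, (S ^ k) (s u) = (-1 : K) ^ k • s ((S ^ k) u) := by
    intro k
    induction k with
    | zero => simp
    | succ k ih =>
      intro u
      have h1 : S (s u) = - s (S u) := by rw [hsS, neg_neg]
      rw [pow_succ, Module.End.mul_apply, h1, map_neg, ih, Module.End.mul_apply, pow_succ]
      simp
  -- the operator `J = D / 2`, and the involution `R` among `s` and `s J`
  obtain ⟨J, hJ⟩ : ∃ J : Module.End K V, J = (2⁻¹ : K) • D := ⟨_, rfl⟩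
  have hJx : ∀ x, J x = (2⁻¹ : K) • D x := fun x => by rw [hJ]; rfl
  have hSJ : ∀ i x, (S ^ i) (J x) = J ((S ^ i) x) := fun i x => by
    rw [hJx, map_smul, hDS, hJx]
  have hsJ : ∀ x, s (J x) = J (s x) := fun x => by rw [hJx, map_smul, hsD, hJx]
  have hJJ : ∀ x, J (J x) = (2⁻¹ * 2⁻¹ : K) • (S ^ 2) x - x := fun x => by
    have h4 : aeval S (4 : K[X]) x = (4 : K) • x := by
      have : (4 : K[X]) = C 4 := (map_ofNat C 4).symm
      rw [this, aeval_C, Module.algebraMap_end_apply]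
    rw [hJx, hJx, map_smul, h.sq_apply, map_sub, LinearMap.sub_apply, h4, map_pow, aeval_X,
      smul_smul, smul_sub, smul_smul]
    congr 1
    rw [show (4 : K) = 2 * 2 by norm_num]
    field_simp
    rw [one_smul]
  have hJadj : ∀ u v, f u (J v) = - f (J u) v := fun u v => by
    rw [hJx, hJx, map_smul, h.skew, map_smul, LinearMap.smul_apply]
    simp
  have hsadj : ∀ u v, f (s u) v = ε * f u (s v) := fun u v => by
    have h1 := hff u (s v)
    rw [hs2, map_smul, smul_eq_mul] at h1
    linear_combination (-(f (s u)) v) * hεε + ε * h1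
  have hπS : ∀ x, (S ^ (j + 1)) x = 0 → π ((S ^ 2) x) = 0 := fun x hx => by
    have hcomm : ∀ i, (S ^ i) ((S ^ 2) x) = (S ^ (i + 2)) x := fun i => by
      rw [← Module.End.mul_apply, ← pow_add]
    have hbig : ∀ i, (S ^ (i + (j + 1))) x = 0 := fun i => by
      rw [pow_add, Module.End.mul_apply, hx, map_zero]
    refine hπ0 _ trivial ?_ fun v _ _ => ?_
    · rw [hcomm, show j + 1 + 2 = 2 + (j + 1) by ring, hbig]
    · rw [hcomm, show j + 2 = 1 + (j + 1) by ring, hbig, map_zero, LinearMap.zero_apply]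
  -- operators on `H` induced by operators compatible with the form
  have hind : ∀ A : Module.End K V, (∀ u, (S ^ (j + 1)) u = 0 → (S ^ (j + 1)) (A u) = 0) →
      (∃ A' : Module.End K V, ∃ a : K, (∀ u, (S ^ (j + 1)) u = 0 → (S ^ (j + 1)) (A' u) = 0) ∧
        ∀ u v, f ((S ^ j) (A u)) v = a * f ((S ^ j) u) (A' v)) →
      ∀ u, (S ^ (j + 1)) u = 0 → π (A (π u)) = π (A u) := by
    rintro A hA ⟨A', a, hA', hadj⟩ u hu
    have h1 := hπ u trivial hu
    have h2 := hHU _ h1.1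
    rw [← sub_eq_zero, ← map_sub, ← map_sub]
    have h3 : (S ^ (j + 1)) (π u - u) = 0 := by rw [map_sub, h2.2.1, hu, sub_zero]
    refine hπ0 _ trivial (hA _ h3) fun v _ hv => ?_
    rw [hadj, map_sub, map_sub, LinearMap.sub_apply, (h1.2 _ trivial (hA' v hv)).1, sub_self,
      mul_zero]
  have hJU : ∀ u, (S ^ (j + 1)) u = 0 → (S ^ (j + 1)) (J u) = 0 := fun u hu => by
    rw [hSJ, hu, map_zero]
  have hJind := hind J hJU ⟨J, -1, hJU, fun u v => by rw [hSJ, hJadj]; ring⟩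
  obtain ⟨R, hRU, hRR, hRJ, hRadj⟩ : ∃ R : Module.End K V,
      (∀ u, (S ^ (j + 1)) u = 0 → (S ^ (j + 1)) (R u) = 0) ∧
      (∀ u, (S ^ (j + 1)) u = 0 → π (R (R u)) = π u) ∧ (∀ u, R (J u) = J (R u)) ∧
      ∀ u v, f ((S ^ j) (R u)) v = - f ((S ^ j) u) (R v) := by
    have hsU : ∀ u, (S ^ (j + 1)) u = 0 → (S ^ (j + 1)) (s u) = 0 := fun u hu => by
      rw [hsk, hu, map_zero, smul_zero]
    rcases hε with rfl | rfl
    · refine ⟨s, hsU, fun u _ => by rw [hs2, one_smul], hsJ, fun u v => ?_⟩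
      rw [hsk, map_smul, LinearMap.smul_apply, hsadj, hj.neg_one_pow, smul_eq_mul]
      ring
    · refine ⟨s * J, fun u hu => hsU _ (hJU u hu), fun u hu => ?_, fun u => ?_, fun u v => ?_⟩
      · rw [Module.End.mul_apply, Module.End.mul_apply, ← hsJ, hs2, hJJ, neg_one_smul, map_neg,
          map_sub, map_smul, hπS u hu, smul_zero, zero_sub, neg_neg]
      · rw [Module.End.mul_apply, Module.End.mul_apply, hsJ]
      · rw [Module.End.mul_apply, Module.End.mul_apply, hsk, map_smul, LinearMap.smul_apply, hsadj,
          hj.neg_one_pow, smul_eq_mul, hsJ v, hJadj, ← hSJ]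
        ring
  have hRind := hind R hRU ⟨R, -1, hRU, fun u v => by rw [hRadj]; ring⟩
  let R' : Module.End K H := (π * R).restrict (p := H) (q := H) fun u hu =>
    (hπ _ trivial (hRU u (hHU u hu).2.1)).1
  let J' : Module.End K H := (π * J).restrict (p := H) (q := H) fun u hu =>
    (hπ _ trivial (hJU u (hHU u hu).2.1)).1
  have hmain : 4 ∣ Module.finrank K H := by
    refine four_dvd_finrank hsq (B := (f ∘ₗ (S ^ j)).domRestrict₁₂ H H) (R := R') (J := J')
      (fun x hx => Subtype.ext (hnd x x.2 fun v hv => hx ⟨v, hv⟩))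
      (fun x => Subtype.ext ?_) (fun x => Subtype.ext ?_) (fun x => Subtype.ext ?_) fun x y => ?_
    · change π (R (π (R x))) = x
      have hx := hHU x x.2
      rw [hRind _ (hRU _ hx.2.1), hRR _ hx.2.1, hx.2.2]
    · change π (J (π (J x))) = -x
      have hx := hHU x x.2
      rw [hJind _ (hJU _ hx.2.1), hJJ, map_sub, map_smul, hπS _ hx.2.1, hx.2.2, smul_zero, zero_sub]
    · change π (R (π (J x))) = π (J (π (R x)))
      have hx := hHU x x.2
      rw [hRind _ (hJU _ hx.2.1), hJind _ (hRU _ hx.2.1), hRJ]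
    · change f ((S ^ j) (π (R x))) y = - f ((S ^ j) x) (π (R y))
      have hx := hHU x x.2
      have hy := hHU y y.2
      rw [((hπ _ trivial (hRU _ hx.2.1)).2 _ trivial hy.2.1).1,
        ((hπ _ trivial (hRU _ hy.2.1)).2 _ trivial hx.2.1).2, hRadj]
  exact_mod_cast hmain

end Obstruction

section ElementaryDivisorCount

variable {K V : Type*} [Field K] [AddCommGroup V] [Module K V]

/-! ### Elementary divisors and Jordan blocks -/

theorem finrank_range_of_conj {X Y : Type*} [AddCommGroup X] [Module K X] [AddCommGroup Y]
    [Module K Y] (E : X ≃ₗ[K] Y) {T : Module.End K X} {T' : Module.End K Y}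
    (h : ∀ x, E (T x) = T' (E x)) :
    Module.finrank K (LinearMap.range T) = Module.finrank K (LinearMap.range T') := by
  have h1 : (LinearMap.range T).map (E : X →ₗ[K] Y) = LinearMap.range T' := by
    rw [← LinearMap.range_comp]
    have h2 : (E : X →ₗ[K] Y) ∘ₗ T = T' ∘ₗ (E : X →ₗ[K] Y) := LinearMap.ext h
    rw [h2, LinearMap.range_comp, LinearEquiv.range, Submodule.map_top]
  rw [← h1]
  exact (LinearEquiv.finrank_map_eq E _).symm

theorem finrank_range_pi {ι : Type*} [Fintype ι] {M : ι → Type*} [∀ i, AddCommGroup (M i)]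
    [∀ i, Module K (M i)] [∀ i, FiniteDimensional K (M i)] (T : ∀ i, Module.End K (M i)) :
    Module.finrank K (LinearMap.range (LinearMap.pi fun i => (T i) ∘ₗ LinearMap.proj i :
      Module.End K (∀ i, M i))) = ∑ i, Module.finrank K (LinearMap.range (T i)) := by
  let L : (∀ i, LinearMap.range (T i)) →ₗ[K] ∀ i, M i :=
    LinearMap.pi fun i => (LinearMap.range (T i)).subtype ∘ₗ LinearMap.proj i
  have hL : Function.Injective L := fun x y hxy => funext fun i => Subtype.ext (congrFun hxy i)
  have hr : LinearMap.range (LinearMap.pi fun i => (T i) ∘ₗ LinearMap.proj i :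
      Module.End K (∀ i, M i)) = LinearMap.range L := by
    ext x
    constructor
    · rintro ⟨y, rfl⟩
      exact ⟨fun i => ⟨T i (y i), y i, rfl⟩, rfl⟩
    · rintro ⟨y, rfl⟩
      choose z hz using fun i => (y i).2
      exact ⟨z, funext hz⟩
  rw [hr, LinearMap.finrank_range_of_inj hL, Module.finrank_pi_fintype]

/-- The multiplication by a polynomial, as a `K`-linear map. -/
noncomputable def mulEnd (M : Type*) [AddCommGroup M] [Module K M] [Module K[X] M]
    [IsScalarTower K K[X] M] (a : K[X]) : Module.End K M :=
  (LinearMap.lsmul K[X] M a).restrictScalars K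

theorem mulEnd_apply {M : Type*} [AddCommGroup M] [Module K M] [Module K[X] M]
    [IsScalarTower K K[X] M] (a : K[X]) (x : M) : mulEnd M a x = a • x := rfl

theorem finiteDimensional_quotient {P : K[X]} (hP : P ≠ 0) :
    FiniteDimensional K (K[X] ⧸ Ideal.span {P}) := (AdjoinRoot.powerBasis hP).finite

theorem finrank_range_mulEnd_of_isCoprime {P a : K[X]} (h : IsCoprime a P) :
    Module.finrank K (LinearMap.range (mulEnd (K[X] ⧸ Ideal.span {P}) a)) = P.natDegree := by
  suffices hs : Function.Surjective (mulEnd (K[X] ⧸ Ideal.span {P}) a) by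
    rw [LinearMap.range_eq_top.2 hs, finrank_top, finrank_quotient_span_eq_natDegree]
  intro x
  obtain ⟨x, rfl⟩ := Ideal.Quotient.mk_surjective x
  obtain ⟨c, d, hcd⟩ := h
  refine ⟨Ideal.Quotient.mk _ (c * x), ?_⟩
  rw [mulEnd_apply, ← Ideal.Quotient.mk_eq_mk, ← Submodule.Quotient.mk_smul,
    Ideal.Quotient.mk_eq_mk,
    Ideal.Quotient.eq, Ideal.mem_span_singleton, smul_eq_mul]
  exact ⟨-(d * x), by linear_combination x * hcd⟩

theorem finrank_range_mulEnd_pow {p : K[X]} (hp : p ≠ 0) (e k : ℕ) :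
    Module.finrank K (LinearMap.range (mulEnd (K[X] ⧸ Ideal.span {p ^ e}) (p ^ k))) =
      (e - k) * p.natDegree := by
  rcases le_or_gt e k with hk | hk
  · have h0 : mulEnd (K[X] ⧸ Ideal.span {p ^ e}) (p ^ k) = 0 := by
      refine LinearMap.ext fun x => ?_
      obtain ⟨x, rfl⟩ := Ideal.Quotient.mk_surjective x
      rw [mulEnd_apply, ← Ideal.Quotient.mk_eq_mk, ← Submodule.Quotient.mk_smul,
        Ideal.Quotient.mk_eq_mk, LinearMap.zero_apply, Ideal.Quotient.eq_zero_iff_mem,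
        Ideal.mem_span_singleton, smul_eq_mul]
      exact (pow_dvd_pow p hk).mul_right x
    rw [h0, LinearMap.range_zero, finrank_bot, Nat.sub_eq_zero_of_le hk, zero_mul]
  · -- multiplication by `p ^ k` embeds `K[x] / (p ^ (e - k))`
    have hpe : p ^ e = p ^ k * p ^ (e - k) := by rw [← pow_add, Nat.add_sub_cancel' hk.le]
    let F : (K[X] ⧸ Ideal.span {p ^ (e - k)}) →ₗ[K[X]] (K[X] ⧸ Ideal.span {p ^ e}) :=
      Submodule.mapQ _ _ (LinearMap.lsmul K[X] K[X] (p ^ k)) (by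
        rw [Ideal.span, Submodule.span_le, Set.singleton_subset_iff]
        change p ^ k * p ^ (e - k) ∈ Ideal.span {p ^ e}
        rw [← hpe]
        exact Ideal.mem_span_singleton_self _)
    have hF : ∀ x : K[X], F (Ideal.Quotient.mk _ x) = Ideal.Quotient.mk _ (p ^ k * x) :=
      fun x => rfl
    have hinj : Function.Injective (F.restrictScalars K) := by
      rw [← LinearMap.ker_eq_bot, LinearMap.ker_eq_bot']
      intro x hx
      obtain ⟨x, rfl⟩ := Ideal.Quotient.mk_surjective x
      change F _ = 0 at hx
      rw [hF, Ideal.Quotient.eq_zero_iff_mem, Ideal.mem_span_singleton, hpe] at hx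
      rw [Ideal.Quotient.eq_zero_iff_mem, Ideal.mem_span_singleton]
      exact (mul_dvd_mul_iff_left (pow_ne_zero k hp)).1 hx
    have hrange : LinearMap.range (mulEnd (K[X] ⧸ Ideal.span {p ^ e}) (p ^ k)) =
        LinearMap.range (F.restrictScalars K) := by
      ext x
      constructor
      · rintro ⟨y, rfl⟩
        obtain ⟨y, rfl⟩ := Ideal.Quotient.mk_surjective y
        exact ⟨Ideal.Quotient.mk _ y, rfl⟩
      · rintro ⟨y, rfl⟩
        obtain ⟨y, rfl⟩ := Ideal.Quotient.mk_surjective y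
        exact ⟨Ideal.Quotient.mk _ y, rfl⟩
    rw [hrange, LinearMap.finrank_range_of_inj hinj, finrank_quotient_span_eq_natDegree,
      natDegree_pow]

theorem pow_eq_pow_iff_of_irreducible {p q : K[X]} (hp : Irreducible p) (hpm : p.Monic)
    (hq : Irreducible q) (hqm : q.Monic) {a b : ℕ} (ha : 1 ≤ a) :
    q ^ a = p ^ b ↔ q = p ∧ a = b := by
  refine ⟨fun h => ?_, fun h => by rw [h.1, h.2]⟩
  have hd : q ∣ p ^ b := h ▸ dvd_pow_self q (by omega)
  have hqp : q = p := eq_of_monic_of_associated hqm hpm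
    (hq.associated_of_dvd hp (hq.prime.dvd_of_dvd_pow hd))
  refine ⟨hqp, ?_⟩
  subst hqp
  have h1 := congrArg natDegree h
  rw [natDegree_pow, natDegree_pow] at h1
  exact Nat.eq_of_mul_eq_mul_right hq.natDegree_pos h1

theorem IsElementaryDivisors.finrank_range [FiniteDimensional K V] {φ : Module.End K V} {N : ℕ}
    {p : Fin N → K[X]} {e : Fin N → ℕ} (hp : ∀ i, p i ≠ 0)
    (E : Module.AEval' φ ≃ₗ[K[X]] ⨁ i, K[X] ⧸ Ideal.span {p i ^ e i}) (a : K[X]) :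
    Module.finrank K (LinearMap.range (aeval φ a)) =
      ∑ i, Module.finrank K (LinearMap.range (mulEnd (K[X] ⧸ Ideal.span {p i ^ e i}) a)) := by
  have := fun i => finiteDimensional_quotient (pow_ne_zero (e i) (hp i))
  rw [← finrank_range_pi]
  let E' : Module.AEval' φ ≃ₗ[K[X]] (∀ i, K[X] ⧸ Ideal.span {p i ^ e i}) :=
    E ≪≫ₗ DirectSum.linearEquivFunOnFintype K[X] (Fin N) _
  refine finrank_range_of_conj ((Module.AEval'.of φ) ≪≫ₗ E'.restrictScalars K) fun x => ?_
  change E' (Module.AEval'.of φ (aeval φ a x)) = _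
  have h1 : Module.AEval'.of φ (aeval φ a x) = a • Module.AEval'.of φ x :=
    Module.AEval.of_aeval_smul φ a x
  rw [h1, map_smul]
  rfl

open Classical in
/-- The multiplicity of the elementary divisor `p ^ (j + 1)` is, up to the factor `deg p`, the
number of Jordan blocks of size `j + 1` of `p(φ)`. -/
theorem IsElementaryDivisors.count_mul_natDegree [FiniteDimensional K V] {φ : Module.End K V}
    {S : Multiset K[X]} (h : IsElementaryDivisors φ S) {p : K[X]} (hp : Irreducible p)
    (hpm : p.Monic) (j : ℕ) :
    (S.count (p ^ (j + 1)) : ℤ) * p.natDegree = jordanCount (aeval φ p) ⊤ j := by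
  obtain ⟨N, q, e, hq, rfl, ⟨E⟩⟩ := h
  have hrank : ∀ k, (Module.finrank K ((⊤ : Submodule K V).map (aeval φ p ^ k)) : ℤ) =
      ∑ i, if q i = p then ((e i - k : ℕ) : ℤ) * p.natDegree else e i * (q i).natDegree := by
    intro k
    rw [Submodule.map_top, ← map_pow,
      IsElementaryDivisors.finrank_range (fun i => (hq i).1.ne_zero) E]
    push_cast
    refine Finset.sum_congr rfl fun i _ => ?_
    split_ifs with hi
    · rw [← hi, finrank_range_mulEnd_pow (hq i).1.ne_zero]
      push_cast
      rfl
    · rw [finrank_range_mulEnd_of_isCoprime, natDegree_pow]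
      · push_cast; rfl
      · refine IsCoprime.pow ((hp.coprime_iff_not_dvd).2 fun hd => hi ?_)
        exact eq_of_monic_of_associated (hq i).2.1 hpm (hp.associated_of_dvd (hq i).1 hd).symm
  rw [jordanCount, hrank, hrank, hrank, Multiset.count_map, ← Finset.filter_val, Finset.card_val,
    Finset.mul_sum, ← Finset.sum_sub_distrib, ← Finset.sum_add_distrib, Finset.card_filter]
  push_cast
  rw [Finset.sum_mul]
  refine Finset.sum_congr rfl fun i _ => ?_
  have hiff : p ^ (j + 1) = q i ^ e i ↔ q i = p ∧ e i = j + 1 := by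
    rw [eq_comm, pow_eq_pow_iff_of_irreducible hp hpm (hq i).1 (hq i).2.1 (hq i).2.2]
  simp only [hiff]
  by_cases hi : q i = p
  · simp only [hi, true_and, if_true]
    split_ifs with he
    · have h1 : j + 1 - j = 1 := by omega
      have h2 : j + 1 - (j + 1) = 0 := by omega
      have h3 : j + 1 - (j + 2) = 0 := by omega
      rw [he, h1, h2, h3]
      push_cast
      ring
    · have h1 : ((e i - j : ℕ) : ℤ) - 2 * ((e i - (j + 1) : ℕ) : ℤ) +
          ((e i - (j + 2) : ℕ) : ℤ) = 0 := by
        omega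
      linear_combination (-(p.natDegree : ℤ)) * h1
  · simp only [hi, false_and, if_false]
    ring

theorem IsElementaryDivisors.sum_natDegree [FiniteDimensional K V] {φ : Module.End K V}
    {S : Multiset K[X]} (h : IsElementaryDivisors φ S) :
    (S.map natDegree).sum = Module.finrank K V := by
  obtain ⟨N, q, e, hq, rfl, ⟨E⟩⟩ := h
  have h1 := IsElementaryDivisors.finrank_range (fun i => (hq i).1.ne_zero) E 1
  rw [map_one] at h1
  have h2 : LinearMap.range (1 : Module.End K V) = ⊤ := LinearMap.range_id
  rw [h2, finrank_top] at h1
  rw [h1, Multiset.map_map]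
  refine Finset.sum_congr rfl fun i _ => ?_
  rw [finrank_range_mulEnd_of_isCoprime isCoprime_one_left]
  rfl

end ElementaryDivisorCount

section ProjectiveSymplectic

variable {K V : Type*} [Field K] [AddCommGroup V] [Module K V] {f : LinearMap.BilinForm K V}

/-! ### Reversible and bireflectional elements of the projective group -/

theorem Sp.neg_neg (φ : Sp f) : - -φ = φ := Sp.ext_apply fun _ => _root_.neg_neg _

theorem Sp.neg_mul (φ ψ : Sp f) : -φ * ψ = -(φ * ψ) := rfl

theorem Sp.mul_neg (φ ψ : Sp f) : φ * -ψ = -(φ * ψ) :=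
  Sp.ext_apply fun _ => map_neg (φ : V ≃ₗ[K] V) _

theorem Sp.toPSp_surjective : Function.Surjective (Sp.toPSp (f := f)) :=
  QuotientGroup.mk'_surjective _

theorem Sp.toPSp_mul (φ ψ : Sp f) : Sp.toPSp (φ * ψ) = Sp.toPSp φ * Sp.toPSp ψ := rfl

theorem Sp.toPSp_inv (φ : Sp f) : Sp.toPSp φ⁻¹ = (Sp.toPSp φ)⁻¹ := rfl

theorem Sp.toPSp_eq_iff (φ ψ : Sp f) : Sp.toPSp φ = Sp.toPSp ψ ↔ φ = ψ ∨ φ = -ψ := by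
  change ((φ : PSp f) = (ψ : PSp f)) ↔ _
  rw [QuotientGroup.eq]
  change φ⁻¹ * ψ = 1 ∨ φ⁻¹ * ψ = -1 ↔ _
  refine or_congr ?_ ?_
  · rw [inv_mul_eq_one]
  · rw [inv_mul_eq_iff_eq_mul, Sp.mul_neg, mul_one]
    constructor
    · rintro rfl; rw [Sp.neg_neg]
    · rintro rfl; rw [Sp.neg_neg]

theorem Sp.toPSp_eq_one_iff (φ : Sp f) : Sp.toPSp φ = 1 ↔ φ = 1 ∨ φ = -1 :=
  Sp.toPSp_eq_iff φ 1

theorem Sp.isReversible_toPSp_iff (φ : Sp f) :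
    IsReversible (Sp.toPSp φ) ↔ IsConj φ φ⁻¹ ∨ IsConj φ (-φ⁻¹) := by
  rw [IsReversible, isConj_iff, isConj_iff, isConj_iff, ← exists_or,
    Sp.toPSp_surjective.exists]
  refine exists_congr fun g => ?_
  rw [← Sp.toPSp_inv, ← Sp.toPSp_inv, ← Sp.toPSp_mul, ← Sp.toPSp_mul, Sp.toPSp_eq_iff]

/-- The image of `φ` in the projective group is a product of two involutions if and only if some `s`
of square `±1` conjugates `φ` to `±φ⁻¹`. -/
theorem Sp.isBireflectional_toPSp_iff (φ : Sp f) : IsBireflectional (Sp.toPSp φ) ↔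
    ∃ s : Sp f, (s * s = 1 ∨ s * s = -1) ∧ (s * φ = φ⁻¹ * s ∨ s * φ = -(φ⁻¹ * s)) := by
  have key : ∀ S T : PSp f, S * S = 1 → (S * T = T⁻¹ * S ↔ (S * T) * (S * T) = 1) := by
    intro S T hS
    have hinv : S⁻¹ = S := inv_eq_of_mul_eq_one_left hS
    rw [mul_eq_one_iff_eq_inv, mul_inv_rev, hinv]
  have hiff : ∀ s : Sp f, (s * φ = φ⁻¹ * s ∨ s * φ = -(φ⁻¹ * s)) ↔
      Sp.toPSp s * Sp.toPSp φ = (Sp.toPSp φ)⁻¹ * Sp.toPSp s := fun s => by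
    rw [← Sp.toPSp_inv, ← Sp.toPSp_mul, ← Sp.toPSp_mul, Sp.toPSp_eq_iff]
  have hsq : ∀ s : Sp f, (s * s = 1 ∨ s * s = -1) ↔ Sp.toPSp s * Sp.toPSp s = 1 := fun s => by
    rw [← Sp.toPSp_mul, Sp.toPSp_eq_one_iff]
  simp only [hiff, hsq]
  rw [← Sp.toPSp_surjective.exists (p := fun S : PSp f => S * S = 1 ∧
    S * Sp.toPSp φ = (Sp.toPSp φ)⁻¹ * S)]
  constructor
  · rintro ⟨S, T, hS, hT, h⟩
    rw [sq] at hS hT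
    refine ⟨S, hS, (key S _ hS).2 ?_⟩
    have h1 : S * Sp.toPSp φ = T := by rw [h, ← mul_assoc, hS, one_mul]
    rw [h1, hT]
  · rintro ⟨S, hS, h⟩
    refine ⟨S, S * Sp.toPSp φ, by rw [sq, hS], ?_, by rw [← mul_assoc, hS, one_mul]⟩
    rw [sq]
    exact (key S _ hS).1 h

/-- An element of `Sp f` as an endomorphism. -/
abbrev Sp.toEnd (φ : Sp f) : Module.End K V := ((φ : V ≃ₗ[K] V) : V →ₗ[K] V)

theorem Sp.toEnd_mul (φ ψ : Sp f) : Sp.toEnd (φ * ψ) = Sp.toEnd φ * Sp.toEnd ψ := rfl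

theorem Sp.toEnd_neg (φ : Sp f) : Sp.toEnd (-φ) = - Sp.toEnd φ := rfl

theorem Sp.toEnd_one : Sp.toEnd (1 : Sp f) = 1 := rfl

theorem Sp.toEnd_injective : Function.Injective (Sp.toEnd (f := f)) := fun _ _ h =>
  Sp.ext_apply fun v => LinearMap.congr_fun h v

theorem Sp.isIsometryPair (φ : Sp f) : IsIsometryPair f (Sp.toEnd φ) (Sp.toEnd φ⁻¹) where
  mul_eq_one := by rw [← Sp.toEnd_mul, mul_inv_cancel, Sp.toEnd_one]
  mul_eq_one' := by rw [← Sp.toEnd_mul, inv_mul_cancel, Sp.toEnd_one]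
  adj u v := by
    have h1 : f (Sp.toEnd φ (Sp.toEnd φ⁻¹ u)) (Sp.toEnd φ v) = f (Sp.toEnd φ⁻¹ u) v :=
      φ.2 (Sp.toEnd φ⁻¹ u) v
    rwa [← Module.End.mul_apply, ← Sp.toEnd_mul, mul_inv_cancel, Sp.toEnd_one,
      Module.End.one_apply] at h1

theorem IsTwist.apply_eq [NeZero (2 : K)] {φ ψ s : Module.End K V} {η ε c d : K} (hd : d = -c)
    (hs : IsTwist f η ε {(φ - ψ, c), (φ + ψ, d)} ⊤ s) (x : V) : s (φ x) = d • ψ (s x) := by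
  have h1 := hs.comm _ (Or.inl rfl) x trivial
  have h2 := hs.comm _ (Or.inr rfl) x trivial
  simp only [LinearMap.sub_apply, LinearMap.add_apply, map_sub, map_add] at h1 h2
  have h3 : (2 : K) • s (φ x) = (2 : K) • d • ψ (s x) := by
    calc (2 : K) • s (φ x) = (s (φ x) - s (ψ x)) + (s (φ x) + s (ψ x)) := by module
      _ = (2 : K) • d • ψ (s x) := by rw [h1, h2, hd]; module
  exact smul_right_injective V (NeZero.ne (2 : K)) h3

theorem IsTwist.exists_sp {s : Module.End K V} {ε : K} {𝒜 : Set (Module.End K V × K)}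
    (hε : ε * ε = 1) (hs : IsTwist f 1 ε 𝒜 ⊤ s) : ∃ σ : Sp f, Sp.toEnd σ = s := by
  have h1 : ∀ x, s (s x) = ε • x := fun x => hs.sq x trivial
  have h2 : s ∘ₗ (ε • s) = LinearMap.id := LinearMap.ext fun x => by
    rw [LinearMap.comp_apply, LinearMap.smul_apply, map_smul, h1, smul_smul, hε, one_smul]
    rfl
  have h3 : (ε • s) ∘ₗ s = LinearMap.id := LinearMap.ext fun x => by
    rw [LinearMap.comp_apply, LinearMap.smul_apply, h1, smul_smul, hε, one_smul]
    rfl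
  exact ⟨⟨LinearEquiv.ofLinearMap s (ε • s) h2 h3, fun u w => by
    have := hs.form u trivial w trivial
    rw [one_mul] at this
    exact this⟩, LinearMap.ext fun _ => rfl⟩

variable [FiniteDimensional K V]

theorem Sp.exists_inverting [Finite K] (h2 : ringChar K ≠ 2) [NeZero (2 : K)] (hf : f.IsAlt)
    (hf' : f.Nondegenerate) (φ : Sp f)
    (hcond : IsSquare (-1 : K) ∨ ∀ j, Odd j →
      Even (jordanCount (Sp.toEnd φ - (1 : K) • 1) ⊤ j) ∧
      Even (jordanCount (Sp.toEnd φ - (-1 : K) • 1) ⊤ j)) :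
    ∃ s : Sp f, s * s = -1 ∧ s * φ = φ⁻¹ * s := by
  obtain ⟨s, hs⟩ := (Sp.isIsometryPair φ).exists_isTwist_inverting h2 hf hf' hcond
  obtain ⟨σ, rfl⟩ := hs.exists_sp (by ring)
  refine ⟨σ, Sp.toEnd_injective (LinearMap.ext fun x => ?_),
    Sp.toEnd_injective (LinearMap.ext fun x => ?_)⟩
  · rw [Sp.toEnd_mul, Sp.toEnd_neg, Sp.toEnd_one, Module.End.mul_apply, hs.sq x trivial]
    simp
  · have := hs.apply_eq (by ring) x
    rw [one_smul] at this
    exact this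

theorem Sp.exists_neg_inverting [Finite K] (h2 : ringChar K ≠ 2) [NeZero (2 : K)] (hf : f.IsAlt)
    (hf' : f.Nondegenerate) (φ : Sp f) (hconj : IsConj φ (-φ⁻¹))
    (hcond : ∀ j, Odd j → (4 : ℤ) ∣ jordanCount (Sp.toEnd φ + Sp.toEnd φ⁻¹) ⊤ j) :
    ∃ s : Sp f, s * s = 1 ∧ s * φ = -(φ⁻¹ * s) := by
  obtain ⟨g, hg⟩ := isConj_iff.1 hconj
  have h1 : g * φ = -(φ⁻¹ * g) := by rw [← Sp.neg_mul, ← hg, inv_mul_cancel_right]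
  have h3 : g * φ⁻¹ = -(φ * g) := by
    have h4 : (g * φ * g⁻¹)⁻¹ = -φ := by
      rw [hg, inv_eq_iff_mul_eq_one, Sp.neg_mul, Sp.mul_neg, Sp.neg_neg, inv_mul_cancel]
    rw [mul_inv_rev, mul_inv_rev, inv_inv] at h4
    rw [← Sp.neg_mul, ← h4]
    group
  have h1' := congrArg Sp.toEnd h1
  have h3' := congrArg Sp.toEnd h3
  simp only [Sp.toEnd_mul, Sp.toEnd_neg] at h1' h3'
  obtain ⟨s, hs⟩ := (Sp.isIsometryPair φ).isSumDiff.exists_isTwist_of_conj h2 hf hf'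
    (Sp.isIsometryPair g)
    (by rw [mul_sub, sub_mul, h1', h3']; abel) (by rw [mul_add, add_mul, h1', h3']; abel) hcond
  obtain ⟨σ, rfl⟩ := hs.exists_sp (by ring)
  refine ⟨σ, Sp.toEnd_injective (LinearMap.ext fun x => ?_),
    Sp.toEnd_injective (LinearMap.ext fun x => ?_)⟩
  · rw [Sp.toEnd_mul, Sp.toEnd_one, Module.End.mul_apply, hs.sq x trivial]
    simp
  · have := hs.apply_eq rfl x
    rw [neg_one_smul] at this
    exact this

theorem Sp.even_jordanCount_of_inverting [NeZero (2 : K)] (hsq : ¬ IsSquare (-1 : K))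
    (hf : f.IsAlt) (hf' : f.Nondegenerate) {φ s : Sp f} (hs : s * φ = φ⁻¹ * s) {c : K}
    (hc : c * c = 1) {j : ℕ} (hj : Odd j) :
    Even (jordanCount (Sp.toEnd φ - c • 1) ⊤ j) := by
  have hs' : s * φ⁻¹ = φ * s := by
    rw [mul_inv_eq_iff_eq_mul, mul_assoc, hs, mul_inv_cancel_left]
  have h1 : ∀ x, Sp.toEnd s (Sp.toEnd φ x) = Sp.toEnd φ⁻¹ (Sp.toEnd s x) := fun x =>
    LinearMap.congr_fun (congrArg Sp.toEnd hs) x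
  have h2 : ∀ x, Sp.toEnd s (Sp.toEnd φ⁻¹ x) = Sp.toEnd φ (Sp.toEnd s x) := fun x =>
    LinearMap.congr_fun (congrArg Sp.toEnd hs') x
  have h := (Sp.isIsometryPair φ)
  have htop : IsNondegOn f (⊤ : Submodule K V) := isNondegOn_top hf'
  rw [← h.jordanCount_nilPart hf.isRefl hc htop (fun _ _ => Submodule.mem_top) fun _ _ => trivial]
  have hcφ := h.commute_sum (2 * c)
  have hφ₁ := IsIsometryPair.inv_of_commute hcφ.1 (W := ⊤) fun _ _ => trivial
  have hψ₁ := IsIsometryPair.inv_of_commute hcφ.2 (W := ⊤) fun _ _ => trivial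
  refine even_jordanCount_of_twist hsq hf h.isSumDiff.skew
    (nilPart_spec hf.isRefl (h.sub_smul_self c) htop fun _ _ => trivial).1
    (fun u hu => Submodule.sub_mem _ (hφ₁ u hu) (hψ₁ u hu))
    (IsIsometryPair.inv_of_commute ?_ fun _ _ => trivial) (fun u v => s.2 u v) (fun u => ?_) hj
  · refine LinearMap.ext fun x => ?_
    simp only [Module.End.mul_apply, LinearMap.sub_apply, LinearMap.add_apply,
      LinearMap.smul_apply, Module.End.one_apply, map_sub, map_add, map_smul, h1, h2]
    abel
  · simp only [LinearMap.sub_apply, map_sub, h1, h2]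
    abel

theorem Sp.four_dvd_jordanCount_of_neg_inverting [NeZero (2 : K)] (hsq : ¬ IsSquare (-1 : K))
    (hf : f.IsAlt) (hf' : f.Nondegenerate) {φ s : Sp f} (hs2 : s * s = 1 ∨ s * s = -1)
    (hs : s * φ = -(φ⁻¹ * s)) {j : ℕ} (hj : Odd j) :
    (4 : ℤ) ∣ jordanCount (Sp.toEnd φ + Sp.toEnd φ⁻¹) ⊤ j := by
  have hs' : s * φ⁻¹ = -(φ * s) := by
    rw [mul_inv_eq_iff_eq_mul, Sp.neg_mul, mul_assoc, hs, Sp.mul_neg, mul_inv_cancel_left,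
      Sp.neg_neg]
  have h1 : ∀ x, Sp.toEnd s (Sp.toEnd φ x) = - Sp.toEnd φ⁻¹ (Sp.toEnd s x) := fun x =>
    LinearMap.congr_fun (congrArg Sp.toEnd hs) x
  have h2 : ∀ x, Sp.toEnd s (Sp.toEnd φ⁻¹ x) = - Sp.toEnd φ (Sp.toEnd s x) := fun x =>
    LinearMap.congr_fun (congrArg Sp.toEnd hs') x
  obtain ⟨ε, hε, hsε⟩ : ∃ ε : K, (ε = 1 ∨ ε = -1) ∧ ∀ x, Sp.toEnd s (Sp.toEnd s x) = ε • x := by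
    rcases hs2 with h | h
    · refine ⟨1, Or.inl rfl, fun x => ?_⟩
      rw [one_smul]
      exact LinearMap.congr_fun (congrArg Sp.toEnd h) x
    · refine ⟨-1, Or.inr rfl, fun x => ?_⟩
      rw [neg_one_smul]
      exact LinearMap.congr_fun (congrArg Sp.toEnd h) x
  refine (Sp.isIsometryPair φ).isSumDiff.four_dvd_jordanCount hsq hf hf' hε (s := Sp.toEnd s)
    ⟨fun _ _ => trivial, fun u _ v _ => by rw [one_mul]; exact s.2 u v, fun u _ => hsε u, ?_⟩ hj
  rintro p (rfl | rfl) u -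
  · simp only [LinearMap.sub_apply, map_sub, h1, h2]
    module
  · simp only [LinearMap.add_apply, map_add, h1, h2]
    module

/-! ### The conditions in terms of elementary divisors -/

theorem Sp.elemDivMult_mul_natDegree (φ : Sp f) {p : K[X]} (hp : Irreducible p) (hpm : p.Monic)
    (j : ℕ) : (Sp.elemDivMult φ (p ^ (j + 1)) : ℤ) * p.natDegree =
      jordanCount (aeval (Sp.toEnd φ) p) ⊤ j :=
  (exists_isElementaryDivisors (Sp.toEnd φ)).choose_spec.count_mul_natDegree hp hpm j

theorem Sp.elemDivMult_X_sub_C (φ : Sp f) (c : K) (j : ℕ) :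
    (Sp.elemDivMult φ ((X - C c) ^ (j + 1)) : ℤ) = jordanCount (Sp.toEnd φ - c • 1) ⊤ j := by
  have h := Sp.elemDivMult_mul_natDegree φ (irreducible_X_sub_C c) (monic_X_sub_C c) j
  rw [natDegree_X_sub_C, Nat.cast_one, mul_one, map_sub, aeval_X, aeval_C,
    Algebra.algebraMap_eq_smul_one] at h
  exact h

theorem irreducible_X_sq_add_one (hsq : ¬ IsSquare (-1 : K)) : Irreducible (X ^ 2 + 1 : K[X]) := by
  have h : (X ^ 2 + 1 : K[X]) = X ^ 2 - C (-1) := by simp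
  rw [h]
  exact X_pow_sub_C_irreducible_of_prime Nat.prime_two fun b hb => hsq ⟨b, by rw [← hb, sq]⟩

theorem monic_X_sq_add_one : (X ^ 2 + 1 : K[X]).Monic := by
  simpa using monic_X_pow_add_C (1 : K) two_ne_zero

theorem natDegree_X_sq_add_one : (X ^ 2 + 1 : K[X]).natDegree = 2 := by
  simpa using natDegree_X_pow_add_C (n := 2) (r := (1 : K))

/-- `φ ^ 2 + 1` and `S = φ + φ⁻¹` differ by the invertible factor `φ`. -/
theorem Sp.elemDivMult_X_sq_add_one (hsq : ¬ IsSquare (-1 : K)) (φ : Sp f) (j : ℕ) :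
    (Sp.elemDivMult φ ((X ^ 2 + 1) ^ (j + 1)) : ℤ) * 2 =
      jordanCount (Sp.toEnd φ + Sp.toEnd φ⁻¹) ⊤ j := by
  have h := Sp.elemDivMult_mul_natDegree φ (irreducible_X_sq_add_one hsq) monic_X_sq_add_one j
  rw [natDegree_X_sq_add_one] at h
  have hφ := (Sp.isIsometryPair φ)
  have h1 : aeval (Sp.toEnd φ) (X ^ 2 + 1 : K[X]) =
      Sp.toEnd φ * (Sp.toEnd φ + Sp.toEnd φ⁻¹) := by
    rw [mul_add, hφ.mul_eq_one]
    simp [sq]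
  rw [h1, jordanCount_mul_of_injOn _ (fun _ _ => Submodule.mem_top)
    (fun _ _ => Submodule.mem_top)] at h
  · exact_mod_cast h
  · intro u _ h0
    rw [← hφ.apply_apply' u, h0, map_zero]
  · have h2 : Commute (Sp.toEnd φ) (Sp.toEnd φ⁻¹) := by
      rw [commute_iff_eq, hφ.mul_eq_one, hφ.mul_eq_one']
    exact (Commute.refl _).add_right h2

/-- If `φ` is conjugate to `-φ⁻¹`, its Jordan blocks for the eigenvalues `1` and `-1` agree. -/
theorem Sp.jordanCount_eq_of_isConj {φ : Sp f} (h : IsConj φ (-φ⁻¹)) (j : ℕ) :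
    jordanCount (Sp.toEnd φ - (1 : K) • 1) ⊤ j = jordanCount (Sp.toEnd φ - (-1 : K) • 1) ⊤ j := by
  obtain ⟨g, hg⟩ := isConj_iff.1 h
  have hφ := (Sp.isIsometryPair φ)
  have h1 : g * φ = -(φ⁻¹ * g) := by rw [← Sp.neg_mul, ← hg, inv_mul_cancel_right]
  have h1' : ∀ x, Sp.toEnd g (Sp.toEnd φ x) = - Sp.toEnd φ⁻¹ (Sp.toEnd g x) := fun x =>
    LinearMap.congr_fun (congrArg Sp.toEnd h1) x
  set A := Sp.toEnd φ - (1 : K) • 1 with hA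
  set B := (-Sp.toEnd φ⁻¹) * (Sp.toEnd φ - (-1 : K) • 1) with hB
  have hAB : ∀ k x, Sp.toEnd g ((A ^ k) x) = (B ^ k) (Sp.toEnd g x) := by
    have h0 : ∀ x, Sp.toEnd g (A x) = B (Sp.toEnd g x) := fun x => by
      simp only [hA, hB, Module.End.mul_apply, LinearMap.sub_apply, LinearMap.neg_apply,
        LinearMap.smul_apply, Module.End.one_apply, map_sub, map_smul, h1', hφ.apply_apply']
      module
    intro k
    induction k with
    | zero => simp
    | succ k ih => intro x; rw [pow_succ, Module.End.mul_apply, ih, h0, pow_succ]; rfl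
  have hr : ∀ k, Module.finrank K ((⊤ : Submodule K V).map (A ^ k)) =
      Module.finrank K ((⊤ : Submodule K V).map (B ^ k)) := fun k => by
    rw [Submodule.map_top, Submodule.map_top]
    exact finrank_range_of_conj (g : V ≃ₗ[K] V) (hAB k)
  have hj : jordanCount A ⊤ j = jordanCount B ⊤ j := by simp only [jordanCount, hr]
  rw [hj, hB]
  refine jordanCount_mul_of_injOn ?_ (fun _ _ => Submodule.mem_top)
    (fun _ _ => Submodule.mem_top) ?_ j
  · have h2 : Commute (Sp.toEnd φ⁻¹) (Sp.toEnd φ) := by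
      rw [commute_iff_eq, hφ.mul_eq_one, hφ.mul_eq_one']
    exact (h2.sub_right ((Commute.one_right _).smul_right _)).neg_left
  · intro u _ h0
    rw [LinearMap.neg_apply, neg_eq_zero] at h0
    rw [← hφ.apply_apply u, h0, map_zero]

/-- If some isometry inverts `φ`, the multiplicities of `(x ± 1) ^ (2 t)` are even, so there is also
an inverting isometry of square `-1`. Hence a reversible image that is not bireflectional requires
`φ` to be conjugate to `-φ⁻¹`; given this, each of the two odd multiplicities rules out one of the
two kinds of `s` with `s ^ 2 = ±1`, and is the only obstruction to it. -/
theorem Sp.isReversible_and_not_isBireflectional_iff [Finite K] (h2 : ringChar K ≠ 2)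
    [NeZero (2 : K)]
    (hsq : ¬ IsSquare (-1 : K)) (hf : f.IsAlt) (hf' : f.Nondegenerate) (φ : Sp f) :
    (IsReversible (Sp.toPSp φ) ∧ ¬ IsBireflectional (Sp.toPSp φ)) ↔
      (IsConj φ (-φ⁻¹) ∧
        (∃ t : ℕ, 1 ≤ t ∧ Odd (Sp.elemDivMult φ ((X ^ 2 + 1) ^ (2 * t)))) ∧
        (∃ t : ℕ, 1 ≤ t ∧ Odd (Sp.elemDivMult φ ((X - 1) ^ (2 * t))))) := by
  have hX1 : (X - 1 : K[X]) = X - C 1 := by rw [C_1]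
  have hmult1 := fun j => Sp.elemDivMult_X_sub_C φ (1 : K) j
  have hmult2 := fun j => Sp.elemDivMult_X_sq_add_one hsq φ j
  rw [hX1, Sp.isReversible_toPSp_iff, Sp.isBireflectional_toPSp_iff]
  constructor
  · rintro ⟨hrev, hbi⟩
    push Not at hbi
    have hnot : ¬ ∀ j, Odd j → Even (jordanCount (Sp.toEnd φ - (1 : K) • 1) ⊤ j) ∧
        Even (jordanCount (Sp.toEnd φ - (-1 : K) • 1) ⊤ j) := fun hc => by
      obtain ⟨s, hs, hs'⟩ := Sp.exists_inverting h2 hf hf' φ (Or.inr hc)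
      exact (hbi s (Or.inr hs)).1 hs'
    have hconj : IsConj φ (-φ⁻¹) := by
      refine hrev.resolve_left fun hc => hnot fun j hj => ?_
      obtain ⟨s, hs⟩ := isConj_iff.1 hc
      have hs : s * φ = φ⁻¹ * s := by rw [← hs, inv_mul_cancel_right]
      exact ⟨Sp.even_jordanCount_of_inverting hsq hf hf' hs (by ring) hj,
        Sp.even_jordanCount_of_inverting hsq hf hf' hs (by ring) hj⟩
    refine ⟨hconj, ?_, ?_⟩
    · by_contra! hc
      obtain ⟨s, hs, hs'⟩ := Sp.exists_neg_inverting h2 hf hf' φ hconj fun j hj => by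
        obtain ⟨t, rfl⟩ := hj
        have h3 := hc (t + 1) (by omega)
        rw [Nat.not_odd_iff_even] at h3
        rw [← hmult2, show 2 * t + 1 + 1 = 2 * (t + 1) by ring]
        obtain ⟨m, hm⟩ := h3
        rw [hm]
        exact ⟨m, by push_cast; ring⟩
      exact (hbi s (Or.inl hs)).2 hs'
    · by_contra! hc
      refine hnot fun j hj => ?_
      rw [← Sp.jordanCount_eq_of_isConj hconj, and_self]
      obtain ⟨t, rfl⟩ := hj
      have h3 := hc (t + 1) (by omega)
      rw [Nat.not_odd_iff_even] at h3
      rw [← hmult1, show 2 * t + 1 + 1 = 2 * (t + 1) by ring]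
      exact_mod_cast h3
  · rintro ⟨hconj, ⟨t₂, ht₂, ho₂⟩, ⟨t₁, ht₁, ho₁⟩⟩
    refine ⟨Or.inr hconj, ?_⟩
    obtain ⟨t₁, rfl⟩ := Nat.exists_eq_add_of_le' ht₁
    obtain ⟨t₂, rfl⟩ := Nat.exists_eq_add_of_le' ht₂
    rintro ⟨s, hs2, hs | hs⟩
    · have h3 := Sp.even_jordanCount_of_inverting hsq hf hf' hs (c := 1) (by ring)
        (j := 2 * t₁ + 1) ⟨t₁, rfl⟩
      rw [← hmult1, show 2 * t₁ + 1 + 1 = 2 * (t₁ + 1) by ring, Int.even_coe_nat] at h3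
      exact Nat.not_even_iff_odd.2 ho₁ h3
    · have h3 := Sp.four_dvd_jordanCount_of_neg_inverting hsq hf hf' hs2 hs
        (j := 2 * t₂ + 1) ⟨t₂, rfl⟩
      rw [← hmult2, show 2 * t₂ + 1 + 1 = 2 * (t₂ + 1) by ring] at h3
      obtain ⟨m, hm⟩ := ho₂
      omega

open Classical in
/-- As `(x + 1) ^ (2 t₁)` occurs together with `(x - 1) ^ (2 t₁)`, there are three different
elementary divisors, of degrees at least `4`, `2`, `2`. -/
theorem Sp.eight_le_finrank [NeZero (2 : K)] (hsq : ¬ IsSquare (-1 : K)) {φ : Sp f}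
    (hconj : IsConj φ (-φ⁻¹)) {t₁ t₂ : ℕ} (h₁ : 1 ≤ t₁) (h₂ : 1 ≤ t₂)
    (ho₁ : Odd (Sp.elemDivMult φ ((X - 1) ^ (2 * t₁))))
    (ho₂ : Odd (Sp.elemDivMult φ ((X ^ 2 + 1) ^ (2 * t₂)))) : 8 ≤ Module.finrank K V := by
  have hX1 : (X - 1 : K[X]) = X - C 1 := by rw [C_1]
  rw [hX1] at ho₁
  have h3 : Sp.elemDivMult φ ((X - C (-1)) ^ (2 * t₁)) =
      Sp.elemDivMult φ ((X - C 1) ^ (2 * t₁)) := by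
    obtain ⟨t, rfl⟩ := Nat.exists_eq_add_of_le' h₁
    have h4 := Sp.elemDivMult_X_sub_C φ (1 : K) (2 * t + 1)
    rw [Sp.jordanCount_eq_of_isConj hconj, ← Sp.elemDivMult_X_sub_C] at h4
    exact_mod_cast h4.symm
  have hS := (exists_isElementaryDivisors (Sp.toEnd φ)).choose_spec
  set E := (exists_isElementaryDivisors (Sp.toEnd φ)).choose
  have hmem : ∀ d, Odd (Sp.elemDivMult φ d) → d ∈ E := fun d hd =>
    Multiset.count_pos.1 hd.pos
  have hdeg : ∀ (c : K), ((X - C c) ^ (2 * t₁)).natDegree = 2 * t₁ := fun c => by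
    rw [natDegree_pow, natDegree_X_sub_C, mul_one]
  have hdeg' : ((X ^ 2 + 1 : K[X]) ^ (2 * t₂)).natDegree = 2 * t₂ * 2 := by
    rw [natDegree_pow, natDegree_X_sq_add_one]
  have hne : (X - C (1 : K)) ^ (2 * t₁) ≠ (X - C (-1)) ^ (2 * t₁) := fun h => by
    have h4 := congrArg (eval 1) h
    simp only [eval_pow, eval_sub, eval_X, eval_C, sub_self] at h4
    rw [zero_pow (by omega)] at h4
    have h5 := pow_eq_zero_iff (by omega) |>.1 h4.symm
    have h6 : (2 : K) = 0 := by linear_combination h5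
    exact NeZero.ne (2 : K) h6
  have hne' : ∀ c : K, (X ^ 2 + 1) ^ (2 * t₂) ≠ (X - C c) ^ (2 * t₁) := fun c h => by
    have h4 := congrArg (eval c) h
    simp only [eval_pow, eval_sub, eval_X, eval_C, sub_self, eval_add, eval_one] at h4
    rw [zero_pow (by omega)] at h4
    have h5 := pow_eq_zero_iff (by omega) |>.1 h4
    exact hsq ⟨c, by linear_combination -h5⟩
  have hle : ({(X ^ 2 + 1) ^ (2 * t₂), (X - C (1 : K)) ^ (2 * t₁), (X - C (-1)) ^ (2 * t₁)} :
      Finset K[X]).val ≤ E := by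
    rw [Finset.val_le_iff_val_subset]
    intro d hd
    simp only [Finset.mem_val, Finset.mem_insert, Finset.mem_singleton] at hd
    rcases hd with rfl | rfl | rfl
    · exact hmem _ ho₂
    · exact hmem _ ho₁
    · exact hmem _ (h3 ▸ ho₁)
  obtain ⟨R, hR⟩ := Multiset.le_iff_exists_add.1 hle
  rw [← hS.sum_natDegree, hR, Multiset.map_add, Multiset.sum_add]
  refine le_trans ?_ (Nat.le_add_right _ _)
  change 8 ≤ ∑ d ∈ ({(X ^ 2 + 1) ^ (2 * t₂), (X - C (1 : K)) ^ (2 * t₁),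
    (X - C (-1)) ^ (2 * t₁)} : Finset K[X]), d.natDegree
  rw [Finset.sum_insert (by
      rw [Finset.mem_insert, Finset.mem_singleton, not_or]; exact ⟨hne' 1, hne' (-1)⟩),
    Finset.sum_insert (by rw [Finset.mem_singleton]; exact hne),
    Finset.sum_singleton, hdeg, hdeg, hdeg']
  omega

end ProjectiveSymplectic

/-! ### An element that is reversible but not bireflectional in dimension at least eight -/

section Example

variable {K V : Type*} [Field K] [AddCommGroup V] [Module K V] {f : LinearMap.BilinForm K V}

theorem jordanCount_congr {S T : Module.End K V} {W : Submodule K V} (hT : ∀ u ∈ W, T u ∈ W)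
    (h : ∀ u ∈ W, S u = T u) (j : ℕ) : jordanCount S W j = jordanCount T W j := by
  have hk : ∀ k, ∀ u ∈ W, (S ^ k) u = (T ^ k) u := fun k => by
    induction k with
    | zero => simp
    | succ k ih =>
      intro u hu
      rw [pow_succ, Module.End.mul_apply, pow_succ, Module.End.mul_apply, h u hu, ih _ (hT u hu)]
  have hm : ∀ k, W.map (S ^ k) = W.map (T ^ k) := fun k =>
    SetLike.coe_injective (Set.image_congr (hk k))
  rw [jordanCount, jordanCount, hm j, hm (j + 1), hm (j + 2)]

/-- On the subspace `W`, `φ` and `g` are isometries with `φ g φ = -g`; moreover `φ` has `a` Jordan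
blocks of size two for the eigenvalue `1`, and `φ ^ 2 + 1` has `b` Jordan blocks of size two for the
eigenvalue `0`. -/
structure IsNegInvertingPair (f : LinearMap.BilinForm K V) (W : Submodule K V) (a b : ℤ)
    (φ g : Module.End K V) : Prop where
  mapsTo : ∀ u ∈ W, φ u ∈ W
  mapsTo' : ∀ u ∈ W, g u ∈ W
  form : ∀ u ∈ W, ∀ v ∈ W, f (φ u) (φ v) = f u v
  form' : ∀ u ∈ W, ∀ v ∈ W, f (g u) (g v) = f u v
  rel : ∀ u ∈ W, φ (g (φ u)) = -g u
  count_sub_one : jordanCount (φ - (1 : K) • 1) W 1 = a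
  count_sq_add_one : jordanCount (φ * φ + 1) W 1 = b

theorem IsNegInvertingPair.glue [FiniteDimensional K V] (hf : f.IsRefl) {W₁ W : Submodule K V}
    (hW₁ : IsNondegOn f W₁) (hle : W₁ ≤ W) {a₁ b₁ a₂ b₂ : ℤ} {φ₁ g₁ φ₂ g₂ : Module.End K V}
    (h₁ : IsNegInvertingPair f W₁ a₁ b₁ φ₁ g₁)
    (h₂ : IsNegInvertingPair f (W ⊓ f.orthogonal W₁) a₂ b₂ φ₂ g₂) :
    ∃ φ g, IsNegInvertingPair f W (a₁ + a₂) (b₁ + b₂) φ g := by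
  have hsup := hW₁.sup_compl hf hle
  have hdis := hW₁.disjoint_compl hf W
  set W₂ := W ⊓ f.orthogonal W₁ with hW₂
  have hc := hW₁.isCompl hf
  let P : Module.End K V := W₁.subtype ∘ₗ Submodule.projectionOnto _ _ hc
  have hP1 : ∀ x ∈ W₁, P x = x := fun x hx => by
    simpa [P] using congrArg Subtype.val (Submodule.projectionOnto_apply_left hc ⟨x, hx⟩)
  have hP2 : ∀ x ∈ W₂, P x = 0 := fun x hx => by
    simpa [P] using (Submodule.projectionOnto_apply_eq_zero_iff hc).2 hx.2
  have key : ∀ s₁ s₂ : Module.End K V, ∃ s : Module.End K V,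
      (∀ x ∈ W₁, s x = s₁ x) ∧ ∀ x ∈ W₂, s x = s₂ x := fun s₁ s₂ =>
    ⟨s₁ ∘ₗ P + s₂ ∘ₗ (LinearMap.id - P), fun x hx => by simp [hP1 x hx],
      fun x hx => by simp [hP2 x hx]⟩
  obtain ⟨φ, hφ1, hφ2⟩ := key φ₁ φ₂
  obtain ⟨g, hg1, hg2⟩ := key g₁ g₂
  have hmem : ∀ x, x ∈ W ↔ ∃ y ∈ W₁, ∃ z ∈ W₂, y + z = x := fun x => by
    rw [← hsup, Submodule.mem_sup]
  have horth : ∀ y ∈ W₁, ∀ z ∈ W₂, f y z = 0 := fun y hy z hz => hz.2 y hy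
  have hform : ∀ (s s₁ s₂ : Module.End K V), (∀ x ∈ W₁, s x = s₁ x) → (∀ x ∈ W₂, s x = s₂ x) →
      (∀ x ∈ W₁, s₁ x ∈ W₁) → (∀ x ∈ W₂, s₂ x ∈ W₂) →
      (∀ u ∈ W₁, ∀ v ∈ W₁, f (s₁ u) (s₁ v) = f u v) →
      (∀ u ∈ W₂, ∀ v ∈ W₂, f (s₂ u) (s₂ v) = f u v) →
      ∀ u ∈ W, ∀ v ∈ W, f (s u) (s v) = f u v := by
    intro s s₁ s₂ hs1 hs2 hm1 hm2 hf1 hf2 u hu v hv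
    obtain ⟨y, hy, z, hz, rfl⟩ := (hmem u).1 hu
    obtain ⟨y', hy', z', hz', rfl⟩ := (hmem v).1 hv
    simp only [map_add, hs1 y hy, hs2 z hz, hs1 y' hy', hs2 z' hz', LinearMap.add_apply]
    rw [hf1 y hy y' hy', hf2 z hz z' hz', horth _ hy _ hz', hf _ _ (horth _ hy' _ hz),
      horth _ (hm1 y hy) _ (hm2 z' hz'), hf _ _ (horth _ (hm1 y' hy') _ (hm2 z hz))]
  have hmap : ∀ (s s₁ s₂ : Module.End K V), (∀ x ∈ W₁, s x = s₁ x) → (∀ x ∈ W₂, s x = s₂ x) →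
      (∀ x ∈ W₁, s₁ x ∈ W₁) → (∀ x ∈ W₂, s₂ x ∈ W₂) → ∀ u ∈ W, s u ∈ W := by
    intro s s₁ s₂ hs1 hs2 hm1 hm2 u hu
    obtain ⟨y, hy, z, hz, rfl⟩ := (hmem u).1 hu
    rw [map_add, hs1 y hy, hs2 z hz]
    exact (hmem _).2 ⟨_, hm1 y hy, _, hm2 z hz, rfl⟩
  have hcount : ∀ (s s₁ s₂ : Module.End K V) (c d : ℤ), (∀ x ∈ W₁, s x = s₁ x) →
      (∀ x ∈ W₂, s x = s₂ x) → (∀ x ∈ W₁, s₁ x ∈ W₁) → (∀ x ∈ W₂, s₂ x ∈ W₂) →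
      jordanCount s₁ W₁ 1 = c → jordanCount s₂ W₂ 1 = d → jordanCount s W 1 = c + d := by
    intro s s₁ s₂ c d hs1 hs2 hm1 hm2 hc hd
    rw [← hsup, jordanCount_sup hdis (fun u hu => by rw [hs1 u hu]; exact hm1 u hu)
      (fun u hu => by rw [hs2 u hu]; exact hm2 u hu), jordanCount_congr hm1 hs1,
      jordanCount_congr hm2 hs2, hc, hd]
  refine ⟨φ, g, hmap φ φ₁ φ₂ hφ1 hφ2 h₁.mapsTo h₂.mapsTo,
    hmap g g₁ g₂ hg1 hg2 h₁.mapsTo' h₂.mapsTo',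
    hform φ φ₁ φ₂ hφ1 hφ2 h₁.mapsTo h₂.mapsTo h₁.form h₂.form,
    hform g g₁ g₂ hg1 hg2 h₁.mapsTo' h₂.mapsTo' h₁.form' h₂.form', fun u hu => ?_,
    hcount _ (φ₁ - (1 : K) • 1) (φ₂ - (1 : K) • 1) _ _ (fun x hx => ?_) (fun x hx => ?_)
      (fun x hx => ?_) (fun x hx => ?_) h₁.count_sub_one h₂.count_sub_one,
    hcount _ (φ₁ * φ₁ + 1) (φ₂ * φ₂ + 1) _ _ (fun x hx => ?_) (fun x hx => ?_)
      (fun x hx => ?_) (fun x hx => ?_) h₁.count_sq_add_one h₂.count_sq_add_one⟩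
  · obtain ⟨y, hy, z, hz, rfl⟩ := (hmem u).1 hu
    simp only [map_add]
    rw [hφ1 y hy, hφ2 z hz, hg1 _ (h₁.mapsTo y hy), hg2 _ (h₂.mapsTo z hz),
      hφ1 _ (h₁.mapsTo' _ (h₁.mapsTo y hy)), hφ2 _ (h₂.mapsTo' _ (h₂.mapsTo z hz)), h₁.rel y hy,
      h₂.rel z hz, hg1 y hy, hg2 z hz, neg_add]
  · simp [hφ1 x hx]
  · simp [hφ2 x hx]
  · exact W₁.sub_mem (h₁.mapsTo x hx) (W₁.smul_mem _ hx)
  · exact W₂.sub_mem (h₂.mapsTo x hx) (W₂.smul_mem _ hx)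
  · simp [hφ1 x hx, hφ1 _ (h₁.mapsTo x hx)]
  · simp [hφ2 x hx, hφ2 _ (h₂.mapsTo x hx)]
  · exact W₁.add_mem (h₁.mapsTo _ (h₁.mapsTo x hx)) hx
  · exact W₂.add_mem (h₂.mapsTo _ (h₂.mapsTo x hx)) hx

/-- `(w 0, w 1)` and `(w 2, w 3)` are mutually orthogonal hyperbolic pairs. -/
structure IsHyperbolicQuadruple (f : LinearMap.BilinForm K V) (w : Fin 4 → V) : Prop where
  h01 : f (w 0) (w 1) = 1
  h23 : f (w 2) (w 3) = 1
  h02 : f (w 0) (w 2) = 0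
  h03 : f (w 0) (w 3) = 0
  h12 : f (w 1) (w 2) = 0
  h13 : f (w 1) (w 3) = 0

theorem IsHyperbolicQuadruple.isNondegOn (hf : f.IsAlt) {w : Fin 4 → V}
    (h : IsHyperbolicQuadruple f w) : IsNondegOn f (Submodule.span K (Set.range w)) := by
  have hs : ∀ x y, f x y = 0 → f y x = 0 := hf.isRefl
  have h10 : f (w 1) (w 0) = -1 := by rw [← hf.neg_eq, h.h01]
  have h32 : f (w 3) (w 2) = -1 := by rw [← hf.neg_eq, h.h23]
  refine isNondegOn_span_of_dual w fun k => Or.inr ?_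
  fin_cases k
  · refine ⟨1, by simp [h.h01], fun j hj => ?_⟩
    fin_cases j
    exacts [absurd rfl hj, hf _, hs _ _ h.h12, hs _ _ h.h13]
  · refine ⟨0, by simp [h10], fun j hj => ?_⟩
    fin_cases j
    exacts [hf _, absurd rfl hj, hs _ _ h.h02, hs _ _ h.h03]
  · refine ⟨3, by simp [h.h23], fun j hj => ?_⟩
    fin_cases j
    exacts [h.h03, h.h13, absurd rfl hj, hf _]
  · refine ⟨2, by simp [h32], fun j hj => ?_⟩
    fin_cases j
    exacts [h.h02, h.h12, hf _, absurd rfl hj]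

/-- An isometry of the span of a hyperbolic quadruple is given by another quadruple in it. -/
theorem IsHyperbolicQuadruple.exists_isometry (hf : f.IsAlt) {w w' : Fin 4 → V}
    (h : IsHyperbolicQuadruple f w) (h' : IsHyperbolicQuadruple f w')
    (hmem : ∀ i, w' i ∈ Submodule.span K (Set.range w)) :
    ∃ s : Module.End K V, (∀ i, s (w i) = w' i) ∧
      (∀ u ∈ Submodule.span K (Set.range w), s u ∈ Submodule.span K (Set.range w)) ∧
      ∀ u ∈ Submodule.span K (Set.range w), ∀ v ∈ Submodule.span K (Set.range w),
        f (s u) (s v) = f u v := by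
  have hgram : ∀ i j, f (w' i) (w' j) = 1 * f (w i) (w j) := by
    have hs : ∀ {x y : V} {c : K}, f x y = c → f y x = -c := fun {x y c} hxy => by
      rw [← hxy, hf.neg_eq]
    intro i j
    rw [one_mul]
    fin_cases i <;> fin_cases j
    · exact (hf _).trans (hf _).symm
    · exact h'.h01.trans h.h01.symm
    · exact h'.h02.trans h.h02.symm
    · exact h'.h03.trans h.h03.symm
    · exact (hs h'.h01).trans (hs h.h01).symm
    · exact (hf _).trans (hf _).symm
    · exact h'.h12.trans h.h12.symm
    · exact h'.h13.trans h.h13.symm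
    · exact (hs h'.h02).trans (hs h.h02).symm
    · exact (hs h'.h12).trans (hs h.h12).symm
    · exact (hf _).trans (hf _).symm
    · exact h'.h23.trans h.h23.symm
    · exact (hs h'.h03).trans (hs h.h03).symm
    · exact (hs h'.h13).trans (hs h.h13).symm
    · exact (hs h'.h23).trans (hs h.h23).symm
    · exact (hf _).trans (hf _).symm
  obtain ⟨s, hs⟩ := exists_linearMap_of_gram w w' 1 (h'.isNondegOn hf) hgram
  refine ⟨s, hs, fun u hu => ?_, fun u hu v hv => ?_⟩
  · refine (Submodule.span_le (p := (Submodule.span K (Set.range w)).comap s)).2 ?_ hu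
    rintro _ ⟨i, rfl⟩
    change s (w i) ∈ Submodule.span K (Set.range w)
    rw [hs]
    exact hmem i
  · rw [form_eq_on_span w 1 s (fun i j => by rw [hs, hs, hgram]) u hu v hv, one_mul]

theorem IsNondegOn.exists_hyperbolic_pair {W : Submodule K V} (hW : IsNondegOn f W) (h0 : W ≠ ⊥) :
    ∃ x ∈ W, ∃ y ∈ W, f x y = 1 := by
  obtain ⟨x, hx, hx0⟩ := W.ne_bot_iff.1 h0
  obtain ⟨y, hy, hxy⟩ : ∃ y ∈ W, f x y ≠ 0 := by
    by_contra! hc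
    exact hx0 (hW x hx hc)
  exact ⟨x, hx, (f x y)⁻¹ • y, W.smul_mem _ hy, by
    rw [map_smul, smul_eq_mul, inv_mul_cancel₀ hxy]⟩

theorem IsNondegOn.exists_hyperbolicQuadruple [FiniteDimensional K V] (hf : f.IsAlt)
    {W : Submodule K V} (hW : IsNondegOn f W) (h4 : 4 ≤ Module.finrank K W) :
    ∃ w : Fin 4 → V, IsHyperbolicQuadruple f w ∧ ∀ i, w i ∈ W := by
  obtain ⟨x, hx, y, hy, hxy⟩ := hW.exists_hyperbolic_pair (by rintro rfl; simp at h4)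
  have hyx : f y x = -1 := by rw [← hf.neg_eq, hxy]
  have hnd : IsNondegOn f (Submodule.span K (Set.range ![x, y])) := by
    refine isNondegOn_span_of_dual _ fun k => Or.inr ?_
    fin_cases k
    · refine ⟨1, by simp [hxy], fun j hj => ?_⟩
      fin_cases j
      exacts [absurd rfl hj, hf _]
    · refine ⟨0, by simp [hyx], fun j hj => ?_⟩
      fin_cases j
      exacts [hf _, absurd rfl hj]
  have hle : Submodule.span K (Set.range ![x, y]) ≤ W := by
    rw [Submodule.span_le]
    rintro _ ⟨i, rfl⟩
    fin_cases i
    exacts [hx, hy]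
  have hW' := hnd.compl hf.isRefl hW hle
  have hsup := hnd.sup_compl hf.isRefl hle
  have hr := finrank_range_le_card (R := K) ![x, y]
  rw [Fintype.card_fin] at hr
  obtain ⟨x', hx', y', hy', hxy'⟩ := hW'.exists_hyperbolic_pair fun h => by
    rw [h, sup_bot_eq] at hsup
    rw [Set.finrank, hsup] at hr
    omega
  have ho : ∀ i, ∀ z ∈ W ⊓ f.orthogonal (Submodule.span K (Set.range ![x, y])),
      f (![x, y] i) z = 0 := fun i z hz => hz.2 _ (Submodule.subset_span ⟨i, rfl⟩)
  refine ⟨![x, y, x', y'], ⟨hxy, hxy', ho 0 _ hx', ho 0 _ hy', ho 1 _ hx', ho 1 _ hy'⟩, fun i => ?_⟩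
  fin_cases i
  exacts [hx, hy, hx'.1, hy'.1]

theorem eqOn_span_range {ι : Type*} {w : ι → V} {S T : Module.End K V}
    (h : ∀ i, S (w i) = T (w i)) : ∀ u ∈ Submodule.span K (Set.range w), S u = T u := by
  refine fun u hu => LinearMap.eqOn_span (f := S) (g := T) ?_ hu
  rintro _ ⟨i, rfl⟩
  exact h i

theorem eq_zero_of_apply_eq_smul {Q : Module.End K V} {u : V} {c : K} (hc : c ≠ 0)
    (h : Q u = c • u) (h0 : Q (Q u) = 0) : u = 0 := by
  rw [h, map_smul, h, smul_smul] at h0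
  exact (smul_eq_zero.1 h0).resolve_left (mul_ne_zero hc hc)

/-- Here `φ` acts as a transvection on the first hyperbolic plane and as the negative of a
transvection on the second, and `g` exchanges the two planes. -/
theorem IsHyperbolicQuadruple.exists_isNegInvertingPair_one_zero [FiniteDimensional K V]
    [NeZero (2 : K)] (hf : f.IsAlt) {w : Fin 4 → V} (h : IsHyperbolicQuadruple f w) :
    ∃ φ g, IsNegInvertingPair f (Submodule.span K (Set.range w)) 1 0 φ g := by
  have h2 : (2 : K) ≠ 0 := NeZero.ne 2
  have hs : ∀ {x y : V} {c : K}, f x y = c → f y x = -c := fun {x y c} hxy => by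
    rw [← hxy, hf.neg_eq]
  have hm : ∀ i, w i ∈ Submodule.span K (Set.range w) := fun i => Submodule.subset_span ⟨i, rfl⟩
  obtain ⟨φ, hφ, hφm, hφf⟩ := h.exists_isometry hf (w' := ![w 0, w 1 + w 0, -w 2, -w 3 + w 2])
    (by constructor <;> simp [h.h01, h.h23, h.h02, h.h03, h.h12, h.h13, hf.self_eq_zero])
    (fun i => by
      fin_cases i
      exacts [hm 0, add_mem (hm 1) (hm 0), neg_mem (hm 2), add_mem (neg_mem (hm 3)) (hm 2)])
  obtain ⟨g, hg, hgm, hgf⟩ := h.exists_isometry hf (w' := ![w 2, w 3, w 0, w 1])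
    ⟨h.h23, h.h01, by simpa using hs h.h02, by simpa using hs h.h12, by simpa using hs h.h03,
      by simpa using hs h.h13⟩
    (fun i => by fin_cases i; exacts [hm 2, hm 3, hm 0, hm 1])
  have p0 : φ (w 0) = w 0 := hφ 0
  have p1 : φ (w 1) = w 1 + w 0 := hφ 1
  have p2 : φ (w 2) = -w 2 := hφ 2
  have p3 : φ (w 3) = -w 3 + w 2 := hφ 3
  have g0 : g (w 0) = w 2 := hg 0
  have g1 : g (w 1) = w 3 := hg 1
  have g2 : g (w 2) = w 0 := hg 2
  have g3 : g (w 3) = w 1 := hg 3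
  refine ⟨φ, g, hφm, hgm, hφf, hgf, ?_, ?_, ?_⟩
  · refine eqOn_span_range (S := φ * g * φ) (T := -g) fun i => ?_
    fin_cases i <;> simp [p0, p1, p2, p3, g0, g1, g2, g3]
  · have hsplit : Submodule.span K (Set.range w) =
        Submodule.span K {w 0, w 1} ⊔ Submodule.span K {w 2, w 3} := by
      rw [← Submodule.span_union]
      congr 1
      ext x
      simp only [Set.mem_range, Fin.exists_fin_succ, Set.mem_union, Set.mem_insert_iff,
        Set.mem_singleton_iff, eq_comm (a := x)]
      simp
      tauto
    have hdis : Disjoint (Submodule.span K {w 0, w 1}) (Submodule.span K {w 2, w 3}) := by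
      rw [Submodule.disjoint_def]
      intro u hu hu'
      obtain ⟨a, b, rfl⟩ := Submodule.mem_span_pair.1 hu
      obtain ⟨c, d, hcd⟩ := Submodule.mem_span_pair.1 hu'
      have e1 := congrArg (f · (w 0)) hcd
      have e2 := congrArg (f · (w 1)) hcd
      simp [h.h01, hs h.h01, hs h.h02, hs h.h03, hs h.h12, hs h.h13, hf.self_eq_zero] at e1 e2
      simp [e1, ← e2]
    have inv1 : ∀ u ∈ Submodule.span K {w 0, w 1},
        (φ - (1 : K) • 1) u ∈ Submodule.span K {w 0, w 1} := by
      intro u hu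
      obtain ⟨a, b, rfl⟩ := Submodule.mem_span_pair.1 hu
      exact Submodule.mem_span_pair.2 ⟨b, 0, by simp [p0, p1]⟩
    have inv2 : ∀ u ∈ Submodule.span K {w 2, w 3},
        (φ - (1 : K) • 1) u ∈ Submodule.span K {w 2, w 3} := by
      intro u hu
      obtain ⟨a, b, rfl⟩ := Submodule.mem_span_pair.1 hu
      exact Submodule.mem_span_pair.2 ⟨-2 * a + b, -2 * b, by simp [p2, p3]; module⟩
    rw [hsplit, jordanCount_sup hdis inv1 inv2, jordanCount_eq_zero_of_injOn inv2,
      jordanCount_of_pow_eq_zero, add_zero]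
    · have hmap : (Submodule.span K {w 0, w 1}).map ((φ - (1 : K) • 1) ^ 1) =
          Submodule.span K {w 0} := by
        rw [Submodule.map_span, Set.image_pair]
        simp [p0, p1]
      rw [hmap, finrank_span_singleton, Nat.cast_one]
      intro h0
      have := h.h01
      simp [h0] at this
    · intro u hu
      obtain ⟨a, b, rfl⟩ := Submodule.mem_span_pair.1 hu
      simp [pow_succ, p0, p1]
    · intro u hu h0
      obtain ⟨a, b, rfl⟩ := Submodule.mem_span_pair.1 hu
      refine eq_zero_of_apply_eq_smul (Q := φ + 1) h2 ?_ (by simp [p2, p3]; abel)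
      have h1 : φ (a • w 2 + b • w 3) = a • w 2 + b • w 3 := by
        simpa [sub_eq_zero] using h0
      rw [LinearMap.add_apply, h1, Module.End.one_apply, two_smul]
  · refine jordanCount_eq_zero_of_injOn (fun u hu => add_mem (hφm _ (hφm u hu)) hu)
      (fun u hu h0 => ?_) 1
    refine eq_zero_of_apply_eq_smul (Q := φ * φ - 1) (neg_ne_zero.2 h2) ?_ ?_
    · have h1 : φ (φ u) = -u := eq_neg_of_add_eq_zero_left h0
      rw [LinearMap.sub_apply, Module.End.mul_apply, h1, Module.End.one_apply]
      module
    · refine eqOn_span_range (S := (φ * φ - 1) * (φ * φ - 1)) (T := 0) (fun i => ?_) u hu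
      fin_cases i <;> simp [p0, p1, p2, p3]
      abel

/-- Here `φ` exchanges the two hyperbolic planes and satisfies `(φ ^ 2 + 1) ^ 2 = 0`, and `g` mixes
the planes by a similitude `[[a, b], [-b, a]]` whose multiplier `a ^ 2 + b ^ 2 = -1` is compensated
by a sign on `w 1` and `w 3`. -/
theorem IsHyperbolicQuadruple.exists_isNegInvertingPair_zero_two [FiniteDimensional K V]
    [NeZero (2 : K)] (hf : f.IsAlt) {w : Fin 4 → V} (h : IsHyperbolicQuadruple f w) {a b : K}
    (hab : a ^ 2 + b ^ 2 = -1) :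
    ∃ φ g, IsNegInvertingPair f (Submodule.span K (Set.range w)) 0 2 φ g := by
  have h2 : (2 : K) ≠ 0 := NeZero.ne 2
  have hs : ∀ {x y : V} {c : K}, f x y = c → f y x = -c := fun {x y c} hxy => by
    rw [← hxy, hf.neg_eq]
  have hm : ∀ i, w i ∈ Submodule.span K (Set.range w) := fun i => Submodule.subset_span ⟨i, rfl⟩
  obtain ⟨φ, hφ, hφm, hφf⟩ := h.exists_isometry hf
    (w' := ![w 2, w 3 + w 2, -w 0, -w 1 - w 0])
    (by constructor <;> simp [h.h01, h.h23, hs h.h02, hs h.h03,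
      hs h.h12, hs h.h13, hf.self_eq_zero])
    (fun i => by
      fin_cases i
      exacts [hm 2, add_mem (hm 3) (hm 2), neg_mem (hm 0), sub_mem (neg_mem (hm 1)) (hm 0)])
  obtain ⟨g, hg, hgm, hgf⟩ := h.exists_isometry hf
    (w' := ![a • w 0 + b • w 2, -(a • w 1 + b • w 3), a • w 2 - b • w 0, b • w 1 - a • w 3])
    (by
      constructor <;> simp [h.h01, h.h23, h.h02, h.h03, h.h12, h.h13, hs h.h01, hs h.h23, hs h.h02,
        hs h.h03, hs h.h12, hs h.h13, hf.self_eq_zero] <;>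
        first | linear_combination -hab | ring)
    (fun i => by
      have hsm : ∀ (c : K) i, c • w i ∈ Submodule.span K (Set.range w) := fun c i =>
        Submodule.smul_mem _ c (hm i)
      fin_cases i
      exacts [add_mem (hsm _ 0) (hsm _ 2), neg_mem (add_mem (hsm _ 1) (hsm _ 3)),
        sub_mem (hsm _ 2) (hsm _ 0), sub_mem (hsm _ 1) (hsm _ 3)])
  have p0 : φ (w 0) = w 2 := hφ 0
  have p1 : φ (w 1) = w 3 + w 2 := hφ 1
  have p2 : φ (w 2) = -w 0 := hφ 2
  have p3 : φ (w 3) = -w 1 - w 0 := hφ 3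
  have g0 : g (w 0) = a • w 0 + b • w 2 := hg 0
  have g1 : g (w 1) = -(a • w 1 + b • w 3) := hg 1
  have g2 : g (w 2) = a • w 2 - b • w 0 := hg 2
  have g3 : g (w 3) = b • w 1 - a • w 3 := hg 3
  have hsq : ∀ u ∈ Submodule.span K (Set.range w), (φ * φ + 1) ((φ * φ + 1) u) = 0 := by
    refine eqOn_span_range (S := (φ * φ + 1) * (φ * φ + 1)) (T := 0) fun i => ?_
    fin_cases i <;> simp [p0, p1, p2, p3] <;> abel
  have q0 : (φ * φ + 1) (w 0) = 0 := by simp [p0, p2]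
  have q1 : (φ * φ + 1) (w 1) = (-2 : K) • w 0 := by simp [p1, p2, p3]; module
  have q2 : (φ * φ + 1) (w 2) = 0 := by simp [p0, p2]
  have q3 : (φ * φ + 1) (w 3) = (-2 : K) • w 2 := by simp [p0, p1, p3]; module
  refine ⟨φ, g, hφm, hgm, hφf, hgf, ?_, ?_, ?_⟩
  · refine eqOn_span_range (S := φ * g * φ) (T := -g) fun i => ?_
    fin_cases i <;> simp [p0, p1, p2, p3, g0, g1, g2, g3] <;> module
  · refine jordanCount_eq_zero_of_injOn (fun u hu => sub_mem (hφm u hu) (Submodule.smul_mem _ _ hu))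
      (fun u hu h0 => eq_zero_of_apply_eq_smul (Q := φ * φ + 1) h2 ?_ (hsq u hu)) 1
    have h1 : φ u = u := by simpa [sub_eq_zero] using h0
    rw [LinearMap.add_apply, Module.End.mul_apply, h1, h1, Module.End.one_apply, two_smul]
  · rw [jordanCount_of_pow_eq_zero (fun u hu => by rw [sq]; exact hsq u hu), pow_one]
    have hmap : (Submodule.span K (Set.range w)).map (φ * φ + 1) =
        Submodule.span K (Set.range ![w 0, w 2]) := by
      refine le_antisymm ?_ ?_
      · rw [Submodule.map_span_le]
        rintro _ ⟨i, rfl⟩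
        fin_cases i
        · exact q0 ▸ zero_mem _
        · exact q1 ▸ Submodule.smul_mem _ _ (Submodule.subset_span ⟨0, rfl⟩)
        · exact q2 ▸ zero_mem _
        · exact q3 ▸ Submodule.smul_mem _ _ (Submodule.subset_span ⟨1, rfl⟩)
      · rw [Submodule.span_le]
        have hinv : (-2 : K)⁻¹ * -2 = 1 := inv_mul_cancel₀ (neg_ne_zero.2 h2)
        rintro _ ⟨i, rfl⟩
        fin_cases i
        · exact ⟨(-2 : K)⁻¹ • w 1, Submodule.smul_mem _ _ (hm 1), by
            rw [map_smul, q1, smul_smul, hinv, one_smul]; rfl⟩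
        · exact ⟨(-2 : K)⁻¹ • w 3, Submodule.smul_mem _ _ (hm 3), by
            rw [map_smul, q3, smul_smul, hinv, one_smul]; rfl⟩
    have hli : LinearIndependent K ![w 0, w 2] := by
      rw [LinearIndependent.pair_iff]
      intro c d hcd
      have e1 := congrArg (f · (w 1)) hcd
      have e2 := congrArg (f · (w 3)) hcd
      simp [h.h01, h.h23, h.h03, hs h.h12] at e1 e2
      exact ⟨e1, e2⟩
    rw [hmap, finrank_span_eq_card hli, Fintype.card_fin]
    rfl

/-- On any nondegenerate subspace an isometry of square `-1` contributes nothing to either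
count; it fills up the orthogonal complement of the two quadruples. -/
theorem IsNondegOn.exists_isNegInvertingPair_zero_zero [FiniteDimensional K V] [NeZero (2 : K)]
    (hsum : ∀ a : K, a ≠ 0 → ∃ x y : K, x ^ 2 + a * y ^ 2 = -1) (hf : f.IsAlt)
    {W : Submodule K V} (hW : IsNondegOn f W) :
    ∃ φ g, IsNegInvertingPair f W 0 0 φ g := by
  have hz : ∀ j, ((0 : Module.End K V) ^ (j + 1)) = 0 := fun j => zero_pow j.succ_ne_zero
  have hc0 : ∀ j, jordanCount (0 : Module.End K V) W (j + 1) = 0 := fun j => by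
    rw [jordanCount_of_pow_eq_zero (fun x _ => by rw [hz]; rfl), hz, Submodule.map_zero,
      finrank_bot, Nat.cast_zero]
  obtain ⟨s, hs⟩ := exists_isTwist_of_nilpotent hsum hf (D := 0) (by simp) hW (by simp)
    ⟨1, by simp⟩ (Or.inr fun j hj => by
      obtain ⟨j, rfl⟩ := Nat.exists_eq_add_of_le' hj.pos
      rw [hc0]
      exact Even.zero)
  have hsq : ∀ u ∈ W, s (s u) = -u := fun u hu => by rw [hs.sq u hu, neg_one_smul]
  refine ⟨s, 1, hs.mapsTo, fun u hu => hu, fun u hu v hv => by rw [hs.form u hu v hv, one_mul],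
    fun _ _ _ _ => rfl, hsq, ?_, ?_⟩
  · refine jordanCount_eq_zero_of_injOn (fun u hu => sub_mem (hs.mapsTo u hu) (W.smul_mem _ hu))
      (fun u hu h0 => ?_) 1
    have h1 : s u = u := by simpa [sub_eq_zero] using h0
    have h3 := hsq u hu
    rw [h1, h1] at h3
    have h4 : (2 : K) • u = 0 := by rw [two_smul]; nth_rw 2 [h3]; exact add_neg_cancel u
    exact (smul_eq_zero.1 h4).resolve_left (NeZero.ne 2)
  · rw [jordanCount_congr (T := 0) (by simp) (fun u hu => by simp [hsq u hu]), hc0]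

theorem Sp.exists_isConj_neg_inv [FiniteDimensional K V] [NeZero (2 : K)]
    (hsum : ∀ a : K, a ≠ 0 → ∃ x y : K, x ^ 2 + a * y ^ 2 = -1) (hsq : ¬ IsSquare (-1 : K))
    (hf : f.IsAlt) (hf' : f.Nondegenerate) (h8 : 8 ≤ Module.finrank K V) :
    ∃ φ : Sp f, IsConj φ (-φ⁻¹) ∧ Sp.elemDivMult φ ((X ^ 2 + 1) ^ 2) = 1 ∧
      Sp.elemDivMult φ ((X - 1) ^ 2) = 1 := by
  have htop := isNondegOn_top hf'
  obtain ⟨w, hw, -⟩ := htop.exists_hyperbolicQuadruple hf (by rw [finrank_top]; omega)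
  have hnd := hw.isNondegOn hf
  have hnd' := hnd.compl hf.isRefl htop le_top
  obtain ⟨w', hw', hmem⟩ := hnd'.exists_hyperbolicQuadruple hf (by
    have h1 := Submodule.finrank_add_le_finrank_add_finrank (Submodule.span K (Set.range w))
      (⊤ ⊓ f.orthogonal (Submodule.span K (Set.range w)))
    rw [hnd.sup_compl hf.isRefl le_top, finrank_top] at h1
    have hr := finrank_range_le_card (R := K) w
    rw [Fintype.card_fin, Set.finrank] at hr
    omega)
  have hle : Submodule.span K (Set.range w') ≤
      ⊤ ⊓ f.orthogonal (Submodule.span K (Set.range w)) := by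
    rw [Submodule.span_le]
    rintro _ ⟨i, rfl⟩
    exact hmem i
  have hnd₂ := hw'.isNondegOn hf
  obtain ⟨a, b, hab⟩ := hsum 1 one_ne_zero
  rw [one_mul] at hab
  obtain ⟨φ₁, g₁, h₁⟩ := hw.exists_isNegInvertingPair_one_zero hf
  obtain ⟨φ₂, g₂, h₂⟩ := hw'.exists_isNegInvertingPair_zero_two hf hab
  obtain ⟨φ₃, g₃, h₃⟩ := (hnd₂.compl hf.isRefl hnd' hle).exists_isNegInvertingPair_zero_zero hsum hf
  obtain ⟨φ₄, g₄, h₄⟩ := h₂.glue hf.isRefl hnd₂ hle h₃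
  obtain ⟨φ, g, h⟩ := h₁.glue hf.isRefl hnd le_top h₄
  have key : ∀ s : Module.End K V, (∀ u v, f (s u) (s v) = f u v) → ∃ σ : Sp f, Sp.toEnd σ = s := by
    intro s hs
    have hinj : Function.Injective s := by
      rw [← LinearMap.ker_eq_bot, LinearMap.ker_eq_bot']
      intro u hu
      refine hf'.1 u fun v => ?_
      rw [← hs, hu, map_zero, LinearMap.zero_apply]
    exact ⟨⟨LinearEquiv.ofInjectiveEndo s hinj, hs⟩, LinearMap.ext fun _ => rfl⟩
  obtain ⟨φ, rfl⟩ := key φ fun u v => h.form u Submodule.mem_top v Submodule.mem_top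
  obtain ⟨g, rfl⟩ := key g fun u v => h.form' u Submodule.mem_top v Submodule.mem_top
  refine ⟨φ, isConj_iff.2 ⟨g, ?_⟩, ?_, ?_⟩
  · have h5 : φ * (g * φ) = -g :=
      Sp.toEnd_injective (LinearMap.ext fun u => h.rel u Submodule.mem_top)
    rw [mul_inv_eq_iff_eq_mul, Sp.neg_mul, eq_inv_mul_of_mul_eq h5, Sp.mul_neg]
  · have h5 := Sp.elemDivMult_mul_natDegree φ (irreducible_X_sq_add_one hsq)
      monic_X_sq_add_one 1
    have h6 : aeval (Sp.toEnd φ) (X ^ 2 + 1 : K[X]) = Sp.toEnd φ * Sp.toEnd φ + 1 := by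
      simp [sq]
    rw [natDegree_X_sq_add_one, h6, h.count_sq_add_one] at h5
    push_cast at h5
    omega
  · have h5 := Sp.elemDivMult_X_sub_C φ 1 1
    rw [h.count_sub_one, C_1] at h5
    exact_mod_cast h5

end Example

theorem mainTheorem4 {K V : Type*} [Field K] [Finite K] [AddCommGroup V] [Module K V]
    [FiniteDimensional K V] (f : LinearMap.BilinForm K V) (hf : f.IsAlt) (hf' : f.Nondegenerate)
    (q n : ℕ) (hq : Nat.card K = q) (hchar : ringChar K ≠ 2) (hn : Module.finrank K V = 2 * n) :
    (q ≡ 3 [MOD 4] → ∀ φ : Sp f,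
      (IsReversible (Sp.toPSp φ) ∧ ¬ IsBireflectional (Sp.toPSp φ)) ↔
        (IsConj φ (-φ⁻¹) ∧
          (∃ t : ℕ, 1 ≤ t ∧ Odd (Sp.elemDivMult φ ((X ^ 2 + 1) ^ (2 * t)))) ∧
          (∃ t : ℕ, 1 ≤ t ∧ Odd (Sp.elemDivMult φ ((X - 1) ^ (2 * t)))))) ∧
    ((∃ g : PSp f, IsReversible g ∧ ¬ IsBireflectional g) ↔
      (q ≡ 3 [MOD 4] ∧ 8 ≤ 2 * n)) := by
  have : NeZero (2 : K) := ⟨Ring.two_ne_zero hchar⟩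
  have hiff : q ≡ 3 [MOD 4] ↔ ¬ IsSquare (-1 : K) := by
    cases nonempty_fintype K
    rw [FiniteField.isSquare_neg_one_iff, ← Nat.card_eq_fintype_card, hq, not_not]
    rfl
  have ha := fun (hsq : ¬ IsSquare (-1 : K)) (φ : Sp f) =>
    Sp.isReversible_and_not_isBireflectional_iff hchar hsq hf hf' φ
  refine ⟨fun h φ => ha (hiff.1 h) φ, fun ⟨g, hg⟩ => ?_, fun ⟨h, h8⟩ => ?_⟩
  · obtain ⟨φ, rfl⟩ := Sp.toPSp_surjective g
    -- if `-1` is a square, every `φ` is inverted by some `s` with `s ^ 2 = -1`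
    have hsq : ¬ IsSquare (-1 : K) := fun hsq => by
      obtain ⟨s, hs, hsφ⟩ := Sp.exists_inverting hchar hf hf' φ (Or.inl hsq)
      exact hg.2 ((Sp.isBireflectional_toPSp_iff φ).2 ⟨s, Or.inr hs, Or.inl hsφ⟩)
    obtain ⟨hc, ⟨t₂, h₂, ho₂⟩, t₁, h₁, ho₁⟩ := (ha hsq φ).1 hg
    refine ⟨hiff.2 hsq, ?_⟩
    rw [← hn]
    exact Sp.eight_le_finrank hsq hc h₁ h₂ ho₁ ho₂
  · have hsq := hiff.1 h
    obtain ⟨φ, hc, h1, h2⟩ := Sp.exists_isConj_neg_inv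
      (fun a ha => exists_sq_add_mul_sq hchar ha (-1)) hsq hf hf' (hn ▸ h8)
    exact ⟨Sp.toPSp φ, (ha hsq φ).2 ⟨hc, ⟨1, le_rfl, by rw [mul_one, h1]; exact odd_one⟩,
      1, le_rfl, by rw [mul_one, h2]; exact odd_one⟩⟩
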